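/- **Theorem 6.2 (Global existence and uniqueness).** Let $\gamma\in\,]0,1]$, $N=\lfloor 1/\gamma\rfloor$, $T>0$, and let $\mathcal H=\bigoplus_{n=0}^N\mathcal H_n$ be a real $N$-truncated connected graded commutative Hopf algebra: the $\mathcal H_n$ are finite-dimensional, $\dim\mathcal H_0=1$, the product is graded, associative, commutative and unital, the coproduct $\Delta$ is graded, coassociative and counital with counit $\epsilon$, and $\Delta(xy)-\Delta(x)\Delta(y)\in\bigoplus_{p+q\ge N+1}\mathcal H_p\otimes\mathcal H_q$ for all $x,y$. Let $\mathcal H$ carry a nondegenerate homogeneous pairing $\langle-,-\rangle$ and linear maps $L_1,\dots,L_d$, homogeneous of degree one, such that $(L_i(\mathbf 1))_{i}$ is a basis of $\mathcal H_1$ and, for homogeneous $x,y$ of degree at most $N-1$, $$\Delta L_i(x)=(\mathrm{Id}\otimes L_i)\Delta(x)+L_i(x)\otimes\mathbf 1,\qquad \langle L_i(x),L_j(y)\rangle=\delta_{ij}\langle x,y\rangle .$$ Fix a norm on $\mathcal H$; let $\star$ be the product on $\mathcal H^*$ dual to $\Delta$, and let $\pi_j$ be the projection to degree $j$. Let $\omega$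 be a control on $\{0\le s\le t\le T\}$ (finite, nonnegative, null on the diagonal, and superadditive: $\omega(s,u)+\omega(u,t)\le\omega(s,t)$) which is right-continuous: $\omega(s,t_+)=\omega(s,t)$. Let $\mathbf X=(\mathbf X_{st})$ be an $N$-truncated rough path $\gamma$-adapted to $\omega$: each $\mathbf X_{st}\in\mathcal H^*$ satisfies $\mathbf X_{st}(\mathbf 1)=1$ and $\mathbf X_{st}(xy)=\mathbf X_{st}(x)\mathbf X_{st}(y)$ for homogeneous $x,y$ with $|x|+|y|\le N$; $\mathbf X_{st}|_{\mathcal H_1}=X_t-X_s$ for a path $X$ in $\mathcal H_1^*$; $\mathbf X_{st}=\mathbf X_{su}\star\mathbf X_{ut}$ for $s\le u\le t$; and $|\langle\mathbf X_{st},x\rangle|\le C\|x\|\,\omega(s,t)^{|x|\gamma}$ for homogeneous $x$. An $\mathbf X$-controlled rough path is a map $\mathbf Z:[0,T]\to\mathcal H^e$ whose remainder, defined by $\langle h,R_{st}\rangle=\langle h,\mathbf Z_t\rangle-\langle\mathbf X_{st}\star h,\mathbf Z_s\rangle$ for all $h\in\mathcal H^*$, satisfies $\|\pi_jR_{st}\|\le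 C\omega(s,t)^{(N-j)\gamma}$ for $0\le j\le N$ and $0\le s\le t\le T$ (with $0^0=1$). These paths form the space $\mathcal V_{\mathbf X}^{[0,T]}$. For $\varphi:\mathbb R^e\to\mathbb R^e$ of class $C^N$, the image $\varphi(\mathbf Z)$ is the $\mathcal H^e$-valued path $$\varphi(\mathbf Z)_s=\sum_{n=0}^N\frac{D^n\varphi(Z_s)}{n!}\big(\overline{\mathbf Z}_s,\dots,\overline{\mathbf Z}_s\big),\qquad Z_s=\epsilon(\mathbf Z_s),\quad \overline{\mathbf Z}_s=\mathbf Z_s-Z_s\mathbf 1,$$ where $D^n\varphi(Z_s)$ is extended to $\mathcal H^e$ through the product of $\mathcal H$. For a controlled rough path $\mathbf Y$ let $$\int_0^t\mathbf Y_s\,dX^i_s:=L_i(\mathbf Y_t)+\Big(\int_0^tY_s\,dX^i_s\Big)\mathbf 1,$$ where the rough integral $\int_0^tY_s\,dX_s^i\in\mathbb R^e$ is the limit along refinement of partitions of $[0,t]$ of the Riemann sums $\sum\langle\mathbf X_{uv},L_i(\mathbf Y_u)\rangle$. Let $\varphi_1,\dots,\varphi_d:\mathbb R^e\to\mathbb R^e$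 be of class $C^{N+1}$ (for instance smooth), bounded and with bounded derivatives up to order $N$. Then for every $\mathbf Z_0\in\mathcal H^e$ whose constant path belongs to $\mathcal V_{\mathbf X}^{[0,T]}$, and every $\xi\mathbf 1$ with $\xi\in\mathbb R^e$ is such a $\mathbf Z_0$, the equation $$\mathbf Z_t=\mathbf Z_0+\sum_{i=1}^d\int_0^t\varphi_i(\mathbf Z)_s\,dX^i_s,\qquad t\in[0,T],$$ (in which the symbol $\mathbf Z_0$ denotes this given constant) has a solution $\mathbf Z$ in $\mathcal V_{\mathbf X}^{[0,T]}$ on the whole interval $[0,T]$, in the sense that all the rough integrals exist and the equation holds, and this solution is unique. -/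

import Mathlib

open scoped TensorProduct
open Set Filter Topology

namespace RoughHopf

section Algebra

variable {H : Type*} [CommRing H] [Algebra ℝ H]

/-- The subspace `H_p ⊗ H_q` of `H ⊗ H`. -/
def bidegree (𝒜 : ℕ → Submodule ℝ H) (p q : ℕ) : Submodule ℝ (H ⊗[ℝ] H) :=
  LinearMap.range (TensorProduct.mapIncl (𝒜 p) (𝒜 q))

variable [Coalgebra ℝ H]

/-- `H = ⨁ H_n` (with `H_n = 𝒜 n`) is an `N`-truncated connected graded commutative Hopf algebra.
The graded, associative, commutative, unital product and the coassociative, counital coproduct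
are those of the ambient instances `CommRing`, `Algebra`, `GradedAlgebra` and `Coalgebra`.
The product of `H ⊗ H` is the componentwise one, so that `comul x * comul y` is
`(μ ⊗ μ) τ₂₃ (Δ x ⊗ Δ y)`. -/
structure IsTruncatedHopf (𝒜 : ℕ → Submodule ℝ H) [GradedAlgebra 𝒜] (N : ℕ) : Prop where
  finite : ∀ n, Module.Finite ℝ (𝒜 n)
  truncated : ∀ n, N < n → 𝒜 n = ⊥
  connected : Module.finrank ℝ (𝒜 0) = 1
  comul_graded : ∀ n, ∀ x ∈ 𝒜 n,
    Coalgebra.comul (R := ℝ) x ∈ ⨆ (p : ℕ) (q : ℕ) (_ : p + q = n), bidegree 𝒜 p q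
  comul_mul : ∀ x y : H,
    Coalgebra.comul (R := ℝ) (x * y) - Coalgebra.comul (R := ℝ) x * Coalgebra.comul (R := ℝ) y
      ∈ ⨆ (p : ℕ) (q : ℕ) (_ : N + 1 ≤ p + q), bidegree 𝒜 p q

/-- A nondegenerate homogeneous pairing `B` on `H`, and degree-one cocycles `L i` such that the
`L i 1` form a basis of `H_1` and `⟨L i x, L j y⟩ = δ_ij ⟨x, y⟩`.
An element of top degree `N` is sent to `0` by `L i`; the cocycle identity and the orthogonality
relation are therefore those of the elements `x`, `y` of degree `< N`. -/
structure IsCocycleSystem (𝒜 : ℕ → Submodule ℝ H) (N : ℕ) {d : ℕ}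
    (B : LinearMap.BilinForm ℝ H) (L : Fin d → H →ₗ[ℝ] H) : Prop where
  nondegenerate : B.Nondegenerate
  homogeneous : ∀ p q, p ≠ q → ∀ x ∈ 𝒜 p, ∀ y ∈ 𝒜 q, B x y = 0
  degree_one : ∀ i n, ∀ x ∈ 𝒜 n, L i x ∈ 𝒜 (n + 1)
  cocycle : ∀ i, ∀ n < N, ∀ x ∈ 𝒜 n,
    Coalgebra.comul (R := ℝ) (L i x)
      = (L i).lTensor H (Coalgebra.comul (R := ℝ) x) + L i x ⊗ₜ[ℝ] (1 : H)
  linearIndependent : LinearIndependent ℝ (fun i => L i 1)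
  span_eq : Submodule.span ℝ (Set.range fun i => L i 1) = 𝒜 1
  orthogonal : ∀ i j, ∀ p < N, ∀ q < N, ∀ x ∈ 𝒜 p, ∀ y ∈ 𝒜 q,
    B (L i x) (L j y) = if i = j then B x y else 0

/-- The convolution product `ξ ⋆ η` of two linear forms, the transpose of the coproduct. -/
noncomputable def conv (ξ η : Module.Dual ℝ H) : Module.Dual ℝ H :=
  LinearMap.mul' ℝ ℝ ∘ₗ TensorProduct.map ξ η ∘ₗ Coalgebra.comul

/-- The transpose `z ↦ (ξ ⊗ id) (Δ z)` of the operator `ξ ⋆ -`. -/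
noncomputable def act (ξ : Module.Dual ℝ H) : H →ₗ[ℝ] H :=
  (TensorProduct.lid ℝ H).toLinearMap ∘ₗ ξ.rTensor H ∘ₗ Coalgebra.comul

theorem pairing_act (ξ h : Module.Dual ℝ H) (z : H) : h (act ξ z) = conv ξ h z := by
  simp only [act, conv, LinearMap.comp_apply]
  generalize (Coalgebra.comul (R := ℝ) z) = w
  induction w using TensorProduct.induction_on with
  | zero => simp
  | tmul a b => simp
  | add a b ha hb => simp only [map_add, ha, hb]

/-- Truncated characters. -/
structure IsTruncatedCharacter (𝒜 : ℕ → Submodule ℝ H) (N : ℕ) (ξ : Module.Dual ℝ H) : Prop where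
  map_one : ξ 1 = 1
  map_mul : ∀ p q, p + q ≤ N → ∀ x ∈ 𝒜 p, ∀ y ∈ 𝒜 q, ξ (x * y) = ξ x * ξ y

/-- `bar z = z - ε(z) 1`. -/
noncomputable def bar (z : H) : H := z - algebraMap ℝ H (Coalgebra.counit (R := ℝ) z)

/-- The pairing of `z₁ ⊗ ... ⊗ zₙ` with the iterated reduced coproduct
`Δ_⋆^{red (n-1)} h = (Δ_⋆^red ⊗ id ⊗ ... ⊗ id) (Δ_⋆^{red (n-2)} h)`, where `Δ_⋆` is the transpose
of the product and `Δ_⋆^red h = Δ_⋆ h - ε ⊗ h - h ⊗ ε`. -/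
noncomputable def redPairing (h : Module.Dual ℝ H) : List H → ℝ
  | [] => 0
  | [x] => h x
  | x :: y :: l => redPairing h (x * y :: l)
      - Coalgebra.counit (R := ℝ) x * redPairing h (y :: l)
      - Coalgebra.counit (R := ℝ) y * redPairing h (x :: l)
termination_by l => l.length

/-- For `h(1) = 0` and a multiplicative counit (the case of truncated Hopf algebras), the pairing
above is `h` applied to the product of the `bar zₖ`. -/
theorem redPairing_eq (h : Module.Dual ℝ H) (h_one : h 1 = 0)
    (hmul : ∀ x y : H, Coalgebra.counit (R := ℝ) (x * y)
      = Coalgebra.counit (R := ℝ) x * Coalgebra.counit (R := ℝ) y) (l : List H) :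
    ∀ x : H, redPairing h (x :: l) = h (((x :: l).map bar).prod) := by
  induction l with
  | nil =>
    intro x
    simp [redPairing, bar, Algebra.algebraMap_eq_smul_one, h_one]
  | cons y l ih =>
    intro x
    have key : ((x :: y :: l).map bar).prod = ((x * y :: l).map bar).prod
        - Coalgebra.counit (R := ℝ) x • ((y :: l).map bar).prod
        - Coalgebra.counit (R := ℝ) y • ((x :: l).map bar).prod := by
      simp only [List.map_cons, List.prod_cons, bar, hmul, Algebra.smul_def, _root_.map_mul]
      ring
    rw [redPairing, ih, ih, ih, key]
    simp only [map_sub, map_smul, smul_eq_mul]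

end Algebra

section Controls

/-- `ω` is a control on `Δ_T = {(s,t) : 0 ≤ s ≤ t ≤ T}`. -/
structure IsControl (T : ℝ) (ω : ℝ → ℝ → ℝ) : Prop where
  nonneg : ∀ s t, 0 ≤ s → s ≤ t → t ≤ T → 0 ≤ ω s t
  diag : ∀ t, 0 ≤ t → t ≤ T → ω t t = 0
  superadditive : ∀ s u t, 0 ≤ s → s ≤ u → u ≤ t → t ≤ T → ω s u + ω u t ≤ ω s t

/-- `ω(s, t+) = ω(s, t)` for all `0 ≤ s ≤ t ≤ T`. -/
def IsRightContinuous (T : ℝ) (ω : ℝ → ℝ → ℝ) : Prop :=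
  ∀ s t, 0 ≤ s → s ≤ t → t ≤ T → Tendsto (ω s) (𝓝[Ioc t T] t) (𝓝 (ω s t))

end Controls

section Integration

/-- The sum of `Ξ u v` over consecutive entries `u, v` of a list. -/
def chainSum {V : Type*} [AddCommMonoid V] (Ξ : ℝ → ℝ → V) : List ℝ → V
  | [] => 0
  | [_] => 0
  | u :: v :: l => Ξ u v + chainSum Ξ (v :: l)

/-- `P` is the set of points of a finite partition of `[s, t]`. -/
def IsPartition (s t : ℝ) (P : Finset ℝ) : Prop :=
  s ∈ P ∧ t ∈ P ∧ ∀ u ∈ P, u ∈ Icc s t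

/-- `K` is the limit of the Riemann sums of `Ξ` over the partitions of `[s, t]`, in the sense of
refinement Riemann-Stieltjes convergence. -/
def HasRRSLimit {V : Type*} [NormedAddCommGroup V] (Ξ : ℝ → ℝ → V) (s t : ℝ) (K : V) : Prop :=
  ∀ ε > 0, ∃ P₀ : Finset ℝ, IsPartition s t P₀ ∧
    ∀ P : Finset ℝ, IsPartition s t P → P₀ ⊆ P → ‖chainSum Ξ (P.sort (· ≤ ·)) - K‖ < ε

end Integration

section RoughPaths

variable {H : Type*} [CommRing H] [Algebra ℝ H] [Coalgebra ℝ H]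

/-- `X` is an `N`-truncated rough path `γ`-adapted to `ω`, above the path `x` in the dual of `H_1`.
Here `nrm` is a norm on `H`. The estimate in degree one says that `x` is `γ`-adapted to `ω`. -/
structure IsRoughPath (𝒜 : ℕ → Submodule ℝ H) (nrm : Seminorm ℝ H) (N : ℕ) (γ T : ℝ)
    (ω : ℝ → ℝ → ℝ) (x : ℝ → Module.Dual ℝ (𝒜 1)) (X : ℝ → ℝ → Module.Dual ℝ H) : Prop where
  character : ∀ s t, 0 ≤ s → s ≤ t → t ≤ T → IsTruncatedCharacter 𝒜 N (X s t)
  above : ∀ s t, 0 ≤ s → s ≤ t → t ≤ T → ∀ h : 𝒜 1, X s t h = x t h - x s h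
  chen : ∀ s u t, 0 ≤ s → s ≤ u → u ≤ t → t ≤ T → X s t = conv (X s u) (X u t)
  bound : ∃ C : ℝ, ∀ s t, 0 ≤ s → s ≤ t → t ≤ T → ∀ n, ∀ h ∈ 𝒜 n,
    |X s t h| ≤ C * nrm h * ω s t ^ ((n : ℝ) * γ)

/-- The remainder `R_X(Z)_{st} = Z_t - (transpose of X_{st} ⋆ -) Z_s` in `H^e`, that is
`⟨h, R_X(Z)_{st}⟩ = ⟨h, Z_t⟩ - ⟨X_{st} ⋆ h, Z_s⟩` for all linear forms `h`. -/
noncomputable def remainder {e : ℕ} (X : ℝ → ℝ → Module.Dual ℝ H) (Z : ℝ → Fin e → H)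
    (s t : ℝ) (m : Fin e) : H :=
  Z t m - act (X s t) (Z s m)

/-- The space of `X`-controlled rough paths on `[0, T]`: the paths `Z` in `H^e` such that
`‖π_j (R_X(Z)_{st})‖ ≤ C ω(s,t)^{(N-j)γ}` for `0 ≤ s ≤ t ≤ T` and `0 ≤ j ≤ N`.
Paths are functions on `ℝ` of which only the restriction to `[0, T]` matters. -/
def controlledPaths (𝒜 : ℕ → Submodule ℝ H) [GradedAlgebra 𝒜] (nrm : Seminorm ℝ H) (N : ℕ)
    (γ T : ℝ) (ω : ℝ → ℝ → ℝ) (X : ℝ → ℝ → Module.Dual ℝ H) (e : ℕ) : Set (ℝ → Fin e → H) :=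
  {Z | ∃ C : ℝ, ∀ s t, 0 ≤ s → s ≤ t → t ≤ T → ∀ j ≤ N, ∀ m,
    nrm (DirectSum.decompose 𝒜 (remainder X Z s t m) j : H) ≤ C * ω s t ^ (((N : ℝ) - j) * γ)}

/-- The image `φ(z)` in `H^e` of `z` in `H^e` under a map `φ` of class `C^N` from `ℝ^e` to `ℝ^e`:
`φ(z) = ∑_{n ≤ N} (1/n!) D^n φ(ε(z)) (bar z, ..., bar z)`, the `n`-th differential being extended
to `H^e` by multilinearity through the product of `H`. By transposition this is
`⟨h, φ(z)⟩ = ∑_{n=1}^N (1/n!) D^n φ(ε(z)) ⟨Δ_⋆^{red (n-1)} h, z^{⊗ n}⟩` when `h(1) = 0`,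
see `redPairing_eq`, and `⟨ε, φ(z)⟩ = φ(ε(z))`. -/
noncomputable def smoothImage {e : ℕ} (N : ℕ) (φ : (Fin e → ℝ) → (Fin e → ℝ))
    (z : Fin e → H) (m : Fin e) : H :=
  ∑ n ∈ Finset.range (N + 1), ((n.factorial : ℝ)⁻¹) •
    ∑ J : Fin n → Fin e,
      (iteratedFDeriv ℝ n φ (fun k => Coalgebra.counit (R := ℝ) (z k))
        (fun k => Pi.single (J k) (1 : ℝ)) m) • ∏ k, bar (z (J k))

/-- `K` is the rough integral from `s` to `t` of (the base path of) `Y` against the `i`-th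
component of `X`, with `Li` the `i`-th cocycle: the limit of the Riemann sums of
`(u, v) ↦ ⟨X_{uv}, Li (Y_u)⟩`. -/
def HasRoughIntegral {e : ℕ} (X : ℝ → ℝ → Module.Dual ℝ H) (Li : H →ₗ[ℝ] H)
    (Y : ℝ → Fin e → H) (s t : ℝ) (K : Fin e → ℝ) : Prop :=
  HasRRSLimit (fun u v (m : Fin e) => X u v (Li (Y u m))) s t K

/-- `Z` solves `Z_t = c + ∑_i ∫_0^t φ_i(Z)_s dX^i_s` in `H^e` for all `t` in `[0, T]`, where
`∫_0^t Y_s dX^i_s = L_i(Y_t) + K 1` with `K` the rough integral in `ℝ^e` of `Y` from `0` to `t`. -/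
def IsSolution {d e : ℕ} (N : ℕ) (T : ℝ) (X : ℝ → ℝ → Module.Dual ℝ H)
    (L : Fin d → H →ₗ[ℝ] H) (φ : Fin d → (Fin e → ℝ) → (Fin e → ℝ)) (c : Fin e → H)
    (Z : ℝ → Fin e → H) : Prop :=
  ∃ K : Fin d → ℝ → Fin e → ℝ,
    (∀ i, ∀ t ∈ Icc 0 T,
      HasRoughIntegral X (L i) (fun s => smoothImage N (φ i) (Z s)) 0 t (K i t)) ∧
    ∀ t ∈ Icc 0 T, ∀ m,
      Z t m = c m + ∑ i, (L i (smoothImage N (φ i) (Z t) m) + K i t m • (1 : H))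

end RoughPaths

end RoughHopf

/-!
Write `z = ε(Z)` for the real part of a solution `Z`, and `act X_st` for the transpose of left
multiplication by `X_st`, so that the remainder of `Z` is `Z_t - act X_st Z_s`.

**Reduction to `ℝ^e`.** The equation says that `Z_t` is a fixed point of the map
`w ↦ bar c + z_t 1 + ∑ L_i φ_i(w)`, where `bar c` is `c` without its real part, and that `z_t` is
given by rough integrals. As `L_i` raises degrees by one, this map has exactly one fixed point
`F(z_t)`, reached after finitely many iterations, and `F` is Lipschitz
(`IsDriver.exists_section`). Only the real part is unknown.

**Estimates.** The bounds `‖π_j h‖ ≤ C ω^{(N-j)γ}` for `j ≤ N` amount to the single bound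
`P r h ≤ C' r^N` at `r = ω^γ`, for the weighted norms `P r h = C₀ ∑ r^j ‖π_j h‖`
(`wnorm`, `IsScale`, `HasOrder`). For a suitable `C₀` all of them are algebra norms, `L_i` gains a factor `r`, and
`act X_st` is bounded and is multiplicative up to `r^N`, because `X_st` is a truncated character.
Taylor's formula (`lift_taylor`) then shows that the image under a function of class `C^N` commutes
with `act X_st` up to `r^N` (`IsScale.ev_sub_map_le`), that is, smooth functions preserve
controlled paths.

**Rough integrals.** Chen's relation and the cocycle identity turn the defect
`X_st(L y) - X_su(L y) - X_ut(L y')` of a germ into `-X_ut(L ρ)` with `ρ = y' - act X_su y`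
(`IsDriver.defect_le`). When `P r ρ ≤ C r^N`, this is at most a constant times
`ω(s,u)^γ ω(s,t)^{Nγ}`, of total exponent
`(N+1)γ > 1`; the factor `ω(s,u)^γ` comes from the fact that `L` kills the component of degree `N`.
It is small on fine partitions even where `ω` jumps at the right end point `t`: right-continuity of
`ω` gives partitions whose intervals, with their right end point removed, have small control, and
the Riemann sums converge (`SewingBound.hasRRSLimit`).

**Existence.** By the same estimates `Ξ_st(x) = ∑ X_st(L_i φ_i(F x))` is an almost flow on `ℝ^e`.
Its Euler schemes satisfy a bound uniform in the partition, and a limit point `z` of them follows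
the flow (`exists_path_of_isAlmostFlow`); then `Z = F(z)` is a solution on all of `[0, T]`, since
the bounds on the `φ_i` are global (`IsDriver.exists_evSolution`). The rough integral of a
controlled path is obtained from the same theorem, for a flow which does not depend on `x`
(`IsDriver.exists_integral`).

**Uniqueness.** The Riemann sums on `[0, t]` involve the solution before `t` only, so two solutions
which agree on `[0, t)` agree at `t`. By right-continuity `ω(t, b)` is small for `b > t` close to
`t`, and on such an interval `[t, b]` the distance of the solutions, together with that of their
remainders, is at most half of itself (`IsDriver.halving`). This rests on the Lipschitz dependence
of the remainder of `φ(Z)` on `Z` (`IsScale.ev_defect_sub_le`), where the derivative of order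
`N + 1` is used; it is continuous, hence bounded on a ball which contains both solutions.

A constant path `ξ 1` is controlled because its remainder is zero: `act X_st 1 = X_st(1) 1 = 1`.
-/

namespace RoughHopf

/-! ### Controls and almost flows -/

/-- `ω` is a control on the simplex `a ≤ s ≤ t ≤ b`. -/
structure IsControlOn (a b : ℝ) (ω : ℝ → ℝ → ℝ) : Prop where
  nonneg : ∀ s t, a ≤ s → s ≤ t → t ≤ b → 0 ≤ ω s t
  diag : ∀ t, a ≤ t → t ≤ b → ω t t = 0
  superadditive : ∀ s u t, a ≤ s → s ≤ u → u ≤ t → t ≤ b → ω s u + ω u t ≤ ω s t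

theorem IsControl.isControlOn {T : ℝ} {ω : ℝ → ℝ → ℝ} (h : IsControl T ω) :
    IsControlOn 0 T ω :=
  ⟨h.nonneg, h.diag, h.superadditive⟩

theorem IsControlOn.restrict {a b a' b' : ℝ} {ω : ℝ → ℝ → ℝ} (h : IsControlOn a b ω)
    (ha : a ≤ a') (hb : b' ≤ b) : IsControlOn a' b' ω :=
  ⟨fun s t h1 h2 h3 => h.nonneg s t (ha.trans h1) h2 (h3.trans hb),
    fun t h1 h2 => h.diag t (ha.trans h1) (h2.trans hb),
    fun s u t h1 h2 h3 h4 => h.superadditive s u t (ha.trans h1) h2 h3 (h4.trans hb)⟩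

theorem IsControlOn.mono {a b : ℝ} {ω : ℝ → ℝ → ℝ} (h : IsControlOn a b ω) {s s' t' t : ℝ}
    (h1 : a ≤ s) (h2 : s ≤ s') (h3 : s' ≤ t') (h4 : t' ≤ t) (h5 : t ≤ b) :
    ω s' t' ≤ ω s t := by
  have e1 := h.superadditive s s' t h1 h2 (h3.trans h4) h5
  have e2 := h.superadditive s' t' t (h1.trans h2) h3 h4 h5
  have e3 := h.nonneg s s' h1 h2 (by linarith)
  have e4 := h.nonneg t' t (by linarith) h4 h5
  linarith

/-- The increments `Ξ s t z` of an almost flow `z ↦ z + Ξ s t z`, with defect controlled by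
`ω(s,u)^γ ω(s,t)^{Nγ}`. The defect is compared at any point `z'` within `ω(s,u)^{Nγ}` of the image
of `z`; this form makes a separate Lipschitz condition on `Ξ` unnecessary. The factor
`ω(s,u)^γ`, which does not see a jump at `t`, is what allows discontinuous controls. -/
structure IsAlmostFlow {E : Type*} [NormedAddCommGroup E] (a b : ℝ) (ω : ℝ → ℝ → ℝ) (γ : ℝ)
    (N : ℕ) (K : ℝ) (Ξ : ℝ → ℝ → E → E) : Prop where
  bound : ∀ s t z, a ≤ s → s ≤ t → t ≤ b → ‖Ξ s t z‖ ≤ K * ω s t ^ γ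
  defect : ∀ s u t z z', a ≤ s → s ≤ u → u ≤ t → t ≤ b →
    ‖z' - z - Ξ s u z‖ ≤ (ω s u ^ γ) ^ N →
    ‖Ξ s t z - Ξ s u z - Ξ u t z'‖ ≤ K * (ω s u ^ γ * (ω s t ^ γ) ^ N)

/-- `y` is an Euler scheme for `Ξ` along the finite set of times `P`. -/
def IsEuler {E : Type*} [AddCommGroup E] (P : Finset ℝ) (Ξ : ℝ → ℝ → E → E) (y : ℝ → E) : Prop :=
  ∀ s ∈ P, ∀ t ∈ P, s < t → (∀ r ∈ P, s < r → t ≤ r) → y t = y s + Ξ s t (y s)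

theorem exists_isEuler {E : Type*} [AddCommGroup E] (Ξ : ℝ → ℝ → E → E) (t₀ : ℝ) (z₀ : E)
    (P : Finset ℝ) : (∀ r ∈ P, t₀ ≤ r) → ∃ y : ℝ → E, y t₀ = z₀ ∧ IsEuler P Ξ y := by
  induction P using Finset.induction_on_max with
  | empty => exact fun _ => ⟨fun _ => z₀, rfl, by simp [IsEuler]⟩
  | insert a P ha ih =>
    intro hP
    rcases P.eq_empty_or_nonempty with rfl | hne
    · refine ⟨fun _ => z₀, rfl, ?_⟩
      intro s hs t ht hst
      simp only [Finset.mem_insert, Finset.notMem_empty, or_false] at hs ht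
      exact absurd hst (by simp [hs, ht])
    · obtain ⟨y, hy0, hy⟩ := ih fun r hr => hP r (Finset.mem_insert_of_mem hr)
      set m := P.max' hne with hm
      have hmP : m ∈ P := P.max'_mem hne
      refine ⟨Function.update y a (y m + Ξ m a (y m)), ?_, ?_⟩
      · have : t₀ ≠ a := ((hP m (Finset.mem_insert_of_mem hmP)).trans_lt (ha m hmP)).ne
        rw [Function.update_of_ne this, hy0]
      · intro s hs t ht hst hcons
        have hsa : s ≠ a := by
          rintro rfl
          rcases Finset.mem_insert.1 ht with h | h
          · exact hst.ne' h
          · exact (ha t h).not_gt hst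
        have hsP : s ∈ P := (Finset.mem_insert.1 hs).resolve_left hsa
        rw [Function.update_of_ne hsa]
        rcases Finset.mem_insert.1 ht with rfl | htP
        · have hsm : s = m := by
            by_contra hne'
            have hlt : s < m := lt_of_le_of_ne (P.le_max' s hsP) hne'
            exact (hcons m (Finset.mem_insert_of_mem hmP) hlt).not_gt (ha m hmP)
          rw [Function.update_self, hsm]
        · rw [Function.update_of_ne (ha t htP).ne]
          exact hy s hsP t htP hst fun r hr => hcons r (Finset.mem_insert_of_mem hr)

section Discrete

variable {E : Type*} [NormedAddCommGroup E] {a b : ℝ} {ω : ℝ → ℝ → ℝ} {γ : ℝ}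
  {N : ℕ} {K : ℝ} {Ξ : ℝ → ℝ → E → E} {P : Finset ℝ} {y : ℝ → E}

theorem IsAlmostFlow.self_eq_zero (hω : IsControlOn a b ω) (hγ : 0 < γ)
    (hΞ : IsAlmostFlow a b ω γ N K Ξ) {t : ℝ} (h1 : a ≤ t) (h2 : t ≤ b) (z : E) :
    Ξ t t z = 0 := by
  have := hΞ.bound t t z h1 le_rfl h2
  rw [hω.diag t h1 h2, Real.zero_rpow hγ.ne', mul_zero] at this
  exact norm_le_zero_iff.1 this

/-- The elementary step of the estimate of the error of an Euler scheme: the error on `[s, t]` is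
at most the sum of the errors on `[s, u]` and `[u, t]` and the defect at `u`. -/
theorem IsAlmostFlow.error_le (hΞ : IsAlmostFlow a b ω γ N K Ξ) {s u t : ℝ} (h1 : a ≤ s)
    (h2 : s ≤ u) (h3 : u ≤ t) (h4 : t ≤ b)
    (hsu : ‖y u - y s - Ξ s u (y s)‖ ≤ (ω s u ^ γ) ^ N) :
    ‖y t - y s - Ξ s t (y s)‖ ≤ ‖y u - y s - Ξ s u (y s)‖ + ‖y t - y u - Ξ u t (y u)‖
      + K * (ω s u ^ γ * (ω s t ^ γ) ^ N) := by
  have h := hΞ.defect s u t (y s) (y u) h1 h2 h3 h4 hsu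
  have e : y t - y s - Ξ s t (y s) = (y u - y s - Ξ s u (y s)) + (y t - y u - Ξ u t (y u))
      - (Ξ s t (y s) - Ξ s u (y s) - Ξ u t (y u)) := by abel
  rw [e]
  exact (norm_sub_le _ _).trans (add_le_add (norm_add_le _ _) h)

/-- The sewing estimate for an Euler scheme on an interval where the control is small. The scheme
is cut at two consecutive times between which the control passes the half of its total value. -/
theorem IsEuler.error_le_of_small (hω : IsControlOn a b ω) (hγ : 0 < γ)
    (hΞ : IsAlmostFlow a b ω γ N K Ξ) (hK : 0 ≤ K) (hP : ∀ r ∈ P, a ≤ r ∧ r ≤ b)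
    (hy : IsEuler P Ξ y) {A δ : ℝ} (hA : 0 ≤ A)
    (hA' : 2 * K + 2 * A * ((1 / 2 : ℝ) ^ γ) ^ (N + 1) ≤ A) (hδ : A * δ ^ γ ≤ 1) :
    ∀ n : ℕ, ∀ s ∈ P, ∀ t ∈ P, s ≤ t → (P.filter fun r => s < r ∧ r < t).card ≤ n →
      ω s t ≤ δ → ‖y t - y s - Ξ s t (y s)‖ ≤ A * (ω s t ^ γ) ^ (N + 1) := by
  intro n
  induction n using Nat.strong_induction_on with
  | _ n ih =>
  intro s hs t ht hst hcard hωδ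
  have has := (hP s hs).1
  have htb := (hP t ht).2
  have nonneg : ∀ {u v}, a ≤ u → u ≤ v → v ≤ b → 0 ≤ ω u v ^ γ := fun h1 h2 h3 =>
    Real.rpow_nonneg (hω.nonneg _ _ h1 h2 h3) _
  have hzero : ∀ u ∈ P, ‖y u - y u - Ξ u u (y u)‖ = 0 := fun u hu => by
    simp [hΞ.self_eq_zero hω hγ (hP u hu).1 (hP u hu).2]
  rcases hst.eq_or_lt with rfl | hlt
  · rw [hzero s hs]
    exact mul_nonneg hA (pow_nonneg (nonneg has le_rfl htb) _)
  have hst0 := hω.nonneg s t has hst htb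
  set S := P.filter fun r => s ≤ r ∧ r < t ∧ ω s r ≤ ω s t / 2 with hS
  have hsS : s ∈ S := by
    rw [hS, Finset.mem_filter, hω.diag s has (hst.trans htb)]
    exact ⟨hs, le_rfl, hlt, by linarith⟩
  set r := S.max' ⟨s, hsS⟩ with hr
  obtain ⟨hrP, hsr, hrt, hωr⟩ := Finset.mem_filter.1 (S.max'_mem ⟨s, hsS⟩)
  rw [← hr] at hrP hsr hrt hωr
  set S' := P.filter fun v => r < v with hS'
  have htS' : t ∈ S' := Finset.mem_filter.2 ⟨ht, hrt⟩
  set v := S'.min' ⟨t, htS'⟩ with hv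
  obtain ⟨hvP, hrv⟩ := Finset.mem_filter.1 (S'.min'_mem ⟨t, htS'⟩)
  rw [← hv] at hvP hrv
  have hvt : v ≤ t := S'.min'_le t htS'
  have hcons : y v = y r + Ξ r v (y r) := by
    refine hy r hrP v hvP hrv fun w hw hrw => S'.min'_le w (Finset.mem_filter.2 ⟨hw, hrw⟩)
  have hrv0 : ‖y v - y r - Ξ r v (y r)‖ = 0 := by rw [hcons]; simp
  have har : a ≤ r := has.trans hsr
  have hrb : r ≤ b := hrt.le.trans htb
  have hsv : s ≤ v := hsr.trans hrv.le
  -- the remaining part after `v` has at most half of the control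
  have hωv : ω v t ≤ ω s t / 2 := by
    rcases hvt.eq_or_lt with h | h
    · rw [h, hω.diag t (has.trans hst) htb]; linarith
    · have : ¬ ω s v ≤ ω s t / 2 := fun hle =>
        (S.le_max' v (Finset.mem_filter.2 ⟨hvP, hsv, h, hle⟩)).not_gt hrv
      have := hω.superadditive s v t has hsv hvt htb
      linarith
  have half : ∀ {x}, 0 ≤ x → x ≤ ω s t / 2 →
      A * (x ^ γ) ^ (N + 1) ≤ A * ((1 / 2 : ℝ) ^ γ) ^ (N + 1) * (ω s t ^ γ) ^ (N + 1) := by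
    intro x hx hx'
    rw [mul_assoc, ← mul_pow, ← Real.mul_rpow (by norm_num) hst0]
    refine mul_le_mul_of_nonneg_left (pow_le_pow_left₀ (Real.rpow_nonneg hx _) ?_ _) hA
    exact Real.rpow_le_rpow hx (by linarith) hγ.le
  have Jsr : ‖y r - y s - Ξ s r (y s)‖ ≤ A * (ω s r ^ γ) ^ (N + 1) := by
    rcases hsr.eq_or_lt with h | h
    · rw [← h, hzero s hs]
      exact mul_nonneg hA (pow_nonneg (nonneg has le_rfl (hst.trans htb)) _)
    · refine ih _ (lt_of_lt_of_le (Finset.card_lt_card ?_) hcard) s hs r hrP hsr le_rfl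
        (hωr.trans (by linarith))
      refine (Finset.ssubset_iff_of_subset fun w hw => ?_).2 ⟨r, ?_, ?_⟩
      · rw [Finset.mem_filter] at hw ⊢
        exact ⟨hw.1, hw.2.1, hw.2.2.trans hrt⟩
      · exact Finset.mem_filter.2 ⟨hrP, h, hrt⟩
      · simp
  have Jvt : ‖y t - y v - Ξ v t (y v)‖ ≤ A * (ω v t ^ γ) ^ (N + 1) := by
    rcases hvt.eq_or_lt with h | h
    · rw [h, hzero t ht]
      exact mul_nonneg hA (pow_nonneg (nonneg (has.trans hst) le_rfl htb) _)
    · refine ih _ (lt_of_lt_of_le (Finset.card_lt_card ?_) hcard) v hvP t ht hvt le_rfl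
        (hωv.trans (by linarith))
      refine (Finset.ssubset_iff_of_subset fun w hw => ?_).2 ⟨v, ?_, ?_⟩
      · rw [Finset.mem_filter] at hw ⊢
        exact ⟨hw.1, hsv.trans_lt hw.2.1, hw.2.2⟩
      · exact Finset.mem_filter.2 ⟨hvP, hsr.trans_lt hrv, h⟩
      · simp
  have lsr : ω s r ^ γ ≤ ω s t ^ γ :=
    Real.rpow_le_rpow (hω.nonneg _ _ has hsr hrb) (by linarith) hγ.le
  have lst1 : A * ω s t ^ γ ≤ 1 :=
    (mul_le_mul_of_nonneg_left (Real.rpow_le_rpow hst0 hωδ hγ.le) hA).trans hδ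
  have near : ‖y r - y s - Ξ s r (y s)‖ ≤ (ω s r ^ γ) ^ N := by
    refine Jsr.trans ?_
    rw [pow_succ, mul_comm _ (ω s r ^ γ), ← mul_assoc]
    refine mul_le_of_le_one_left (pow_nonneg (nonneg has hsr hrb) _) ?_
    exact (mul_le_mul_of_nonneg_left lsr hA).trans lst1
  have E1 := hΞ.error_le (y := y) has hsr hrt.le htb near
  have E2 := hΞ.error_le (y := y) har hrv.le hvt htb
    (by rw [hrv0]; exact pow_nonneg (nonneg har hrv.le (hvt.trans htb)) _)
  have bd : ∀ {u v w}, a ≤ u → s ≤ u → u ≤ v → v ≤ w → w ≤ t →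
      K * (ω u v ^ γ * (ω u w ^ γ) ^ N) ≤ K * (ω s t ^ γ) ^ (N + 1) := by
    intro u v w h1 h2 h3 h4 h5
    rw [pow_succ' (ω s t ^ γ)]
    have g1 : ω u v ^ γ ≤ ω s t ^ γ :=
      Real.rpow_le_rpow (hω.nonneg _ _ h1 h3 (h4.trans (h5.trans htb)))
        (hω.mono has h2 h3 (h4.trans h5) htb) hγ.le
    have g2 : ω u w ^ γ ≤ ω s t ^ γ :=
      Real.rpow_le_rpow (hω.nonneg _ _ h1 (h3.trans h4) (h5.trans htb))
        (hω.mono has h2 (h3.trans h4) h5 htb) hγ.le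
    have g0 := nonneg h1 (h3.trans h4) (h5.trans htb)
    exact mul_le_mul_of_nonneg_left (mul_le_mul g1 (pow_le_pow_left₀ g0 g2 _)
      (pow_nonneg g0 _) (nonneg has hst htb)) hK
  have B1 := bd has le_rfl hsr hrt.le le_rfl
  have B2 := bd har hsr hrv.le hvt le_rfl
  have H1 := half (hω.nonneg _ _ has hsr hrb) hωr
  have H2 := half (hω.nonneg _ _ (has.trans hsv) hvt htb) hωv
  have lpos : 0 ≤ (ω s t ^ γ) ^ (N + 1) := pow_nonneg (nonneg has hst htb) _
  have := mul_le_mul_of_nonneg_right hA' lpos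
  nlinarith

/-- The sewing estimate on an interval where the control is small except possibly for a jump at
the right end. -/
theorem IsEuler.error_le_of_small_left (hω : IsControlOn a b ω) (hγ : 0 < γ)
    (hΞ : IsAlmostFlow a b ω γ N K Ξ) (hK : 0 ≤ K) (hP : ∀ r ∈ P, a ≤ r ∧ r ≤ b)
    (hy : IsEuler P Ξ y) {A δ : ℝ} (hA : 0 ≤ A)
    (hA' : 2 * K + 2 * A * ((1 / 2 : ℝ) ^ γ) ^ (N + 1) ≤ A) (hδ : A * δ ^ γ ≤ 1)
    {s t ε : ℝ} (hs : s ∈ P) (ht : t ∈ P) (hst : s < t) (hε : ε ≤ δ)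
    (hsε : ∀ r ∈ P, s ≤ r → r < t → ω s r ≤ ε) :
    ‖y t - y s - Ξ s t (y s)‖ ≤ (A + K) * (ε ^ γ * (ω s t ^ γ) ^ N) := by
  have has := (hP s hs).1
  have htb := (hP t ht).2
  set S := P.filter fun r => r < t with hS
  have hsS : s ∈ S := Finset.mem_filter.2 ⟨hs, hst⟩
  set r := S.max' ⟨s, hsS⟩ with hr
  obtain ⟨hrP, hrt⟩ := Finset.mem_filter.1 (S.max'_mem ⟨s, hsS⟩)
  rw [← hr] at hrP hrt
  have hsr : s ≤ r := S.le_max' s hsS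
  have hrb : r ≤ b := hrt.le.trans htb
  have hcons : y t = y r + Ξ r t (y r) := by
    refine hy r hrP t ht hrt fun w hw hrw => ?_
    by_contra hlt
    exact (S.le_max' w (Finset.mem_filter.2 ⟨hw, not_le.1 hlt⟩)).not_gt hrw
  have hrt0 : ‖y t - y r - Ξ r t (y r)‖ = 0 := by rw [hcons]; simp
  have hωr := hsε r hrP hsr hrt
  have hsr0 := hω.nonneg s r has hsr hrb
  have l0 := Real.rpow_nonneg hsr0 γ
  have lε : ω s r ^ γ ≤ ε ^ γ := Real.rpow_le_rpow hsr0 hωr hγ.le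
  have lδ : ω s r ^ γ ≤ δ ^ γ := Real.rpow_le_rpow hsr0 (hωr.trans hε) hγ.le
  have lst : ω s r ^ γ ≤ ω s t ^ γ :=
    Real.rpow_le_rpow hsr0 (hω.mono has le_rfl hsr hrt.le htb) hγ.le
  have J := hy.error_le_of_small hω hγ hΞ hK hP hA hA' hδ _ s hs r hrP hsr le_rfl
    (hωr.trans hε)
  have near : ‖y r - y s - Ξ s r (y s)‖ ≤ (ω s r ^ γ) ^ N := by
    refine J.trans ?_
    rw [pow_succ, mul_comm _ (ω s r ^ γ), ← mul_assoc]
    exact mul_le_of_le_one_left (pow_nonneg l0 _)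
      ((mul_le_mul_of_nonneg_left lδ hA).trans hδ)
  have E1 := hΞ.error_le (y := y) has hsr hrt.le htb near
  have B1 : A * (ω s r ^ γ) ^ (N + 1) ≤ A * (ε ^ γ * (ω s t ^ γ) ^ N) := by
    rw [pow_succ']
    exact mul_le_mul_of_nonneg_left (mul_le_mul lε (pow_le_pow_left₀ l0 lst _)
      (pow_nonneg l0 _) (l0.trans lε)) hA
  have B2 : K * (ω s r ^ γ * (ω s t ^ γ) ^ N) ≤ K * (ε ^ γ * (ω s t ^ γ) ^ N) :=
    mul_le_mul_of_nonneg_left (mul_le_mul_of_nonneg_right lε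
      (pow_nonneg (l0.trans lst) _)) hK
  rw [hrt0] at E1
  linarith

end Discrete

/-- The two-parameter family `D` satisfies the bound of the sewing lemma: it is at most
`K ε^γ ω(s,t)^{Nγ}` as soon as `ω(s,r) ≤ ε` for all `r < t`, whatever the jump at `t`. -/
def SewingBound {E : Type*} [NormedAddCommGroup E] (a b : ℝ) (ω : ℝ → ℝ → ℝ) (γ : ℝ) (N : ℕ)
    (K : ℝ) (D : ℝ → ℝ → E) : Prop :=
  ∀ s t ε, a ≤ s → s < t → t ≤ b → 0 ≤ ε → (∀ r, s ≤ r → r < t → ω s r ≤ ε) →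
    ‖D s t‖ ≤ K * (ε ^ γ * (ω s t ^ γ) ^ N)

section Existence

variable {E : Type*} [NormedAddCommGroup E] {a b : ℝ} {ω : ℝ → ℝ → ℝ} {γ : ℝ}
  {N : ℕ} {K : ℝ}

theorem exists_sewing_constants (hγ : 0 < γ) (hθ : 1 < (N + 1) * γ) (hK : 0 ≤ K) :
    ∃ A δ : ℝ, 0 ≤ A ∧ 0 < δ ∧ 2 * K + 2 * A * ((1 / 2 : ℝ) ^ γ) ^ (N + 1) ≤ A ∧
      A * δ ^ γ ≤ 1 := by
  have hq : ((1 / 2 : ℝ) ^ γ) ^ (N + 1) < 1 / 2 := by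
    rw [← Real.rpow_natCast, ← Real.rpow_mul (by norm_num)]
    have h := Real.rpow_lt_rpow_of_exponent_gt (x := 1 / 2) (by norm_num) (by norm_num) hθ
    rw [Real.rpow_one] at h
    have e : γ * ((N + 1 : ℕ) : ℝ) = (N + 1) * γ := by push_cast; ring
    rwa [e]
  set q := ((1 / 2 : ℝ) ^ γ) ^ (N + 1)
  have hA : 0 ≤ 2 * K / (1 - 2 * q) := div_nonneg (by linarith) (by linarith)
  set A := 2 * K / (1 - 2 * q) with hAdef
  refine ⟨A, (1 / (A + 1)) ^ (1 / γ), hA, by positivity, ?_, ?_⟩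
  · have : A * (1 - 2 * q) = 2 * K := div_mul_cancel₀ _ (by linarith)
    linarith
  · rw [← Real.rpow_mul (by positivity), one_div_mul_cancel hγ.ne', Real.rpow_one, mul_one_div,
      div_le_one (by linarith)]
    linarith

/-- Uniform estimates for the Euler schemes of an almost flow. The whole interval is cut into at
most `ω(a,b)/δ + 1` pieces on which the control is small up to a jump at the right end. -/
theorem exists_euler_bounds (hγ : 0 < γ) (hθ : 1 < (N + 1) * γ) (hK : 0 ≤ K) {W : ℝ}
    (hW : 0 ≤ W) :
    ∃ K' C : ℝ, 0 ≤ K' ∧ ∀ (a b : ℝ) (ω : ℝ → ℝ → ℝ), IsControlOn a b ω → ω a b ≤ W →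
      ∀ (Ξ : ℝ → ℝ → E → E), IsAlmostFlow a b ω γ N K Ξ →
      ∀ (P : Finset ℝ) (y : ℝ → E), (∀ r ∈ P, a ≤ r ∧ r ≤ b) → IsEuler P Ξ y →
      (∀ s ∈ P, ∀ t ∈ P, s < t → ∀ ε, 0 ≤ ε → (∀ r ∈ P, s ≤ r → r < t → ω s r ≤ ε) →
        ‖y t - y s - Ξ s t (y s)‖ ≤ K' * (ε ^ γ * (ω s t ^ γ) ^ N)) ∧
      ∀ s ∈ P, ∀ t ∈ P, s ≤ t → ‖y t - y s‖ ≤ C := by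
  obtain ⟨A, δ, hA, hδ0, hA', hδ⟩ := exists_sewing_constants (N := N) hγ hθ hK
  set Λ := W ^ γ with hΛ
  have hΛ0 : 0 ≤ Λ := Real.rpow_nonneg hW _
  set C₀ := (A + K) * (δ ^ γ * Λ ^ N) + K * Λ with hC₀
  have hδγ : 0 < δ ^ γ := Real.rpow_pos_of_pos hδ0 _
  have hC₀0 : 0 ≤ C₀ := by positivity
  set C := C₀ * (1 + W / δ) with hC
  have hC0 : 0 ≤ C := by positivity
  set K' := (A + K) + (C + K * Λ) / (δ ^ γ * (δ ^ γ) ^ N) with hK'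
  refine ⟨K', C, by positivity, fun a b ω hω hωW Ξ hΞ P y hP hy => ?_⟩
  have lΛ : ∀ {s t}, a ≤ s → s ≤ t → t ≤ b → ω s t ^ γ ≤ Λ := fun h1 h2 h3 =>
    Real.rpow_le_rpow (hω.nonneg _ _ h1 h2 h3) ((hω.mono le_rfl h1 h2 h3 le_rfl).trans hωW) hγ.le
  have l0 : ∀ {s t}, a ≤ s → s ≤ t → t ≤ b → 0 ≤ ω s t ^ γ := fun h1 h2 h3 =>
    Real.rpow_nonneg (hω.nonneg _ _ h1 h2 h3) _
  have hΞΛ : ∀ {s t} z, a ≤ s → s ≤ t → t ≤ b → ‖Ξ s t z‖ ≤ K * Λ := fun z h1 h2 h3 =>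
    (hΞ.bound _ _ z h1 h2 h3).trans (mul_le_mul_of_nonneg_left (lΛ h1 h2 h3) hK)
  have step : ∀ s ∈ P, ∀ t ∈ P, s < t → (∀ r ∈ P, s ≤ r → r < t → ω s r ≤ δ) →
      ‖y t - y s‖ ≤ C₀ := by
    intro s hs t ht hst h
    have h1 := hy.error_le_of_small_left hω hγ hΞ hK hP hA hA' hδ hs ht hst le_rfl h
    have h2 := hΞΛ (y s) (hP s hs).1 hst.le (hP t ht).2
    have h3 : (A + K) * (δ ^ γ * (ω s t ^ γ) ^ N) ≤ (A + K) * (δ ^ γ * Λ ^ N) := by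
      have := pow_le_pow_left₀ (l0 (hP s hs).1 hst.le (hP t ht).2)
        (lΛ (hP s hs).1 hst.le (hP t ht).2) N
      gcongr
    calc ‖y t - y s‖ = ‖(y t - y s - Ξ s t (y s)) + Ξ s t (y s)‖ := by abel_nf
      _ ≤ _ := norm_add_le _ _
      _ ≤ C₀ := by linarith
  have long : ∀ n : ℕ, ∀ s ∈ P, ∀ t ∈ P, s ≤ t → (P.filter fun r => s < r ∧ r ≤ t).card ≤ n →
      ‖y t - y s‖ ≤ C₀ * (1 + ω s t / δ) := by
    intro n
    induction n using Nat.strong_induction_on with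
    | _ n ih =>
    intro s hs t ht hst hcard
    have has := (hP s hs).1
    have htb := (hP t ht).2
    have hst0 := hω.nonneg s t has hst htb
    rcases hst.eq_or_lt with rfl | hlt
    · rw [sub_self, norm_zero]; positivity
    by_cases hsmall : ∀ r ∈ P, s ≤ r → r < t → ω s r ≤ δ
    · refine (step s hs t ht hlt hsmall).trans ?_
      have : 0 ≤ ω s t / δ := by positivity
      nlinarith
    · push Not at hsmall
      obtain ⟨r, hr, hsr, hrt, hδr⟩ := hsmall
      -- the first time at which the control from `s` exceeds `δ`
      set S := P.filter fun v => s ≤ v ∧ δ < ω s v with hS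
      have hrS : r ∈ S := Finset.mem_filter.2 ⟨hr, hsr, hδr⟩
      set m := S.min' ⟨r, hrS⟩ with hm
      obtain ⟨hmP, hsm, hδm⟩ := Finset.mem_filter.1 (S.min'_mem ⟨r, hrS⟩)
      rw [← hm] at hmP hsm hδm
      have hmr : m ≤ r := S.min'_le r hrS
      have hmt : m < t := hmr.trans_lt hrt
      have hsm' : s < m := by
        refine lt_of_le_of_ne hsm fun h => ?_
        rw [← h, hω.diag s has (hst.trans htb)] at hδm
        exact hδm.not_gt hδ0
      have J1 := step s hs m hmP hsm' fun v hv hsv hvm => by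
        by_contra hlt'
        exact (S.min'_le v (Finset.mem_filter.2 ⟨hv, hsv, not_le.1 hlt'⟩)).not_gt hvm
      have J2 := ih _ (lt_of_lt_of_le (Finset.card_lt_card (by
        refine (Finset.ssubset_iff_of_subset fun w hw => ?_).2 ⟨m, ?_, ?_⟩
        · rw [Finset.mem_filter] at hw ⊢
          exact ⟨hw.1, hsm'.trans hw.2.1, hw.2.2⟩
        · exact Finset.mem_filter.2 ⟨hmP, hsm', hmt.le⟩
        · simp)) hcard) m hmP t ht hmt.le le_rfl
      have hsup := hω.superadditive s m t has hsm hmt.le htb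
      have hdiv : ω m t / δ + 1 ≤ ω s t / δ := by
        rw [div_add_one hδ0.ne']
        gcongr
        linarith
      calc ‖y t - y s‖ = ‖(y t - y m) + (y m - y s)‖ := by abel_nf
        _ ≤ _ := norm_add_le _ _
        _ ≤ C₀ * (1 + ω m t / δ) + C₀ := add_le_add J2 J1
        _ ≤ C₀ * (1 + ω s t / δ) := by nlinarith
  have global : ∀ s ∈ P, ∀ t ∈ P, s ≤ t → ‖y t - y s‖ ≤ C := by
    intro s hs t ht hst
    refine (long _ s hs t ht hst le_rfl).trans ?_
    have := (hω.mono le_rfl (hP s hs).1 hst (hP t ht).2 le_rfl).trans hωW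
    rw [hC]
    gcongr
  refine ⟨fun s hs t ht hst ε hε h => ?_, global⟩
  have has := (hP s hs).1
  have htb := (hP t ht).2
  have hst0 := hω.nonneg s t has hst.le htb
  have B0 : 0 ≤ ω s t ^ γ := l0 has hst.le htb
  rcases le_or_gt ε δ with hεδ | hεδ
  · refine (hy.error_le_of_small_left hω hγ hΞ hK hP hA hA' hδ hs ht hst hεδ h).trans ?_
    have : A + K ≤ K' := by rw [hK']; exact le_add_of_nonneg_right (by positivity)
    gcongr
  · have hεγ : δ ^ γ ≤ ε ^ γ := Real.rpow_le_rpow hδ0.le hεδ.le hγ.le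
    rcases le_or_gt (ω s t) δ with hsmall | hbig
    · have J := hy.error_le_of_small_left hω hγ hΞ hK hP hA hA' hδ hs ht hst hsmall
        fun r hr h1 h2 => hω.mono has le_rfl h1 h2.le htb
      refine J.trans ?_
      have h1 : A + K ≤ K' := by rw [hK']; exact le_add_of_nonneg_right (by positivity)
      have h2 : ω s t ^ γ ≤ ε ^ γ := Real.rpow_le_rpow hst0 (hsmall.trans hεδ.le) hγ.le
      gcongr
    · have hst' : δ ^ γ ≤ ω s t ^ γ := Real.rpow_le_rpow hδ0.le hbig.le hγ.le
      have h1 : ‖y t - y s - Ξ s t (y s)‖ ≤ C + K * Λ :=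
        (norm_sub_le _ _).trans (add_le_add (global s hs t ht hst.le) (hΞΛ _ has hst.le htb))
      have h2 : δ ^ γ * (δ ^ γ) ^ N ≤ ε ^ γ * (ω s t ^ γ) ^ N := by gcongr
      calc _ ≤ C + K * Λ := h1
        _ = (C + K * Λ) / (δ ^ γ * (δ ^ γ) ^ N) * (δ ^ γ * (δ ^ γ) ^ N) := by
            field_simp
        _ ≤ K' * (ε ^ γ * (ω s t ^ γ) ^ N) := by
            apply mul_le_mul _ h2 (by positivity) (by positivity)
            rw [hK']; linarith

/-- Existence of a path following an almost flow: a limit point of the Euler schemes along the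
directed set of finite sets of times. The constant depends on the control through a bound of its
total mass only. -/
theorem exists_path_of_isAlmostFlow [ProperSpace E] (hγ : 0 < γ) (hθ : 1 < (N + 1) * γ)
    (hK : 0 ≤ K) {W : ℝ} (hW : 0 ≤ W) :
    ∃ K' : ℝ, 0 ≤ K' ∧ ∀ (a b : ℝ) (ω : ℝ → ℝ → ℝ), IsControlOn a b ω → a ≤ b → ω a b ≤ W →
      ∀ (Ξ : ℝ → ℝ → E → E), IsAlmostFlow a b ω γ N K Ξ →
      (∀ s t, a ≤ s → s ≤ t → t ≤ b → Continuous (Ξ s t)) → ∀ z₀ : E, ∃ z : ℝ → E, z a = z₀ ∧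
        SewingBound a b ω γ N K' fun s t => z t - z s - Ξ s t (z s) := by
  obtain ⟨K', C, hK', h⟩ := exists_euler_bounds (E := E) (N := N) hγ hθ hK hW
  refine ⟨K', hK', fun a b ω hω hab hωW Ξ hΞ hcont z₀ => ?_⟩
  let pts : Finset ℝ → Finset ℝ := fun Q => insert a (Q.filter fun r => a ≤ r ∧ r ≤ b)
  have hpts : ∀ Q, ∀ r ∈ pts Q, a ≤ r ∧ r ≤ b := by
    intro Q r hr
    rcases Finset.mem_insert.1 hr with rfl | hr
    · exact ⟨le_rfl, hab⟩
    · exact (Finset.mem_filter.1 hr).2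
  have hmem : ∀ {Q : Finset ℝ} {t : ℝ}, {t} ≤ Q → a ≤ t → t ≤ b → t ∈ pts Q :=
    fun hQ h1 h2 => Finset.mem_insert_of_mem
      (Finset.mem_filter.2 ⟨hQ (Finset.mem_singleton_self _), h1, h2⟩)
  choose y hy0 hy using fun Q => exists_isEuler Ξ a z₀ (pts Q) fun r hr => (hpts Q r hr).1
  let U : Ultrafilter (Finset ℝ) := Ultrafilter.of atTop
  have hU : (U : Filter (Finset ℝ)) ≤ atTop := Ultrafilter.of_le _
  have hlim : ∀ t, a ≤ t → t ≤ b → ∃ z, Tendsto (fun Q => y Q t) U (𝓝 z) := by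
    intro t h1 h2
    have hev : ∀ᶠ Q in (U : Filter (Finset ℝ)), y Q t ∈ Metric.closedBall z₀ C := by
      refine hU ((eventually_ge_atTop {t}).mono fun Q hQ => ?_)
      have := (h a b ω hω hωW Ξ hΞ (pts Q) (y Q) (hpts Q) (hy Q)).2 a (Finset.mem_insert_self _ _) t
        (hmem hQ h1 h2) h1
      rwa [hy0 Q, ← dist_eq_norm] at this
    obtain ⟨z, -, hz⟩ := (isCompact_closedBall z₀ C).ultrafilter_le_nhds (U.map fun Q => y Q t)
      (by rw [le_principal_iff]; exact hev)
    exact ⟨z, hz⟩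
  choose! z hz using hlim
  refine ⟨z, ?_, ?_⟩
  · refine tendsto_nhds_unique (hz a le_rfl hab) ?_
    simp only [hy0]
    exact tendsto_const_nhds
  · intro s t ε h1 h2 h3 hε hr
    have T1 := hz s h1 (h2.le.trans h3)
    have T2 := hz t (h1.trans h2.le) h3
    have T3 := ((hcont s t h1 h2.le h3).tendsto (z s)).comp T1
    refine le_of_tendsto ((T2.sub T1).sub T3).norm ?_
    refine hU ((eventually_ge_atTop {s, t}).mono fun Q hQ => ?_)
    refine (h a b ω hω hωW Ξ hΞ (pts Q) (y Q) (hpts Q) (hy Q)).1 s (hmem ?_ h1 (h2.le.trans h3)) t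
      (hmem ?_ (h1.trans h2.le) h3) h2 ε hε fun r _ => hr r
    · exact Finset.singleton_subset_iff.2 (hQ (by simp))
    · exact Finset.singleton_subset_iff.2 (hQ (by simp))

end Existence

/-! ### Riemann sums -/

section RiemannSums

variable {V : Type*} [NormedAddCommGroup V]

theorem IsPartition.union {s t : ℝ} {P Q : Finset ℝ} (hP : IsPartition s t P)
    (hQ : IsPartition s t Q) : IsPartition s t (P ∪ Q) :=
  ⟨Finset.mem_union_left _ hP.1, Finset.mem_union_left _ hP.2.1, fun u hu =>
    (Finset.mem_union.1 hu).elim (hP.2.2 u) (hQ.2.2 u)⟩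

theorem HasRRSLimit.unique {Ξ : ℝ → ℝ → V} {s t : ℝ} {K K' : V} (h : HasRRSLimit Ξ s t K)
    (h' : HasRRSLimit Ξ s t K') : K = K' := by
  by_contra hne
  have hpos : 0 < ‖K - K'‖ / 2 := half_pos (norm_pos_iff.2 (sub_ne_zero.2 hne))
  obtain ⟨P, hP, h1⟩ := h _ hpos
  obtain ⟨Q, hQ, h2⟩ := h' _ hpos
  have e1 := h1 _ (hP.union hQ) Finset.subset_union_left
  have e2 := h2 _ (hP.union hQ) Finset.subset_union_right
  have : ‖K - K'‖ < ‖K - K'‖ / 2 + ‖K - K'‖ / 2 := by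
    calc ‖K - K'‖ = ‖(chainSum Ξ ((P ∪ Q).sort (· ≤ ·)) - K')
          - (chainSum Ξ ((P ∪ Q).sort (· ≤ ·)) - K)‖ := by abel_nf
      _ ≤ _ := norm_sub_le _ _
      _ < _ := by linarith
  linarith

/-- The increments of `G` telescope along the list, so that their local distances to `Ξ` add up. -/
theorem norm_chainSum_sub_le {Ξ : ℝ → ℝ → V} {G : ℝ → V} {ω : ℝ → ℝ → ℝ} {c : ℝ}
    (l : List ℝ) : ∀ u : ℝ,
    (List.IsChain (fun p q => ‖G q - G p - Ξ p q‖ ≤ c * ω p q) (u :: l)) →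
    ‖chainSum Ξ (u :: l) - (G ((u :: l).getLast (by simp)) - G u)‖
      ≤ c * chainSum ω (u :: l) := by
  induction l with
  | nil => intro u _; simp [chainSum]
  | cons v l ih =>
    intro u h
    rw [List.isChain_cons_cons] at h
    have h2 := ih v h.2
    simp only [chainSum, List.getLast_cons_cons] at h2 ⊢
    set S := chainSum Ξ (v :: l)
    set e := G ((v :: l).getLast (by simp))
    calc ‖Ξ u v + S - (e - G u)‖ = ‖(S - (e - G v)) - (G v - G u - Ξ u v)‖ := by abel_nf
      _ ≤ _ := norm_sub_le _ _
      _ ≤ c * (ω u v + chainSum ω (v :: l)) := by linarith [h.1]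

theorem IsControlOn.chainSum_le {a b : ℝ} {ω : ℝ → ℝ → ℝ} (hω : IsControlOn a b ω) (l : List ℝ) :
    ∀ u : ℝ, (u :: l).Pairwise (· < ·) → (∀ r ∈ u :: l, a ≤ r ∧ r ≤ b) →
      chainSum ω (u :: l) ≤ ω u ((u :: l).getLast (by simp)) := by
  induction l with
  | nil =>
    intro u _ h
    have := h u (by simp)
    simp [chainSum, hω.diag u this.1 this.2]
  | cons v l ih =>
    intro u hl h
    rw [List.pairwise_cons] at hl
    have h2 := ih v hl.2 fun r hr => h r (List.mem_cons_of_mem _ hr)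
    simp only [chainSum, List.getLast_cons_cons] at h2 ⊢
    have hmem : (v :: l).getLast (by simp) ∈ v :: l := List.getLast_mem _
    have hle : v ≤ (v :: l).getLast (by simp) := by
      rcases List.mem_cons.1 hmem with h' | h'
      · exact h'.ge
      · exact ((List.pairwise_cons.1 hl.2).1 _ h').le
    have := hω.superadditive u v _ (h u (by simp)).1 (hl.1 v (by simp)).le hle
      (h _ (List.mem_cons_of_mem _ hmem)).2
    linarith

/-- Consecutive entries of the sorted list of a finite set have no point of the set between
them. -/
theorem isChain_of_sorted {R : ℝ → ℝ → Prop} (l : List ℝ) (hl : l.Pairwise (· < ·))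
    (h : ∀ u ∈ l, ∀ v ∈ l, u < v → (∀ r ∈ l, u < r → v ≤ r) → R u v) : l.IsChain R := by
  induction l with
  | nil => exact .nil
  | cons u l ih =>
    cases l with
    | nil => exact .singleton _
    | cons v l =>
      have hl' := List.pairwise_cons.1 hl
      have hl'' := List.pairwise_cons.1 hl'.2
      rw [List.isChain_cons_cons]
      constructor
      · refine h u (by simp) v (by simp) (hl'.1 v (by simp)) fun r hr hur => ?_
        rcases List.mem_cons.1 hr with rfl | hr
        · exact absurd hur (lt_irrefl _)
        · rcases List.mem_cons.1 hr with rfl | hr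
          · exact le_rfl
          · exact (hl''.1 r hr).le
      · refine ih hl'.2 fun p hp q hq hpq hr => ?_
        refine h p (List.mem_cons_of_mem _ hp) q (List.mem_cons_of_mem _ hq) hpq fun r hr' hpr => ?_
        rcases List.mem_cons.1 hr' with rfl | hr'
        · exact absurd hpr (hl'.1 p hp).not_gt
        · exact hr r hr' hpr

/-- The sorted list of a partition of `[s, t]` runs from `s` to `t`. -/
theorem IsPartition.exists_sort {s t : ℝ} {P : Finset ℝ} (hP : IsPartition s t P) :
    ∃ l, P.sort (· ≤ ·) = s :: l ∧ (s :: l).getLast (by simp) = t := by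
  have hmem : ∀ x, x ∈ P.sort (· ≤ ·) ↔ x ∈ P := fun x => Finset.mem_sort _
  have hsort : (P.sort (· ≤ ·)).Pairwise (· < ·) := Finset.sortedLT_sort P |>.pairwise
  cases hl : P.sort (· ≤ ·) with
  | nil => have := (hmem s).2 hP.1; simp [hl] at this
  | cons u l =>
    rw [hl] at hsort
    have hus : u = s := by
      have h1 : u ∈ P := (hmem u).1 (by simp [hl])
      have h2 := (hP.2.2 u h1).1
      have h3 : s ∈ u :: l := hl ▸ (hmem s).2 hP.1
      rcases List.mem_cons.1 h3 with h | h
      · exact h.symm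
      · exact absurd ((List.pairwise_cons.1 hsort).1 s h) h2.not_gt
    subst hus
    refine ⟨l, rfl, ?_⟩
    have hmem' : ∀ x, x ∈ u :: l → x ∈ P := fun x hx => (hmem x).1 (hl ▸ hx)
    have h1 : (u :: l).getLast (by simp) ∈ P := hmem' _ (List.getLast_mem _)
    refine le_antisymm (hP.2.2 _ h1).2 ?_
    have ht : t ∈ u :: l := hl ▸ (hmem t).2 hP.2.1
    exact (hsort.imp le_of_lt).rel_getLast ht

end RiemannSums

/-- For a right-continuous control, the times at which `ω(s, ·)` passes the multiples of `ε` cut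
`[s, t]` into intervals on which the control is at most `ε`, up to jumps at right ends. -/
theorem exists_partition_small {a b : ℝ} {ω : ℝ → ℝ → ℝ} (hω : IsControlOn a b ω)
    {s t : ℝ} (has : a ≤ s) (hst : s ≤ t) (htb : t ≤ b)
    (hright : ∀ u, s ≤ u → u ≤ t → Tendsto (ω s) (𝓝[Ioc u b] u) (𝓝 (ω s u)))
    {ε : ℝ} (hε : 0 < ε) :
    ∃ P₀ : Finset ℝ, IsPartition s t P₀ ∧ ∀ P : Finset ℝ, IsPartition s t P → P₀ ⊆ P →
      ∀ u ∈ P, ∀ v ∈ P, u < v → (∀ r ∈ P, u < r → v ≤ r) →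
        ∀ r, u ≤ r → r < v → ω u r ≤ ε := by
  have hmono : ∀ {u v}, s ≤ u → u ≤ v → v ≤ t → ω s u ≤ ω s v := fun h1 h2 h3 =>
    hω.mono has le_rfl h1 h2 (h3.trans htb)
  let S : ℕ → Set ℝ := fun k => {r | s ≤ r ∧ r ≤ t ∧ k * ε ≤ ω s r}
  let τ : ℕ → ℝ := fun k => sInf (insert t (S k))
  have hbdd : ∀ k, BddBelow (insert t (S k)) := fun k => ⟨s, by
    rintro x (rfl | hx)
    · exact hst
    · exact hx.1⟩
  have hτs : ∀ k, s ≤ τ k := fun k => le_csInf (insert_nonempty _ _) (by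
    rintro x (rfl | hx)
    · exact hst
    · exact hx.1)
  have hτt : ∀ k, τ k ≤ t := fun k => csInf_le (hbdd k) (mem_insert _ _)
  obtain ⟨n, hn⟩ := exists_nat_gt (ω s t / ε)
  refine ⟨insert s (insert t ((Finset.range (n + 1)).image τ)), ⟨by simp, by simp, ?_⟩, ?_⟩
  · intro u hu
    simp only [Finset.mem_insert, Finset.mem_image, Finset.mem_range] at hu
    rcases hu with rfl | rfl | ⟨k, -, rfl⟩
    · exact ⟨le_rfl, hst⟩
    · exact ⟨hst, le_rfl⟩
    · exact ⟨hτs k, hτt k⟩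
  · intro P hP hP₀ u hu v hv huv hcons r hur hrv
    have hsu := (hP.2.2 u hu).1
    have hvt := (hP.2.2 v hv).2
    have hu0 : 0 ≤ ω s u := hω.nonneg s u has hsu (huv.le.trans (hvt.trans htb))
    set k := ⌊ω s u / ε⌋₊ with hk
    have hk1 : k * ε ≤ ω s u := by
      rw [← le_div_iff₀ hε]; exact Nat.floor_le (by positivity)
    have hk2 : ω s u < (k + 1 : ℕ) * ε := by
      rw [← div_lt_iff₀ hε]; push_cast; exact Nat.lt_floor_add_one _
    have hsup := hω.superadditive s u r has hsu hur (hrv.le.trans (hvt.trans htb))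
    by_contra hcontra
    push Not at hcontra
    have hr : ((k + 1 : ℕ) : ℝ) * ε ≤ ω s r := by push_cast; linarith
    have hrS : r ∈ S (k + 1) := ⟨hsu.trans hur, hrv.le.trans hvt, hr⟩
    have hτr : τ (k + 1) ≤ r := csInf_le (hbdd _) (mem_insert_of_mem _ hrS)
    have hkn : k + 1 < n + 1 := by
      have h1 : ω s u ≤ ω s t := hmono hsu (huv.le.trans hvt) le_rfl
      have h2 : (k : ℝ) < n := by
        refine lt_of_le_of_lt ?_ hn
        rw [le_div_iff₀ hε]
        exact hk1.trans h1
      exact_mod_cast Nat.succ_lt_succ (Nat.cast_lt.1 h2)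
    have hτP : τ (k + 1) ∈ P := hP₀ (by
      simp only [Finset.mem_insert, Finset.mem_image, Finset.mem_range]
      exact Or.inr (Or.inr ⟨k + 1, hkn, rfl⟩))
    -- by right-continuity `ω(s, ·)` has reached the level at the time `τ (k + 1)` itself
    have hlevel : u < τ (k + 1) := by
      by_contra hle
      have hle := not_lt.1 hle
      have hur' : u < r := by
        refine lt_of_le_of_ne hur ?_
        rintro rfl
        exact hk2.not_ge hr
      have hne : (𝓝[Ioc u b] u).NeBot :=
        left_nhdsWithin_Ioc_neBot (hur'.trans (hrv.trans_le (hvt.trans htb)))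
      have hge : ∀ᶠ x in 𝓝[Ioc u b] u, ((k + 1 : ℕ) : ℝ) * ε ≤ ω s x := by
        have hlt : ∀ᶠ x in 𝓝[Ioc u b] u, x < r :=
          (eventually_lt_nhds hur').filter_mono nhdsWithin_le_nhds
        filter_upwards [hlt, self_mem_nhdsWithin] with x hxr hx
        obtain ⟨w, hw, hwx⟩ := exists_lt_of_csInf_lt (insert_nonempty _ _) (hle.trans_lt hx.1)
        have hxt : x ≤ t := hxr.le.trans (hrv.le.trans hvt)
        rcases hw with rfl | hw
        · exact absurd hwx hxt.not_gt
        · exact hw.2.2.trans (hmono hw.1 hwx.le hxt)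
      have := ge_of_tendsto (hright u hsu (huv.le.trans hvt)) hge
      exact hk2.not_ge this
    exact (hcons _ hτP hlevel).not_gt (hτr.trans_lt hrv)

/-- A path whose increments agree with `Ξ` up to the sewing bound is the limit of the Riemann sums
of `Ξ`. -/
theorem SewingBound.hasRRSLimit {V : Type*} [NormedAddCommGroup V] {a b : ℝ} {ω : ℝ → ℝ → ℝ}
    {γ : ℝ} {N : ℕ} {K : ℝ} {Ξ : ℝ → ℝ → V} {G : ℝ → V} (hω : IsControlOn a b ω)
    (hright : ∀ s u, a ≤ s → s ≤ u → u ≤ b → Tendsto (ω s) (𝓝[Ioc u b] u) (𝓝 (ω s u)))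
    (hθ : 1 < (N + 1) * γ) (hNγ : N * γ ≤ 1) (hK : 0 ≤ K)
    (h : SewingBound a b ω γ N K fun s t => G t - G s - Ξ s t)
    {s t : ℝ} (has : a ≤ s) (hst : s ≤ t) (htb : t ≤ b) :
    HasRRSLimit Ξ s t (G t - G s) := by
  intro η hη
  have hst0 := hω.nonneg s t has hst htb
  -- `θ = (N + 1) γ - 1` is the surplus exponent
  set θ := (N + 1) * γ - 1 with hθdef
  have hθ0 : 0 < θ := by linarith
  obtain ⟨ε, hε, hεη⟩ : ∃ ε : ℝ, 0 < ε ∧ K * ε ^ θ * ω s t < η := by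
    have hc : Tendsto (fun ε : ℝ => K * ε ^ θ * ω s t) (𝓝[>] 0) (𝓝 (K * 0 ^ θ * ω s t)) := by
      have := (Real.continuousAt_rpow_const 0 θ (Or.inr hθ0.le)).tendsto
      exact ((this.const_mul K).mul_const _).mono_left nhdsWithin_le_nhds
    rw [Real.zero_rpow hθ0.ne', mul_zero, zero_mul] at hc
    obtain ⟨ε, h1, h2⟩ := ((hc.eventually (gt_mem_nhds hη)).and self_mem_nhdsWithin).exists
    exact ⟨ε, h2, h1⟩
  obtain ⟨P₀, hP₀, hsmall⟩ := exists_partition_small hω has hst htb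
    (fun u h1 h2 => hright s u has h1 (h2.trans htb)) hε
  refine ⟨P₀, hP₀, fun P hP hsub => ?_⟩
  obtain ⟨l, hl, hlast⟩ := hP.exists_sort
  have hmem : ∀ x, x ∈ s :: l ↔ x ∈ P := fun x => hl ▸ Finset.mem_sort _
  have hsort : (s :: l).Pairwise (· < ·) := hl ▸ (Finset.sortedLT_sort P).pairwise
  have hin : ∀ r ∈ s :: l, a ≤ r ∧ r ≤ b := fun r hr =>
    ⟨has.trans (hP.2.2 r ((hmem r).1 hr)).1, ((hP.2.2 r ((hmem r).1 hr)).2).trans htb⟩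
  have hchain : List.IsChain (fun p q => ‖G q - G p - Ξ p q‖ ≤ K * ε ^ θ * ω p q) (s :: l) := by
    refine isChain_of_sorted _ hsort fun u hu v hv huv hcons => ?_
    have hau := (hin u hu).1
    have hvb := (hin v hv).2
    have huv0 := hω.nonneg u v hau huv.le hvb
    have hS := hsmall P hP hsub u ((hmem u).1 hu) v ((hmem v).1 hv) huv
      fun r hr => hcons r ((hmem r).2 hr)
    set ε' := min ε (ω u v) with hε'
    have hε'0 : 0 ≤ ε' := le_min hε.le huv0
    refine (h u v ε' hau huv hvb hε'0 fun r h1 h2 =>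
      le_min (hS r h1 h2) (hω.mono hau le_rfl h1 h2.le hvb)).trans ?_
    rw [mul_assoc]
    refine mul_le_mul_of_nonneg_left ?_ hK
    -- `ε'^γ ω^{Nγ} = ε'^θ ε'^{1 - Nγ} ω^{Nγ} ≤ ε^θ ω`
    have e1 : ε' ^ γ = ε' ^ θ * ε' ^ (1 - N * γ) := by
      rw [← Real.rpow_add_of_nonneg hε'0 hθ0.le (by linarith)]
      congr 1; rw [hθdef]; ring
    have e2 : ω u v = ω u v ^ (1 - N * γ) * (ω u v ^ γ) ^ N := by
      rw [← Real.rpow_natCast (ω u v ^ γ), ← Real.rpow_mul huv0, mul_comm γ]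
      rcases Nat.eq_zero_or_pos N with rfl | hN
      · simp
      · have hN1 : (1 : ℝ) ≤ N := by exact_mod_cast hN
        rw [← Real.rpow_add_of_nonneg huv0 (by linarith) (by nlinarith)]
        simp
    have h1 : ε' ^ θ ≤ ε ^ θ := Real.rpow_le_rpow hε'0 (min_le_left _ _) hθ0.le
    have h2 : ε' ^ (1 - N * γ) ≤ ω u v ^ (1 - N * γ) :=
      Real.rpow_le_rpow hε'0 (min_le_right _ _) (by linarith)
    have h3 : 0 ≤ (ω u v ^ γ) ^ N := pow_nonneg (Real.rpow_nonneg huv0 _) _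
    calc ε' ^ γ * (ω u v ^ γ) ^ N = ε' ^ θ * (ε' ^ (1 - N * γ) * (ω u v ^ γ) ^ N) := by
          rw [e1]; ring
      _ ≤ ε ^ θ * (ω u v ^ (1 - N * γ) * (ω u v ^ γ) ^ N) := by
          refine mul_le_mul h1 (mul_le_mul_of_nonneg_right h2 h3) ?_ (Real.rpow_nonneg hε.le _)
          exact mul_nonneg (Real.rpow_nonneg hε'0 _) h3
      _ = ε ^ θ * ω u v := by rw [← e2]
  have hsum := norm_chainSum_sub_le (Ξ := Ξ) (G := G) l s hchain
  have hle := hω.chainSum_le l s hsort hin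
  rw [hlast] at hsum hle
  rw [hl]
  refine hsum.trans_lt (lt_of_le_of_lt ?_ hεη)
  exact mul_le_mul_of_nonneg_left hle (mul_nonneg hK (Real.rpow_nonneg hε.le _))

/-! ### Differentiation in finite-dimensional algebras -/

section WeakDeriv

variable {V W A : Type*} [AddCommGroup V] [Module ℝ V] [AddCommGroup W] [Module ℝ W]
  [CommRing A] [Algebra ℝ A]

/-- Differentiability of a curve in a real vector space, tested on linear forms. In finite
dimension this is the usual notion; it needs no topology, hence none has to be chosen on `H`. -/
def HasWeakDerivAt (f : ℝ → V) (f' : V) (τ : ℝ) : Prop :=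
  ∀ ℓ : V →ₗ[ℝ] ℝ, HasDerivAt (fun t => ℓ (f t)) (ℓ f') τ

theorem HasWeakDerivAt.add {f g : ℝ → V} {f' g' : V} {τ : ℝ} (hf : HasWeakDerivAt f f' τ)
    (hg : HasWeakDerivAt g g' τ) : HasWeakDerivAt (fun t => f t + g t) (f' + g') τ := fun ℓ => by
  simpa only [map_add] using (hf ℓ).fun_add (hg ℓ)

theorem HasWeakDerivAt.sub {f g : ℝ → V} {f' g' : V} {τ : ℝ} (hf : HasWeakDerivAt f f' τ)
    (hg : HasWeakDerivAt g g' τ) : HasWeakDerivAt (fun t => f t - g t) (f' - g') τ := fun ℓ => by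
  simpa only [map_sub] using (hf ℓ).fun_sub (hg ℓ)

theorem HasWeakDerivAt.sum {κ : Type*} (s : Finset κ) {f : κ → ℝ → V} {f' : κ → V} {τ : ℝ}
    (h : ∀ i ∈ s, HasWeakDerivAt (f i) (f' i) τ) :
    HasWeakDerivAt (fun t => ∑ i ∈ s, f i t) (∑ i ∈ s, f' i) τ := fun ℓ => by
  simpa only [map_sum] using HasDerivAt.fun_sum fun i hi => h i hi ℓ

theorem HasWeakDerivAt.map (T : V →ₗ[ℝ] W) {f : ℝ → V} {f' : V} {τ : ℝ}
    (hf : HasWeakDerivAt f f' τ) : HasWeakDerivAt (fun t => T (f t)) (T f') τ :=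
  fun ℓ => hf (ℓ ∘ₗ T)

theorem HasWeakDerivAt.smul {c : ℝ → ℝ} {c' : ℝ} {f : ℝ → V} {f' : V} {τ : ℝ}
    (hc : HasDerivAt c c' τ) (hf : HasWeakDerivAt f f' τ) :
    HasWeakDerivAt (fun t => c t • f t) (c' • f τ + c τ • f') τ := fun ℓ => by
  simpa only [map_smul, map_add, smul_eq_mul] using hc.fun_mul (hf ℓ)

theorem hasWeakDerivAt_const (v : V) (τ : ℝ) : HasWeakDerivAt (fun _ => v) 0 τ := fun ℓ => by
  simpa only [map_zero] using hasDerivAt_const τ (ℓ v)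

theorem hasWeakDerivAt_line (b c : V) (τ : ℝ) : HasWeakDerivAt (fun t => b + t • c) c τ := by
  have h := (hasWeakDerivAt_const b τ).add ((hasWeakDerivAt_const c τ).smul (hasDerivAt_id τ))
  simpa using h

theorem HasWeakDerivAt.mul [Module.Finite ℝ A] {f g : ℝ → A} {f' g' : A} {τ : ℝ}
    (hf : HasWeakDerivAt f f' τ) (hg : HasWeakDerivAt g g' τ) :
    HasWeakDerivAt (fun t => f t * g t) (f' * g τ + f τ * g') τ := by
  let B := Module.finBasis ℝ A
  have expand : ∀ x y : A, x * y = ∑ i, B.coord i x • (LinearMap.mulLeft ℝ (B i) y) := by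
    intro x y
    conv_lhs => rw [← B.sum_repr x, Finset.sum_mul]
    simp
  have h : HasWeakDerivAt (fun t => ∑ i, B.coord i (f t) • (LinearMap.mulLeft ℝ (B i) (g t)))
      (∑ i, (B.coord i f' • LinearMap.mulLeft ℝ (B i) (g τ)
        + B.coord i (f τ) • LinearMap.mulLeft ℝ (B i) g')) τ :=
    HasWeakDerivAt.sum _ fun i _ => (hg.map _).smul (hf (B.coord i))
  rw [Finset.sum_add_distrib, ← expand, ← expand] at h
  simpa only [← expand] using h

/-- Hahn-Banach: the value of a seminorm is attained by a linear form below it. -/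
theorem exists_dual_eq_seminorm (p : Seminorm ℝ V) (v : V) :
    ∃ ℓ : V →ₗ[ℝ] ℝ, ℓ v = p v ∧ ∀ w, |ℓ w| ≤ p w := by
  have key : ∃ ℓ : V →ₗ[ℝ] ℝ, ℓ v = p v ∧ ∀ w, ℓ w ≤ p w := by
    rcases eq_or_ne v 0 with rfl | hv
    · exact ⟨0, by simp, fun w => by simp⟩
    · obtain ⟨ℓ, h1, h2⟩ := exists_extension_of_le_sublinear
        (LinearPMap.mkSpanSingleton v (p v) hv) p
        (fun c hc x => by rw [map_smul_eq_mul, Real.norm_of_nonneg hc.le])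
        (fun x y => map_add_le_add p x y) (by
          rintro ⟨x, hx⟩
          obtain ⟨c, rfl⟩ := Submodule.mem_span_singleton.1 hx
          rw [LinearPMap.mkSpanSingleton'_apply, map_smul_eq_mul, RingHom.id_apply, smul_eq_mul]
          exact mul_le_mul_of_nonneg_right (le_abs_self c) (apply_nonneg p v))
      refine ⟨ℓ, ?_, h2⟩
      have hv' : v ∈ (LinearPMap.mkSpanSingleton (σ := RingHom.id ℝ) v (p v) hv).domain :=
        Submodule.mem_span_singleton_self v
      rw [h1 ⟨v, hv'⟩]
      exact LinearPMap.mkSpanSingleton_apply ℝ ℝ hv (p v)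
  obtain ⟨ℓ, h1, h2⟩ := key
  refine ⟨ℓ, h1, fun w => abs_le.2 ⟨?_, h2 w⟩⟩
  have := h2 (-w)
  rw [map_neg, map_neg_eq_map] at this
  linarith

/-- The mean value inequality for a seminorm. -/
theorem seminorm_sub_le_of_hasWeakDerivAt (p : Seminorm ℝ V) {f f' : ℝ → V} {C : ℝ}
    (hf : ∀ τ ∈ Icc (0 : ℝ) 1, HasWeakDerivAt f (f' τ) τ)
    (hC : ∀ τ ∈ Icc (0 : ℝ) 1, p (f' τ) ≤ C) : p (f 1 - f 0) ≤ C := by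
  obtain ⟨ℓ, h1, h2⟩ := exists_dual_eq_seminorm p (f 1 - f 0)
  have := norm_image_sub_le_of_norm_deriv_le_segment_01' (f := fun t => ℓ (f t))
    (f' := fun t => ℓ (f' t)) (C := C) (fun τ hτ => (hf τ hτ ℓ).hasDerivWithinAt)
    (fun τ hτ => (h2 _).trans (hC τ ⟨hτ.1, hτ.2.le⟩))
  rw [← h1, map_sub]
  exact (le_abs_self _).trans this

end WeakDeriv

/-! ### Jets of functions, evaluated in an algebra -/

section Jets

variable {ι A : Type*} [Fintype ι] [DecidableEq ι] [CommRing A] [Algebra ℝ A]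

/-- The partial derivative of `g` in the direction of the `j`-th coordinate. -/
noncomputable def pd (j : ι) (g : (ι → ℝ) → ℝ) : (ι → ℝ) → ℝ :=
  fun x => fderiv ℝ g x (Pi.single j 1)

theorem ContDiff.pd {n : ℕ} {g : (ι → ℝ) → ℝ} (hg : ContDiff ℝ (n + 1 : ℕ) g) (j : ι) :
    ContDiff ℝ n (pd j g) :=
  (hg.fderiv_right (m := n) (by norm_cast)).clm_apply contDiff_const

theorem pd_comm {g : (ι → ℝ) → ℝ} (hg : ContDiff ℝ 2 g) (i j : ι) :
    pd i (pd j g) = pd j (pd i g) := by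
  have hd : Differentiable ℝ (fderiv ℝ g) :=
    (hg.fderiv_right (m := 1) (by norm_num)).differentiable (by norm_num)
  have key : ∀ (v w x : ι → ℝ),
      fderiv ℝ (fun y => fderiv ℝ g y v) x w = fderiv ℝ (fderiv ℝ g) x w v := by
    intro v w x
    rw [fderiv_clm_apply (hd x) (differentiableAt_const _)]
    simp
  ext x
  rw [pd, pd]
  rw [show pd j g = fun y => fderiv ℝ g y (Pi.single j 1) from rfl,
    show pd i g = fun y => fderiv ℝ g y (Pi.single i 1) from rfl, key, key]
  exact (hg.contDiffAt.isSymmSndFDerivAt (by simp)) _ _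

theorem hasDerivAt_comp_line {g : (ι → ℝ) → ℝ} (hg : ContDiff ℝ 1 g) (x a : ι → ℝ) (τ : ℝ) :
    HasDerivAt (fun t : ℝ => g (x + t • a)) (∑ j, a j * pd j g (x + τ • a)) τ := by
  have h1 := ((hg.differentiable (by norm_num)) (x + τ • a)).hasFDerivAt
  have h2 : HasDerivAt (fun t : ℝ => x + t • a) a τ := by
    simpa using ((hasDerivAt_id τ).smul_const a).const_add x
  have h3 := h1.comp_hasDerivAt τ h2
  have e : ∀ D : (ι → ℝ) →L[ℝ] ℝ, D a = ∑ j, a j * D (Pi.single j 1) := by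
    intro D
    conv_lhs => rw [pi_eq_sum_univ' a, map_sum]
    exact Finset.sum_congr rfl fun j _ => by rw [map_smul, smul_eq_mul]
  rwa [e] at h3

theorem norm_iteratedFDeriv_pd_le {n : ℕ} {g : (ι → ℝ) → ℝ} (hg : ContDiff ℝ (n + 1 : ℕ) g)
    (j : ι) (x : ι → ℝ) :
    ‖iteratedFDeriv ℝ n (pd j g) x‖ ≤ ‖iteratedFDeriv ℝ (n + 1) g x‖ := by
  have hd : ContDiff ℝ n (fderiv ℝ g) := hg.fderiv_right (m := n) (by norm_cast)
  have h := (ContinuousLinearMap.apply ℝ ℝ (Pi.single j (1 : ℝ))).norm_iteratedFDeriv_comp_left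
    (f := fderiv ℝ g) (x := x) (n := n) hd.contDiffAt le_rfl
  rw [norm_iteratedFDeriv_fderiv] at h
  refine h.trans (mul_le_of_le_one_left (norm_nonneg _) ?_)
  refine ContinuousLinearMap.opNorm_le_bound _ zero_le_one fun φ => ?_
  rw [ContinuousLinearMap.apply_apply, one_mul]
  refine (φ.le_opNorm _).trans (mul_le_of_le_one_right (norm_nonneg _) ?_)
  refine (pi_norm_le_iff_of_nonneg zero_le_one).2 fun k => ?_
  by_cases h : k = j
  · subst h; simp
  · simp [h]

/-- The `n`-th differential of `g` at `x`, extended to `A^ι` by multilinearity through the product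
of `A` and evaluated on the diagonal: `∑ ∂_{j₁} ⋯ ∂_{jₙ} g(x) b_{j₁} ⋯ b_{jₙ}`. -/
noncomputable def jet : ℕ → ((ι → ℝ) → ℝ) → (ι → ℝ) → (ι → A) → A
  | 0, g, x, _ => g x • 1
  | n + 1, g, x, b => ∑ j, b j * jet n (pd j g) x b

/-- The sum of the first `k` terms of the Taylor series of `g` at `x + b`, with `b` in `A^ι`. -/
noncomputable def lift (k : ℕ) (g : (ι → ℝ) → ℝ) (x : ι → ℝ) (b : ι → A) : A :=
  ∑ n ∈ Finset.range k, ((n.factorial : ℝ)⁻¹) • jet n g x b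

theorem lift_succ (k : ℕ) (g : (ι → ℝ) → ℝ) (x : ι → ℝ) (b : ι → A) :
    lift (k + 1) g x b = lift k g x b + ((k.factorial : ℝ)⁻¹) • jet k g x b := by
  rw [lift, Finset.sum_range_succ, ← lift]

theorem jet_hasWeakDerivAt [Module.Finite ℝ A] (n : ℕ) : ∀ {g : (ι → ℝ) → ℝ},
    ContDiff ℝ (n + 1 : ℕ) g → ∀ (x a : ι → ℝ) (b c : ι → A) (τ : ℝ),
    HasWeakDerivAt (fun t => jet n g (x + t • a) (b + t • c))
      (∑ j, a j • jet n (pd j g) (x + τ • a) (b + τ • c)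
        + (n : ℝ) • ∑ j, c j * jet (n - 1) (pd j g) (x + τ • a) (b + τ • c)) τ := by
  induction n with
  | zero =>
    intro g hg x a b c τ
    have h := (hasWeakDerivAt_const (1 : A) τ).smul (hasDerivAt_comp_line (by simpa using hg) x a τ)
    simp only [jet, Nat.cast_zero, zero_smul, add_zero, smul_zero, smul_smul, ← Finset.sum_smul]
      at h ⊢
    exact h
  | succ n ih =>
    intro g hg x a b c τ
    have h : HasWeakDerivAt (fun t => jet (n + 1) g (x + t • a) (b + t • c))
        (∑ j, (c j * jet n (pd j g) (x + τ • a) (b + τ • c) + (b + τ • c) j *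
          (∑ i, a i • jet n (pd i (pd j g)) (x + τ • a) (b + τ • c)
            + (n : ℝ) • ∑ i, c i * jet (n - 1) (pd i (pd j g)) (x + τ • a) (b + τ • c)))) τ :=
      HasWeakDerivAt.sum _ fun j _ =>
        (hasWeakDerivAt_line (b j) (c j) τ).mul (ih (ContDiff.pd hg j) x a b c τ)
    convert h using 1
    have hcomm : ∀ i j, pd i (pd j g) = pd j (pd i g) :=
      pd_comm (hg.of_le (by norm_cast; omega))
    set x' := x + τ • a
    set b' := b + τ • c
    have e1 : ∑ j, b' j * ∑ i, a i • jet n (pd i (pd j g)) x' b'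
        = ∑ j, a j • jet (n + 1) (pd j g) x' b' := by
      simp only [Finset.mul_sum, jet, Finset.smul_sum]
      rw [Finset.sum_comm]
      refine Finset.sum_congr rfl fun i _ => Finset.sum_congr rfl fun j _ => ?_
      rw [hcomm i j, mul_smul_comm]
    have e2 : ∑ j, b' j * (n : ℝ) • ∑ i, c i * jet (n - 1) (pd i (pd j g)) x' b'
        = (n : ℝ) • ∑ j, c j * jet n (pd j g) x' b' := by
      rcases n with _ | n
      · simp
      · simp only [jet, Nat.add_sub_cancel, mul_smul_comm, ← Finset.smul_sum, Finset.mul_sum]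
        rw [Finset.sum_comm]
        congr 1
        refine Finset.sum_congr rfl fun i _ => Finset.sum_congr rfl fun j _ => ?_
        rw [hcomm i j, mul_left_comm]
    simp only [mul_add, Finset.sum_add_distrib]
    rw [e1, e2, Nat.add_sub_cancel, Nat.cast_succ, add_smul, one_smul]
    abel

theorem lift_hasWeakDerivAt [Module.Finite ℝ A] (k : ℕ) {g : (ι → ℝ) → ℝ}
    (hg : ContDiff ℝ (k + 1 : ℕ) g) (x a : ι → ℝ) (b c : ι → A) (τ : ℝ) :
    HasWeakDerivAt (fun t => lift (k + 1) g (x + t • a) (b + t • c))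
      (∑ j, a j • lift (k + 1) (pd j g) (x + τ • a) (b + τ • c)
        + ∑ j, c j * lift k (pd j g) (x + τ • a) (b + τ • c)) τ := by
  have h : HasWeakDerivAt (fun t => lift (k + 1) g (x + t • a) (b + t • c))
      (∑ n ∈ Finset.range (k + 1), ((n.factorial : ℝ)⁻¹) •
        (∑ j, a j • jet n (pd j g) (x + τ • a) (b + τ • c)
        + (n : ℝ) • ∑ j, c j * jet (n - 1) (pd j g) (x + τ • a) (b + τ • c))) τ := by
    refine HasWeakDerivAt.sum _ fun n hn => ?_
    have hn' : n + 1 ≤ k + 1 := by simpa [Nat.lt_succ_iff] using hn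
    exact (jet_hasWeakDerivAt n (hg.of_le (by exact_mod_cast hn')) x a b c τ).map
      ((n.factorial : ℝ)⁻¹ • LinearMap.id)
  convert h using 1
  set x' := x + τ • a
  set b' := b + τ • c
  simp only [smul_add, Finset.sum_add_distrib]
  congr 1
  · simp only [lift, Finset.smul_sum]
    rw [Finset.sum_comm]
    refine Finset.sum_congr rfl fun n _ => Finset.sum_congr rfl fun j _ => ?_
    rw [smul_comm]
  · rw [Finset.sum_range_succ']
    simp only [Nat.cast_zero, zero_smul, smul_zero, Nat.add_sub_cancel, lift,
      Finset.mul_sum, Finset.smul_sum, Finset.sum_const_zero, add_zero]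
    rw [Finset.sum_comm]
    refine Finset.sum_congr rfl fun n _ => Finset.sum_congr rfl fun j _ => ?_
    rw [smul_smul, mul_smul_comm]
    congr 1
    have : ((n.factorial : ℝ)) ≠ 0 := by positivity
    have h2 : ((n : ℝ) + 1) ≠ 0 := by positivity
    rw [Nat.factorial_succ]
    push_cast
    field_simp

end Jets

/-! ### Estimates on jets -/

section SeminormBounds

variable {ι A : Type*} [Fintype ι] [CommRing A] [Algebra ℝ A]

theorem seminorm_sum_le {V κ : Type*} [AddCommGroup V] [Module ℝ V] (p : Seminorm ℝ V)
    (s : Finset κ) (f : κ → V) : p (∑ i ∈ s, f i) ≤ ∑ i ∈ s, p (f i) :=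
  Finset.le_sum_of_subadditive p (map_zero p).le (map_add_le_add p) s f

theorem seminorm_sum_le_card (p : Seminorm ℝ A) {f : ι → A} {C : ℝ} (h : ∀ j, p (f j) ≤ C) :
    p (∑ j, f j) ≤ Fintype.card ι * C := by
  refine (seminorm_sum_le p _ _).trans ((Finset.sum_le_sum fun j _ => h j).trans ?_)
  simp

theorem seminorm_mul_le {p : Seminorm ℝ A} (hp : ∀ x y, p (x * y) ≤ p x * p y) {x y : A}
    {c d : ℝ} (hx : p x ≤ c)
    (hy : p y ≤ d) : p (x * y) ≤ c * d :=
  (hp x y).trans (mul_le_mul hx hy (apply_nonneg _ _) ((apply_nonneg _ _).trans hx))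

theorem seminorm_factorial_smul_le (p : Seminorm ℝ A) (n : ℕ) (x : A) :
    p (((n.factorial : ℝ)⁻¹) • x) ≤ p x := by
  rw [map_smul_eq_mul]
  refine mul_le_of_le_one_left (apply_nonneg _ _) ?_
  rw [Real.norm_of_nonneg (by positivity)]
  exact inv_le_one_of_one_le₀ (by exact_mod_cast n.factorial_pos)

end SeminormBounds

section JetBounds

variable {ι A : Type*} [Fintype ι] [DecidableEq ι] [CommRing A] [Algebra ℝ A]
  {p : Seminorm ℝ A} {P M ρ : ℝ}

theorem jet_le (hp : ∀ x y, p (x * y) ≤ p x * p y) (hP : p 1 ≤ P) (n : ℕ) :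
    ∀ {g : (ι → ℝ) → ℝ}, ContDiff ℝ n g → ∀ {x : ι → ℝ} {b : ι → A},
    ‖iteratedFDeriv ℝ n g x‖ ≤ M → (∀ j, p (b j) ≤ ρ) →
    p (jet n g x b) ≤ P * M * (Fintype.card ι * ρ) ^ n := by
  induction n with
  | zero =>
    intro g hg x b hM hb
    rw [norm_iteratedFDeriv_zero] at hM
    rw [jet, map_smul_eq_mul, pow_zero, mul_one, mul_comm P]
    exact mul_le_mul hM hP (apply_nonneg _ _) ((norm_nonneg _).trans hM)
  | succ n ih =>
    intro g hg x b hM hb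
    refine (seminorm_sum_le_card p fun j => seminorm_mul_le hp (hb j)
      (ih (ContDiff.pd hg j) ((norm_iteratedFDeriv_pd_le hg j x).trans hM) hb)).trans_eq ?_
    ring

theorem lift_le (hp : ∀ x y, p (x * y) ≤ p x * p y) (hP : p 1 ≤ P) (hP0 : 0 ≤ P) (hM0 : 0 ≤ M)
    (hρ : 0 ≤ ρ) (k : ℕ) {g : (ι → ℝ) → ℝ} (hg : ContDiff ℝ k g) {x : ι → ℝ} {b : ι → A}
    (hM : ∀ n < k, ‖iteratedFDeriv ℝ n g x‖ ≤ M) (hb : ∀ j, p (b j) ≤ ρ) :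
    p (lift k g x b) ≤ k * (P * M * (1 + Fintype.card ι * ρ) ^ k) := by
  refine (seminorm_sum_le p _ _).trans ?_
  calc _ ≤ ∑ n ∈ Finset.range k, P * M * (1 + Fintype.card ι * ρ) ^ k := by
        refine Finset.sum_le_sum fun n hn => ?_
        have hn' := Finset.mem_range.1 hn
        refine (seminorm_factorial_smul_le p n _).trans
          ((jet_le hp hP n (hg.of_le (by exact_mod_cast hn'.le)) (hM n hn') hb).trans ?_)
        refine mul_le_mul_of_nonneg_left ?_ (mul_nonneg hP0 hM0)
        have h0 : 0 ≤ Fintype.card ι * ρ := by positivity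
        exact (pow_le_pow_left₀ h0 (by linarith) n).trans
          (pow_le_pow_right₀ (by linarith) hn'.le)
    _ = _ := by simp

/-- Taylor's formula for the extension of `g` to the algebra: the real part `a` of the increment
enters through the derivatives of `g`, its other part `b` only through the jets, and the two expand
together as the single increment `a + b`. -/
theorem lift_taylor [Module.Finite ℝ A] (hp : ∀ x y, p (x * y) ≤ p x * p y) (hP : p 1 ≤ P)
    (hρ : 0 ≤ ρ) (k : ℕ) :
    ∀ {g : (ι → ℝ) → ℝ}, ContDiff ℝ k g → ∀ {x a : ι → ℝ} {b : ι → A},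
    (∀ τ ∈ Icc (0 : ℝ) 1, ‖iteratedFDeriv ℝ k g (x + τ • a)‖ ≤ M) →
    (∀ j, |a j| ≤ ρ) → (∀ j, p (b j) ≤ ρ) → (∀ j, p (a j • 1 + b j) ≤ ρ) →
    p (lift k g (x + a) b - lift k g x (fun j => a j • 1 + b j))
      ≤ k * (P * M * (Fintype.card ι * ρ) ^ k) := by
  induction k with
  | zero =>
    intro g _ x a b _ _ _ _
    simp [lift]
  | succ k ih =>
    intro g hg x a b hM ha hb hv
    set v : ι → A := fun j => a j • 1 + b j with hvdef
    let f' : ℝ → A := fun τ =>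
      (∑ j, v j * (lift k (pd j g) (x + τ • a) (τ • b) - lift k (pd j g) x (τ • v)))
        + ∑ j, a j • ((k.factorial : ℝ)⁻¹ • jet k (pd j g) (x + τ • a) (τ • b))
    have hderiv : ∀ τ ∈ Icc (0 : ℝ) 1, HasWeakDerivAt
        (fun t => lift (k + 1) g (x + t • a) (t • b) - lift (k + 1) g x (t • v)) (f' τ) τ := by
      intro τ _
      have h1 := lift_hasWeakDerivAt k hg x a 0 b τ
      have h2 := lift_hasWeakDerivAt k hg x 0 0 v τ
      simp only [zero_add, smul_zero, add_zero, Pi.zero_apply, zero_smul, Finset.sum_const_zero]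
        at h1 h2
      convert h1.sub h2 using 1
      simp only [f', lift_succ, smul_add, Finset.sum_add_distrib, mul_sub, Finset.sum_sub_distrib,
        hvdef, add_mul, smul_one_mul]
      abel
    have hbound : ∀ τ ∈ Icc (0 : ℝ) 1,
        p (f' τ) ≤ (k + 1 : ℕ) * (P * M * (Fintype.card ι * ρ) ^ (k + 1)) := by
      intro τ hτ
      have scale : ∀ {c r : ℝ}, 0 ≤ c → c ≤ r → τ * c ≤ r := fun h0 h =>
        (mul_le_of_le_one_left h0 hτ.2).trans h
      have hτb : ∀ j, p ((τ • b) j) ≤ ρ := fun j => by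
        rw [Pi.smul_apply, map_smul_eq_mul, Real.norm_of_nonneg hτ.1]
        exact scale (apply_nonneg _ _) (hb j)
      have hτv : τ • v = fun j => (τ • a) j • (1 : A) + (τ • b) j := by
        ext j; simp [hvdef, smul_smul]
      have B1 : ∀ j, p (lift k (pd j g) (x + τ • a) (τ • b) - lift k (pd j g) x (τ • v))
          ≤ k * (P * M * (Fintype.card ι * ρ) ^ k) := by
        intro j
        rw [hτv]
        refine ih (ContDiff.pd hg j) (fun σ hσ => ?_) (fun i => ?_) hτb fun i => ?_
        · refine (norm_iteratedFDeriv_pd_le hg j _).trans ?_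
          rw [smul_smul]
          exact hM _ ⟨mul_nonneg hσ.1 hτ.1, mul_le_one₀ hσ.2 hτ.1 hτ.2⟩
        · rw [Pi.smul_apply, smul_eq_mul, abs_mul, abs_of_nonneg hτ.1]
          exact scale (abs_nonneg _) (ha i)
        · have := congrFun hτv i
          beta_reduce at this
          rw [← this, Pi.smul_apply, map_smul_eq_mul, Real.norm_of_nonneg hτ.1]
          exact scale (apply_nonneg _ _) (hv i)
      have B2 : ∀ j, p ((k.factorial : ℝ)⁻¹ • jet k (pd j g) (x + τ • a) (τ • b))
          ≤ P * M * (Fintype.card ι * ρ) ^ k := fun j =>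
        (seminorm_factorial_smul_le p k _).trans (jet_le hp hP k (ContDiff.pd hg j)
          ((norm_iteratedFDeriv_pd_le hg j _).trans (hM τ hτ)) hτb)
      have C1 := seminorm_sum_le_card p fun j => seminorm_mul_le hp (hv j) (B1 j)
      have C2 := seminorm_sum_le_card p (C := ρ * (P * M * (Fintype.card ι * ρ) ^ k)) fun j => by
        rw [map_smul_eq_mul]
        exact mul_le_mul (ha j) (B2 j) (apply_nonneg _ _) hρ
      refine (map_add_le_add p _ _).trans ((add_le_add C1 C2).trans_eq ?_)
      push_cast
      ring
    have h := seminorm_sub_le_of_hasWeakDerivAt p hderiv hbound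
    simpa using h

/-- The extension of `g` to the algebra is Lipschitz. -/
theorem lift_sub_le [Module.Finite ℝ A] (hp : ∀ x y, p (x * y) ≤ p x * p y) (hP : p 1 ≤ P)
    (hP0 : 0 ≤ P) (hM0 : 0 ≤ M) (hρ : 0 ≤ ρ) (k : ℕ) {g : (ι → ℝ) → ℝ}
    (hg : ContDiff ℝ (k + 1 : ℕ) g) {x a : ι → ℝ} {b c : ι → A}
    (hM : ∀ n ≤ k + 1, ∀ τ ∈ Icc (0 : ℝ) 1, ‖iteratedFDeriv ℝ n g (x + τ • a)‖ ≤ M)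
    (hb : ∀ τ ∈ Icc (0 : ℝ) 1, ∀ j, p ((b + τ • c) j) ≤ ρ) {r : ℝ} (ha : ∀ j, |a j| ≤ r)
    (hc : ∀ j, p (c j) ≤ r) :
    p (lift (k + 1) g (x + a) (b + c) - lift (k + 1) g x b) ≤
      2 * (Fintype.card ι * (r * ((k + 1) * (P * M * (1 + Fintype.card ι * ρ) ^ (k + 1))))) := by
  rcases isEmpty_or_nonempty ι with hι | ⟨⟨i₀⟩⟩
  · have e1 : x + a = x := Subsingleton.elim _ _
    have e2 : b + c = b := Subsingleton.elim _ _
    rw [e1, e2, sub_self, map_zero]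
    simp
  have hr : 0 ≤ r := (abs_nonneg _).trans (ha i₀)
  have h := seminorm_sub_le_of_hasWeakDerivAt p
    (fun τ _ => lift_hasWeakDerivAt k hg x a b c τ) (C := 2 * (Fintype.card ι *
      (r * ((k + 1) * (P * M * (1 + Fintype.card ι * ρ) ^ (k + 1)))))) ?_
  · simpa using h
  intro τ hτ
  have hM' : ∀ j, ∀ n < k + 1, ‖iteratedFDeriv ℝ n (pd j g) (x + τ • a)‖ ≤ M := fun j n hn =>
    (norm_iteratedFDeriv_pd_le (hg.of_le (by exact_mod_cast hn)) j _).trans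
      (hM (n + 1) (by omega) τ hτ)
  have hpd : ∀ j, ContDiff ℝ k (pd j g) := fun j => ContDiff.pd hg j
  have B1 : ∀ j, p (lift (k + 1) (pd j g) (x + τ • a) (b + τ • c))
      ≤ (k + 1) * (P * M * (1 + Fintype.card ι * ρ) ^ (k + 1)) := fun j => by
    refine (seminorm_sum_le p _ _).trans ?_
    calc _ ≤ ∑ n ∈ Finset.range (k + 1), P * M * (1 + Fintype.card ι * ρ) ^ (k + 1) := by
          refine Finset.sum_le_sum fun n hn => ?_
          have hn' := Finset.mem_range.1 hn
          refine (seminorm_factorial_smul_le p n _).trans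
            ((jet_le hp hP n ((hpd j).of_le (by exact_mod_cast Nat.lt_succ_iff.1 hn'))
              (hM' j n hn') (hb τ hτ)).trans ?_)
          refine mul_le_mul_of_nonneg_left ?_ (mul_nonneg hP0 hM0)
          have h0 : 0 ≤ Fintype.card ι * ρ := by positivity
          exact (pow_le_pow_left₀ h0 (by linarith) n).trans
            (pow_le_pow_right₀ (by linarith) hn'.le)
      _ = _ := by simp
  have B2 : ∀ j, p (lift k (pd j g) (x + τ • a) (b + τ • c))
      ≤ (k + 1) * (P * M * (1 + Fintype.card ι * ρ) ^ (k + 1)) := fun j => by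
    refine (lift_le hp hP hP0 hM0 hρ k (hpd j) (fun n hn => hM' j n (by omega)) (hb τ hτ)).trans ?_
    have h0 : 0 ≤ Fintype.card ι * ρ := by positivity
    have := pow_le_pow_right₀ (by linarith : 1 ≤ 1 + Fintype.card ι * ρ) (Nat.le_succ k)
    gcongr
    linarith
  have C1 := seminorm_sum_le_card p fun j => (by
    rw [map_smul_eq_mul]
    exact mul_le_mul (ha j) (B1 j) (apply_nonneg _ _) hr :
    p (a j • lift (k + 1) (pd j g) (x + τ • a) (b + τ • c)) ≤
      r * ((k + 1) * (P * M * (1 + Fintype.card ι * ρ) ^ (k + 1))))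
  have C2 := seminorm_sum_le_card p fun j => seminorm_mul_le hp (hc j) (B2 j)
  refine (map_add_le_add p _ _).trans ((add_le_add C1 C2).trans_eq ?_)
  ring

theorem jet_sub_jet_le (hp : ∀ x y, p (x * y) ≤ p x * p y) (hP : p 1 ≤ P) (hP0 : 0 ≤ P)
    (hM0 : 0 ≤ M) (hρ : 0 ≤ ρ) {r : ℝ} (hr : 0 ≤ r) (n : ℕ) :
    ∀ {g : (ι → ℝ) → ℝ}, ContDiff ℝ n g → ∀ {x : ι → ℝ} {b b' : ι → A},
    ‖iteratedFDeriv ℝ n g x‖ ≤ M → (∀ j, p (b j) ≤ ρ) → (∀ j, p (b' j) ≤ ρ) →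
    (∀ j, p (b j - b' j) ≤ r) → p (jet n g x b - jet n g x b')
      ≤ n * (P * M * (Fintype.card ι * r) * (1 + Fintype.card ι * ρ) ^ n) := by
  induction n with
  | zero => intro g _ x b b' _ _ _ _; simp [jet]
  | succ n ih =>
    intro g hg x b b' hM hb hb' hbb
    have hM' : ∀ j, ‖iteratedFDeriv ℝ n (pd j g) x‖ ≤ M := fun j =>
      (norm_iteratedFDeriv_pd_le hg j x).trans hM
    have e : jet (n + 1) g x b - jet (n + 1) g x b' = ∑ j, ((b j - b' j) * jet n (pd j g) x b
        + b' j * (jet n (pd j g) x b - jet n (pd j g) x b')) := by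
      rw [jet, jet, ← Finset.sum_sub_distrib]
      exact Finset.sum_congr rfl fun j _ => by ring
    rw [e]
    refine (seminorm_sum_le_card p fun j => (map_add_le_add p _ _).trans (add_le_add
      (seminorm_mul_le hp (hbb j) (jet_le hp hP n (ContDiff.pd hg j) (hM' j) hb))
      (seminorm_mul_le hp (hb' j)
        (ih (ContDiff.pd hg j) (hM' j) hb hb' hbb)))).trans ?_
    set c : ℝ := (Fintype.card ι : ℝ) with hc
    have hc0 : 0 ≤ c := by positivity
    have h1 : (c * ρ) ^ n ≤ (1 + c * ρ) ^ (n + 1) :=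
      (pow_le_pow_left₀ (by positivity) (by linarith) n).trans
        (pow_le_pow_right₀ (le_add_of_nonneg_right (by positivity)) (Nat.le_succ n))
    have h2 : c * ρ * (1 + c * ρ) ^ n ≤ (1 + c * ρ) ^ (n + 1) := by
      rw [pow_succ']
      exact mul_le_mul_of_nonneg_right (by linarith) (by positivity)
    have hX : 0 ≤ P * M * (c * r) := by positivity
    have h3 := mul_le_mul_of_nonneg_left h1 hX
    have h4 := mul_le_mul_of_nonneg_left h2 (mul_nonneg (Nat.cast_nonneg (α := ℝ) n) hX)
    calc _ = P * M * (c * r) * (c * ρ) ^ n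
          + n * (P * M * (c * r)) * (c * ρ * (1 + c * ρ) ^ n) := by ring
      _ ≤ _ := add_le_add h3 h4
      _ = _ := by push_cast; ring

/-- A linear map which is multiplicative up to an error `η` intertwines the jets up to the
same order. -/
theorem map_jet_sub_le {p₁ : Seminorm ℝ A} {η : ℝ} {α : A →ₗ[ℝ] A}
    (hp : ∀ x y, p (x * y) ≤ p x * p y) (hp₁ : ∀ x y, p₁ (x * y) ≤ p₁ x * p₁ y)
    (hP : p₁ 1 ≤ P) (hα : α 1 = 1)
    (hmul : ∀ x y, p (α (x * y) - α x * α y) ≤ η * (p₁ x * p₁ y)) (hη : 0 ≤ η) (hρ : 0 ≤ ρ)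
    (n : ℕ) :
    ∀ {g : (ι → ℝ) → ℝ}, ContDiff ℝ n g → ∀ {x : ι → ℝ} {b : ι → A},
    ‖iteratedFDeriv ℝ n g x‖ ≤ M → (∀ j, p₁ (b j) ≤ ρ) → (∀ j, p (α (b j)) ≤ ρ) →
    p (α (jet n g x b) - jet n g x (fun j => α (b j)))
      ≤ n * (η * (P * M * (Fintype.card ι * ρ) ^ n)) := by
  induction n with
  | zero => intro g _ x b _ _ _; simp [jet, hα]
  | succ n ih =>
    intro g hg x b hM hb hb'
    have hM' : ∀ j, ‖iteratedFDeriv ℝ n (pd j g) x‖ ≤ M := fun j =>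
      (norm_iteratedFDeriv_pd_le hg j x).trans hM
    have e : α (jet (n + 1) g x b) - jet (n + 1) g x (fun j => α (b j))
        = ∑ j, ((α (b j * jet n (pd j g) x b) - α (b j) * α (jet n (pd j g) x b))
          + α (b j) * (α (jet n (pd j g) x b) - jet n (pd j g) x (fun j => α (b j)))) := by
      rw [jet, jet, map_sum, ← Finset.sum_sub_distrib]
      exact Finset.sum_congr rfl fun j _ => by ring
    rw [e]
    refine (seminorm_sum_le_card p fun j => (map_add_le_add p _ _).trans (add_le_add
      ((hmul _ _).trans (mul_le_mul_of_nonneg_left (mul_le_mul (hb j)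
        (jet_le hp₁ hP n (ContDiff.pd hg j) (hM' j) hb) (apply_nonneg _ _) hρ) hη))
      (seminorm_mul_le hp (hb' j) (ih (ContDiff.pd hg j) (hM' j) hb hb')))).trans_eq ?_
    push_cast
    ring

/-- The extension of `g` to the algebra commutes with an almost multiplicative map `α`: if the
point `z' = x + a + b'` is close to `α (x + b)`, then `g(z')` is close to `α (g(x + b))`. -/
theorem lift_sub_map_lift_le [Module.Finite ℝ A] {p₁ : Seminorm ℝ A} {η ρ₁ r : ℝ}
    {α : A →ₗ[ℝ] A} (hp : ∀ x y, p (x * y) ≤ p x * p y)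
    (hp₁ : ∀ x y, p₁ (x * y) ≤ p₁ x * p₁ y)
    (hP : p 1 ≤ P) (hP₁ : p₁ 1 ≤ P) (hα : α 1 = 1)
    (hmul : ∀ x y, p (α (x * y) - α x * α y) ≤ η * (p₁ x * p₁ y)) (hη : 0 ≤ η)
    (hM0 : 0 ≤ M) (hρ : 0 ≤ ρ) (hρ₁ : ρ ≤ ρ₁) (hr : 0 ≤ r) (k : ℕ)
    {g : (ι → ℝ) → ℝ} (hg : ContDiff ℝ k g) {x a : ι → ℝ} {b b' : ι → A}
    (hM : ∀ n ≤ k, ∀ τ ∈ Icc (0 : ℝ) 1, ‖iteratedFDeriv ℝ n g (x + τ • a)‖ ≤ M)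
    (ha : ∀ j, |a j| ≤ ρ) (hb' : ∀ j, p (b' j) ≤ ρ) (hv : ∀ j, p (a j • 1 + b' j) ≤ ρ)
    (hαb : ∀ j, p (α (b j)) ≤ ρ) (hb : ∀ j, p₁ (b j) ≤ ρ₁)
    (hR : ∀ j, p (a j • 1 + b' j - α (b j)) ≤ r) :
    p (lift k g (x + a) b' - α (lift k g x b)) ≤ k * (P * M * (Fintype.card ι * ρ) ^ k)
      + k * (k * (P * M * (Fintype.card ι * r + η) * (1 + Fintype.card ι * ρ₁) ^ k)) := by
  have hP0 : 0 ≤ P := (apply_nonneg _ _).trans hP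
  have T := lift_taylor hp hP hρ k hg (fun τ hτ => hM k le_rfl τ hτ) ha hb' hv
  set v : ι → A := fun j => a j • 1 + b' j with hvdef
  set c : ℝ := (Fintype.card ι : ℝ) with hc
  have hc0 : 0 ≤ c := by positivity
  have hρ₁0 : 0 ≤ ρ₁ := hρ.trans hρ₁
  have S : p (lift k g x v - α (lift k g x b))
      ≤ k * (k * (P * M * (c * r + η) * (1 + c * ρ₁) ^ k)) := by
    have e : lift k g x v - α (lift k g x b) = ∑ n ∈ Finset.range k, ((n.factorial : ℝ)⁻¹) •
        ((jet n g x v - jet n g x fun j => α (b j))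
          - (α (jet n g x b) - jet n g x fun j => α (b j))) := by
      simp only [lift, map_sum, map_smul, ← Finset.sum_sub_distrib, ← smul_sub]
      exact Finset.sum_congr rfl fun n _ => by congr 1; abel
    rw [e]
    refine (seminorm_sum_le p _ _).trans ?_
    calc _ ≤ ∑ n ∈ Finset.range k, k * (P * M * (c * r + η) * (1 + c * ρ₁) ^ k) := by
          refine Finset.sum_le_sum fun n hn => ?_
          have hn' := Finset.mem_range.1 hn
          have hMn : ‖iteratedFDeriv ℝ n g x‖ ≤ M := by
            simpa using hM n hn'.le 0 ⟨le_rfl, zero_le_one⟩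
          have hgn : ContDiff ℝ n g := hg.of_le (by exact_mod_cast hn'.le)
          have h1 := jet_sub_jet_le hp hP hP0 hM0 hρ₁0 hr n hgn hMn
            (fun j => (hv j).trans hρ₁) (fun j => (hαb j).trans hρ₁) hR
          have h2 := map_jet_sub_le hp hp₁ hP₁ hα hmul hη hρ₁0 n hgn hMn hb
            (fun j => (hαb j).trans hρ₁)
          refine (seminorm_factorial_smul_le p n _).trans ((map_sub_le_add p _ _).trans
            ((add_le_add h1 h2).trans ?_))
          have e1 : (1 + c * ρ₁) ^ n ≤ (1 + c * ρ₁) ^ k :=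
            pow_le_pow_right₀ (le_add_of_nonneg_right (by positivity)) hn'.le
          have e2 : (c * ρ₁) ^ n ≤ (1 + c * ρ₁) ^ k :=
            (pow_le_pow_left₀ (by positivity) (by linarith) n).trans e1
          have e3 : (n : ℝ) ≤ k := by exact_mod_cast hn'.le
          calc _ ≤ k * (P * M * (c * r) * (1 + c * ρ₁) ^ k)
                + k * (η * (P * M * (1 + c * ρ₁) ^ k)) := by gcongr
            _ = _ := by ring
      _ = _ := by simp
  have e : lift k g (x + a) b' - α (lift k g x b)
      = (lift k g (x + a) b' - lift k g x v) + (lift k g x v - α (lift k g x b)) := by abel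
  rw [e]
  exact (map_add_le_add p _ _).trans (add_le_add T S)

end JetBounds

section JetDifference

variable {ι A : Type*} [Fintype ι] [DecidableEq ι] [CommRing A] [Algebra ℝ A]

/-- The difference of two instances of the defect `g(z') - α (g(z))`, estimated through the mean
value inequality along the segments which join them: the derivative of the defect is the
defect of the partial derivatives of `g`, multiplied by the increments. -/
theorem lift_defect_sub_le [Module.Finite ℝ A] {p p₁ : Seminorm ℝ A} {η X Y W κ₀ κ₁ κ₂ : ℝ}
    {α : A →ₗ[ℝ] A} (hp : ∀ x y, p (x * y) ≤ p x * p y)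
    (hmul : ∀ x y, p (α (x * y) - α x * α y) ≤ η * (p₁ x * p₁ y)) (hη : 0 ≤ η) (k : ℕ)
    {g : (ι → ℝ) → ℝ} (hg : ContDiff ℝ (k + 1 : ℕ) g) {x a x' a' : ι → ℝ} {b c b' c' : ι → A}
    (hX : ∀ τ ∈ Icc (0 : ℝ) 1, ∀ j, p (lift (k + 1) (pd j g) (x' + τ • a') (b' + τ • c')
      - α (lift (k + 1) (pd j g) (x + τ • a) (b + τ • c))) ≤ X)
    (hY : ∀ τ ∈ Icc (0 : ℝ) 1, ∀ j,
      p (α (lift (k + 1) (pd j g) (x + τ • a) (b + τ • c))) ≤ Y)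
    (hY₁ : ∀ τ ∈ Icc (0 : ℝ) 1, ∀ j, p₁ (lift (k + 1) (pd j g) (x + τ • a) (b + τ • c)) ≤ Y)
    (hW' : ∀ τ ∈ Icc (0 : ℝ) 1, ∀ j, p (c' j * jet k (pd j g) (x' + τ • a') (b' + τ • c')) ≤ W)
    (hW : ∀ τ ∈ Icc (0 : ℝ) 1, ∀ j, p (α (c j * jet k (pd j g) (x + τ • a) (b + τ • c))) ≤ W)
    (h0 : ∀ j, p (a' j • 1 + c' j) ≤ κ₀)
    (h1 : ∀ j, p (a' j • 1 + c' j - α (a j • 1 + c j)) ≤ κ₁)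
    (h2 : ∀ j, p₁ (a j • 1 + c j) ≤ κ₂) :
    p ((lift (k + 1) g (x' + a') (b' + c') - α (lift (k + 1) g (x + a) (b + c)))
        - (lift (k + 1) g x' b' - α (lift (k + 1) g x b)))
      ≤ Fintype.card ι * (κ₀ * X + κ₁ * Y + η * (κ₂ * Y)) + Fintype.card ι * (W + W) := by
  have h := seminorm_sub_le_of_hasWeakDerivAt p
    (fun τ _ => (lift_hasWeakDerivAt k hg x' a' b' c' τ).sub
      ((lift_hasWeakDerivAt k hg x a b c τ).map α))
    (C := Fintype.card ι * (κ₀ * X + κ₁ * Y + η * (κ₂ * Y)) + Fintype.card ι * (W + W)) ?_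
  · simpa using h
  intro τ hτ
  set z' := x' + τ • a'
  set z := x + τ • a
  set β' := b' + τ • c'
  set β := b + τ • c
  have e : ∑ j, a' j • lift (k + 1) (pd j g) z' β' + ∑ j, c' j * lift k (pd j g) z' β'
      - α (∑ j, a j • lift (k + 1) (pd j g) z β + ∑ j, c j * lift k (pd j g) z β)
      = ∑ j, ((a' j • 1 + c' j) * (lift (k + 1) (pd j g) z' β' - α (lift (k + 1) (pd j g) z β))
          + (a' j • 1 + c' j - α (a j • 1 + c j)) * α (lift (k + 1) (pd j g) z β)
          - (α ((a j • 1 + c j) * lift (k + 1) (pd j g) z β)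
              - α (a j • 1 + c j) * α (lift (k + 1) (pd j g) z β)))
        - ∑ j, (((k.factorial : ℝ)⁻¹) • (c' j * jet k (pd j g) z' β')
          - ((k.factorial : ℝ)⁻¹) • α (c j * jet k (pd j g) z β)) := by
    rw [← Finset.sum_add_distrib, ← Finset.sum_add_distrib, map_sum, ← Finset.sum_sub_distrib,
      ← Finset.sum_sub_distrib]
    refine Finset.sum_congr rfl fun j _ => ?_
    have e1 : ∀ (u : ι → ℝ) (v : ι → A), lift k (pd j g) u v = lift (k + 1) (pd j g) u v
        - ((k.factorial : ℝ)⁻¹) • jet k (pd j g) u v := fun u v => by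
      rw [lift_succ, add_sub_cancel_right]
    rw [e1, e1]
    simp only [map_add, map_sub, map_smul, mul_sub, add_mul, sub_mul, smul_mul_assoc, one_mul,
      mul_smul_comm]
    abel
  rw [e]
  refine (map_sub_le_add p _ _).trans (add_le_add (seminorm_sum_le_card p fun j => ?_)
    (seminorm_sum_le_card p fun j => ?_))
  · refine (map_sub_le_add p _ _).trans (add_le_add ((map_add_le_add p _ _).trans (add_le_add
      (seminorm_mul_le hp (h0 j) (hX τ hτ j)) (seminorm_mul_le hp (h1 j) (hY τ hτ j)))) ?_)
    refine (hmul _ _).trans (mul_le_mul_of_nonneg_left ?_ hη)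
    exact mul_le_mul (h2 j) (hY₁ τ hτ j) (apply_nonneg _ _) ((apply_nonneg _ _).trans (h2 j))
  · exact (map_sub_le_add p _ _).trans (add_le_add
      ((seminorm_factorial_smul_le p k _).trans (hW' τ hτ j))
      ((seminorm_factorial_smul_le p k _).trans (hW τ hτ j)))

end JetDifference

/-! ### Families of norms compatible with dilations -/

section Scale

variable {H : Type*} [CommRing H] [Algebra ℝ H] [Coalgebra ℝ H]

/-- A family `P r` of algebra seminorms on `H`, to be thought of as `P r h = ∑ r^j ‖π_j h‖`. A bound
`P r h ≤ C r^N` says that the component of degree `j` of `h` is of order `r^(N - j)`, as in the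
definition of controlled paths. One constant `Γ` serves for all inequalities; `Λ` bounds the
range of `r`. -/
structure IsScale (P : ℝ → Seminorm ℝ H) (Γ Λ : ℝ) : Prop where
  one_le_range : 1 ≤ Λ
  range_le : Λ ≤ Γ
  mul_le : ∀ r x y, P r (x * y) ≤ P r x * P r y
  one : ∀ r, P r 1 ≤ Γ
  counit_one : Coalgebra.counit (R := ℝ) (1 : H) = 1
  counit : ∀ r x, |Coalgebra.counit (R := ℝ) x| ≤ Γ * P r x
  le : ∀ r, 0 < r → r ≤ Λ → ∀ x, P r x ≤ Γ * P 1 x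
  small : ∀ r, 0 < r → r ≤ Λ → ∀ x, Coalgebra.counit (R := ℝ) x = 0 → P r x ≤ Γ * r * P 1 x

/-- `α` is a unital map, bounded for `P r` and multiplicative up to an error of order `r^N`. The
transposes `act ξ` of the characters of a rough path have this property. -/
structure IsScaled (P : ℝ → Seminorm ℝ H) (N : ℕ) (Γ r : ℝ) (α : H →ₗ[ℝ] H) : Prop where
  map_one : α 1 = 1
  bound : ∀ x, P r (α x) ≤ Γ * P r x
  map_mul : ∀ x y, P r (α (x * y) - α x * α y) ≤ Γ * r ^ N * (P 1 x * P 1 y)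

theorem IsScale.one_le {P : ℝ → Seminorm ℝ H} {Γ Λ : ℝ} (hP : IsScale P Γ Λ) : 1 ≤ Γ :=
  hP.one_le_range.trans hP.range_le

theorem bar_eq (z : H) : bar z = z - Coalgebra.counit (R := ℝ) z • (1 : H) := by
  rw [bar, Algebra.algebraMap_eq_smul_one]

theorem bar_add (y z : H) : bar (y + z) = bar y + bar z := by
  simp only [bar_eq, map_add, add_smul]; abel

theorem bar_sub (y z : H) : bar (y - z) = bar y - bar z := by
  simp only [bar_eq, map_sub, sub_smul]; abel

theorem bar_smul (c : ℝ) (z : H) : bar (c • z) = c • bar z := by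
  simp only [bar_eq, map_smul, smul_sub, smul_eq_mul, mul_smul]

theorem counit_bar (h : Coalgebra.counit (R := ℝ) (1 : H) = 1) (z : H) :
    Coalgebra.counit (R := ℝ) (bar z) = 0 := by
  rw [bar_eq, map_sub, map_smul, h, smul_eq_mul, mul_one, sub_self]

variable {ι : Type*} [Fintype ι] [DecidableEq ι]

/-- The vector in `ℝ^ι` of the real parts of a vector in `H^ι`. -/
noncomputable def base (w : ι → H) : ι → ℝ := fun j => Coalgebra.counit (R := ℝ) (w j)

/-- The extension of `g` to `H^ι` by its Taylor series, cut after `k` terms. -/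
noncomputable def ev (k : ℕ) (g : (ι → ℝ) → ℝ) (w : ι → H) : H :=
  lift k g (base w) (fun j => bar (w j))

variable {P : ℝ → Seminorm ℝ H} {Γ Λ : ℝ} {N : ℕ}

theorem IsScale.bar_le (hP : IsScale P Γ Λ) {r A : ℝ} (hr : 0 < r) (hrΛ : r ≤ Λ) {z : H}
    (hz : P 1 (bar z) ≤ A) : P r (bar z) ≤ Γ * r * A :=
  (hP.small r hr hrΛ _ (counit_bar hP.counit_one z)).trans
    (mul_le_mul_of_nonneg_left hz (mul_nonneg (zero_le_one.trans hP.one_le) hr.le))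

theorem IsScale.bar_le_self (hP : IsScale P Γ Λ) {r s : ℝ} {z : H} (hz : P r z ≤ s) :
    P r (bar z) ≤ (1 + Γ ^ 2) * s := by
  have hΓ := zero_le_one.trans hP.one_le
  rw [bar_eq]
  refine (map_sub_le_add _ _ _).trans ?_
  rw [map_smul_eq_mul, Real.norm_eq_abs]
  have h1 := mul_le_mul (hP.counit r z) (hP.one r) (apply_nonneg _ _)
    (mul_nonneg hΓ (apply_nonneg _ _))
  nlinarith [mul_nonneg hΓ hΓ]

theorem IsScale.ev_le (hP : IsScale P Γ Λ) {A M : ℝ} (hA : 0 ≤ A) (hM : 0 ≤ M) (N : ℕ) (ι : Type*)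
    [Fintype ι] [DecidableEq ι] :
    ∃ K : ℝ, 0 ≤ K ∧ ∀ g : (ι → ℝ) → ℝ, ContDiff ℝ N g → ∀ r, 0 < r → r ≤ Λ → ∀ w : ι → H,
      (∀ j, P r (bar (w j)) ≤ A) → (∀ n < N, ‖iteratedFDeriv ℝ n g (base w)‖ ≤ M) →
      P r (ev N g w) ≤ K := by
  have hΓ := zero_le_one.trans hP.one_le
  exact ⟨_, by positivity, fun g hg r hr hrΛ w hw hD =>
    lift_le (hP.mul_le r) (hP.one r) hΓ hM hA N hg hD hw⟩

/-- The extension of `g` commutes with `α` up to an error of order `r^N`. -/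
theorem IsScale.ev_sub_map_le [Module.Finite ℝ H] (hP : IsScale P Γ Λ) {A M : ℝ} (hA : 0 ≤ A)
    (hM : 0 ≤ M) (N : ℕ) (ι : Type*) [Fintype ι] [DecidableEq ι] :
    ∃ K : ℝ, 0 ≤ K ∧ ∀ g : (ι → ℝ) → ℝ, ContDiff ℝ N g → ∀ r, 0 < r → r ≤ Λ →
      ∀ α : H →ₗ[ℝ] H, IsScaled P N Γ r α → ∀ w w' : ι → H, (∀ j, P 1 (bar (w j)) ≤ A) →
      (∀ j, P 1 (bar (w' j)) ≤ A) →
      (∀ n ≤ N, ∀ τ ∈ Icc (0 : ℝ) 1,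
        ‖iteratedFDeriv ℝ n g (base w + τ • (base w' - base w))‖ ≤ M) →
      ∀ R, 0 ≤ R → R ≤ A * r → (∀ j, P r (w' j - α (w j)) ≤ R) →
      P r (ev N g w' - α (ev N g w)) ≤ K * (R + r ^ N) := by
  have hΓ1 := hP.one_le
  have hΓ := zero_le_one.trans hΓ1
  set e : ℝ := (Fintype.card ι : ℝ) with he
  have he0 : 0 ≤ e := by positivity
  set c := Γ * (A * (1 + Γ ^ 2)) with hc
  have hc0 : 0 ≤ c := by positivity
  refine ⟨N * (Γ * M * (e * c) ^ N) + N * (N * (Γ * M * (e + Γ) * (1 + e * (Γ * c)) ^ N)),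
    by positivity, fun g hg r hr hrΛ α hα w w' hw hw' hD R hR hRr hwR => ?_⟩
  have hrΓ := hrΛ.trans hP.range_le
  have hv : ∀ j, P r ((base w' - base w) j • 1 + bar (w' j)) ≤ A * (1 + Γ ^ 2) * r := by
    intro j
    have e1 : (base w' - base w) j • (1 : H) + bar (w' j) = (w' j - α (w j)) + α (bar (w j)) := by
      rw [bar_eq, bar_eq, map_sub, map_smul, hα.map_one]
      simp only [Pi.sub_apply, base, sub_smul]
      abel
    rw [e1]
    refine (map_add_le_add _ _ _).trans ?_
    have h1 := (hα.bound (bar (w j))).trans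
      (mul_le_mul_of_nonneg_left (hP.bar_le hr hrΛ (hw j)) hΓ)
    have h2 := (hwR j).trans hRr
    linarith
  have hle : A * (1 + Γ ^ 2) * r ≤ c * r := by
    rw [hc]
    refine mul_le_mul_of_nonneg_right ?_ hr.le
    exact le_mul_of_one_le_left (by positivity) hΓ1
  have hΓA : Γ * A ≤ c := by
    rw [hc]
    refine mul_le_mul_of_nonneg_left ?_ hΓ
    nlinarith [mul_nonneg hA (sq_nonneg Γ)]
  have key := lift_sub_map_lift_le (p := P r) (p₁ := P 1) (η := Γ * r ^ N) (ρ := c * r)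
    (ρ₁ := Γ * c) (r := R) (P := Γ) (M := M) (α := α) (hP.mul_le r) (hP.mul_le 1) (hP.one r)
    (hP.one 1) hα.map_one hα.map_mul (by positivity) hM (by positivity)
    (by nlinarith) hR N hg (x := base w) (a := base w' - base w) (b := fun j => bar (w j))
    (b' := fun j => bar (w' j)) hD ?_ ?_ (fun j => (hv j).trans hle) ?_ ?_ ?_
  · rw [add_sub_cancel] at key
    refine key.trans ?_
    rw [← he]
    have h1 : (e * (c * r)) ^ N = (e * c) ^ N * r ^ N := by rw [← mul_assoc, mul_pow]
    have h2 : (e * R + Γ * r ^ N) ≤ (e + Γ) * (R + r ^ N) := by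
      have : 0 ≤ r ^ N := by positivity
      nlinarith [mul_nonneg he0 this, mul_nonneg hΓ hR]
    have h3 : 0 ≤ r ^ N := by positivity
    calc _ ≤ N * (Γ * M * ((e * c) ^ N * r ^ N)) + N * (N * (Γ * M * ((e + Γ) * (R + r ^ N))
          * (1 + e * (Γ * c)) ^ N)) := by rw [h1]; gcongr
      _ ≤ N * (Γ * M * ((e * c) ^ N * (R + r ^ N))) + N * (N * (Γ * M * ((e + Γ) * (R + r ^ N))
          * (1 + e * (Γ * c)) ^ N)) := by gcongr; linarith
      _ = _ := by ring
  · intro j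
    -- the real part of `w' - ε(w)` is bounded by its norm
    have h1 := hP.counit r ((base w' - base w) j • 1 + bar (w' j))
    rw [map_add, counit_bar hP.counit_one, map_smul, hP.counit_one, smul_eq_mul, mul_one,
      add_zero] at h1
    refine h1.trans ((mul_le_mul_of_nonneg_left (hv j) hΓ).trans_eq ?_)
    rw [hc]; ring
  · intro j
    refine (hP.bar_le hr hrΛ (hw' j)).trans ?_
    nlinarith
  · intro j
    refine (hα.bound _).trans ((mul_le_mul_of_nonneg_left (hP.bar_le hr hrΛ (hw j)) hΓ).trans ?_)
    refine le_trans ?_ hle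
    nlinarith [mul_nonneg hA hr.le]
  · intro j
    refine (hw j).trans ?_
    have : A ≤ Γ * A := le_mul_of_one_le_left hA hΓ1
    exact (this.trans hΓA).trans (le_mul_of_one_le_left hc0 hΓ1)
  · intro j
    have e1 : (base w' - base w) j • (1 : H) + bar (w' j) - α (bar (w j)) = w' j - α (w j) := by
      rw [bar_eq, bar_eq, map_sub, map_smul, hα.map_one]
      simp only [Pi.sub_apply, base, sub_smul]
      abel
    rw [e1]
    exact hwR j

/-- The extension of `g` is Lipschitz for each of the norms. -/
theorem IsScale.ev_sub_le [Module.Finite ℝ H] (hP : IsScale P Γ Λ) {A M : ℝ} (hA : 0 ≤ A)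
    (hM : 0 ≤ M) (hN : 1 ≤ N) (ι : Type*) [Fintype ι] [DecidableEq ι] :
    ∃ K : ℝ, 0 ≤ K ∧ ∀ g : (ι → ℝ) → ℝ, ContDiff ℝ N g → ∀ r, 0 < r → r ≤ Λ →
      ∀ w w' : ι → H, (∀ j, P 1 (bar (w j)) ≤ A) → (∀ j, P 1 (bar (w' j)) ≤ A) →
      (∀ n ≤ N, ∀ τ ∈ Icc (0 : ℝ) 1,
        ‖iteratedFDeriv ℝ n g (base w + τ • (base w' - base w))‖ ≤ M) →
      ∀ R, 0 ≤ R → (∀ j, P r (w' j - w j) ≤ R) → P r (ev N g w' - ev N g w) ≤ K * R := by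
  obtain ⟨k, rfl⟩ : ∃ k, N = k + 1 := ⟨N - 1, by omega⟩
  have hΓ1 := hP.one_le
  have hΓ := zero_le_one.trans hΓ1
  set e : ℝ := (Fintype.card ι : ℝ) with he
  have he0 : 0 ≤ e := by positivity
  set X := (k + 1) * (Γ * M * (1 + e * (Γ * Γ * A)) ^ (k + 1)) with hX
  refine ⟨2 * (e * ((1 + Γ ^ 2) * X)), by positivity,
    fun g hg r hr hrΛ w w' hw hw' hD R hR hwR => ?_⟩
  have hrΓ := hrΛ.trans hP.range_le
  have hbar : ∀ {z : H}, P 1 (bar z) ≤ A → P r (bar z) ≤ Γ * Γ * A := fun h =>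
    (hP.bar_le hr hrΛ h).trans (by gcongr)
  have key := lift_sub_le (p := P r) (P := Γ) (M := M) (ρ := Γ * Γ * A) (hP.mul_le r) (hP.one r)
    hΓ hM (by positivity) k hg (x := base w) (a := base w' - base w) (b := fun j => bar (w j))
    (c := fun j => bar (w' j) - bar (w j)) (r := (1 + Γ ^ 2) * R) hD ?_ ?_ ?_
  · rw [add_sub_cancel] at key
    have e1 : ((fun j => bar (w j)) + fun j => bar (w' j) - bar (w j)) = fun j => bar (w' j) := by
      ext j; simp
    rw [e1] at key
    refine key.trans_eq ?_
    rw [hX, ← he]; ring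
  · intro τ hτ j
    have e1 : ((fun j => bar (w j)) + τ • fun j => bar (w' j) - bar (w j)) j
        = (1 - τ) • bar (w j) + τ • bar (w' j) := by
      simp only [Pi.add_apply, Pi.smul_apply, smul_sub, sub_smul, one_smul]
      abel
    rw [e1]
    refine (map_add_le_add _ _ _).trans ?_
    rw [map_smul_eq_mul, map_smul_eq_mul, Real.norm_of_nonneg hτ.1,
      Real.norm_of_nonneg (sub_nonneg.2 hτ.2)]
    nlinarith [hbar (hw j), hbar (hw' j), hτ.1, hτ.2]
  · intro j
    have h1 := hP.counit r (w' j - w j)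
    rw [map_sub] at h1
    refine h1.trans ((mul_le_mul_of_nonneg_left (hwR j) hΓ).trans ?_)
    exact mul_le_mul_of_nonneg_right (by nlinarith) hR
  · intro j
    rw [← bar_sub]
    exact hP.bar_le_self (hwR j)

end Scale

section ScaleDifference

variable {H : Type*} [CommRing H] [Algebra ℝ H] [Coalgebra ℝ H]
variable {P : ℝ → Seminorm ℝ H} {Γ Λ : ℝ} {N : ℕ}

/-- The defect `g(w') - α (g(w))` depends in a Lipschitz way on `w`, `w'` and their own defect; this
costs one more derivative of `g`. -/
theorem IsScale.ev_defect_sub_le [Module.Finite ℝ H] (hP : IsScale P Γ Λ) {A M : ℝ} (hA : 0 ≤ A)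
    (hM : 0 ≤ M) (hN : 1 ≤ N) (ι : Type*) [Fintype ι] [DecidableEq ι] :
    ∃ K : ℝ, 0 ≤ K ∧ ∀ g : (ι → ℝ) → ℝ, ContDiff ℝ (N + 1 : ℕ) g → ∀ r, 0 < r → r ≤ Λ →
      ∀ α : H →ₗ[ℝ] H, IsScaled P N Γ r α → ∀ w w' y y' : ι → H,
      (∀ j, P 1 (bar (w j)) ≤ A) → (∀ j, P 1 (bar (w' j)) ≤ A) →
      (∀ j, P 1 (bar (y j)) ≤ A) → (∀ j, P 1 (bar (y' j)) ≤ A) →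
      ∀ U : Set (ι → ℝ), Convex ℝ U → (∀ x ∈ U, ∀ n ≤ N + 1, ‖iteratedFDeriv ℝ n g x‖ ≤ M) →
      base w ∈ U → base w' ∈ U → base y ∈ U → base y' ∈ U →
      (∀ j, P r (w' j - α (w j)) ≤ A * r ^ N) → (∀ j, P r (y' j - α (y j)) ≤ A * r ^ N) →
      ∀ κ, 0 ≤ κ → (∀ j, P 1 (w j - y j) ≤ κ) → (∀ j, P 1 (w' j - y' j) ≤ κ) →
      (∀ j, P r ((w' j - α (w j)) - (y' j - α (y j))) ≤ κ * r ^ N) →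
      P r ((ev N g w' - α (ev N g w)) - (ev N g y' - α (ev N g y))) ≤ K * (κ * r ^ N) := by
  obtain ⟨k, rfl⟩ : ∃ k, N = k + 1 := ⟨N - 1, by omega⟩
  have hΓ1 := hP.one_le
  have hΓ := zero_le_one.trans hΓ1
  have hA₂ : 0 ≤ A * Γ ^ (k + 1) := by positivity
  have hAA₂ : A ≤ A * Γ ^ (k + 1) := le_mul_of_one_le_right hA (one_le_pow₀ hΓ1)
  obtain ⟨K₁, hK₁, comp⟩ := hP.ev_sub_map_le hA₂ hM (k + 1) ι
  obtain ⟨K₂, hK₂, bdd⟩ := hP.ev_le (A := Γ * Γ * A) (by positivity) hM (k + 1) ι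
  set e : ℝ := (Fintype.card ι : ℝ) with he
  have he0 : 0 ≤ e := by positivity
  set D := Γ * (Γ * (1 + Γ ^ 2) * (Γ * M * (e * (Γ * A)) ^ k)) with hD
  have hD0 : 0 ≤ D := by positivity
  refine ⟨e * (Γ * (K₁ * (A + 1)) + Γ * K₂ + Γ * (Γ * K₂)) + e * (D + D), by positivity, ?_⟩
  intro g hg r hr hrΛ α hα w w' y y' hw hw' hy hy' U hU hUM bw bw' by_ by' hwα hyα κ hκ h1 h2 h3
  have hrΓ := hrΛ.trans hP.range_le
  have hpd : ∀ j, ContDiff ℝ (k + 1 : ℕ) (pd j g) := fun j => ContDiff.pd hg j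
  have hpdM : ∀ j, ∀ n ≤ k + 1, ∀ x ∈ U, ‖iteratedFDeriv ℝ n (pd j g) x‖ ≤ M := fun j n hn x hx =>
    (norm_iteratedFDeriv_pd_le (hg.of_le (by exact_mod_cast Nat.succ_le_succ hn)) j x).trans
      (hUM x hx (n + 1) (by omega))
  -- points of the segments which join `y` to `w` and `y'` to `w'`
  let pt : ℝ → (ι → H) → (ι → H) → ι → H := fun τ u v j => v j + τ • (u j - v j)
  have pt_bar : ∀ τ u v, (fun j => bar (pt τ u v j))
      = (fun j => bar (v j)) + τ • (fun j => bar (u j) - bar (v j)) := by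
    intro τ u v; ext j; simp only [pt, bar_add, bar_smul, bar_sub]; rfl
  have pt_base : ∀ τ u v, base (pt τ u v) = base v + τ • (base u - base v) := by
    intro τ u v; ext j; simp [pt, base]
  have pt_mem : ∀ τ ∈ Icc (0 : ℝ) 1, ∀ u v, base u ∈ U → base v ∈ U → base (pt τ u v) ∈ U := by
    intro τ hτ u v hu hv
    rw [pt_base]
    exact hU.add_smul_sub_mem hv hu hτ
  have conv_le : ∀ (p : Seminorm ℝ H) {τ : ℝ}, τ ∈ Icc (0 : ℝ) 1 → ∀ {u v : H} {c : ℝ}, p u ≤ c →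
      p v ≤ c → p (v + τ • (u - v)) ≤ c := by
    intro p τ hτ u v c hu hv
    have e1 : v + τ • (u - v) = (1 - τ) • v + τ • u := by
      rw [smul_sub, sub_smul, one_smul]; abel
    rw [e1]
    refine (map_add_le_add _ _ _).trans ?_
    rw [map_smul_eq_mul, map_smul_eq_mul, Real.norm_of_nonneg hτ.1,
      Real.norm_of_nonneg (sub_nonneg.2 hτ.2)]
    nlinarith [hτ.1, hτ.2]
  have pt_bar_le : ∀ τ ∈ Icc (0 : ℝ) 1, ∀ u v : ι → H, (∀ j, P 1 (bar (u j)) ≤ A) →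
      (∀ j, P 1 (bar (v j)) ≤ A) → ∀ j, P 1 (bar (pt τ u v j)) ≤ A := by
    intro τ hτ u v hu hv j
    simp only [pt, bar_add, bar_smul, bar_sub]
    exact conv_le _ hτ (hu j) (hv j)
  have segU : ∀ τ ∈ Icc (0 : ℝ) 1, ∀ j, ∀ n ≤ k + 1, ∀ σ ∈ Icc (0 : ℝ) 1,
      ‖iteratedFDeriv ℝ n (pd j g) (base (pt τ w y)
        + σ • (base (pt τ w' y') - base (pt τ w y)))‖ ≤ M := fun τ hτ j n hn σ hσ =>
    hpdM j n hn _ (hU.add_smul_sub_mem (pt_mem τ hτ _ _ bw by_) (pt_mem τ hτ _ _ bw' by') hσ)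
  have lift_eq : ∀ τ j u v, lift (k + 1) (pd j g) (base v + τ • (base u - base v))
      ((fun j => bar (v j)) + τ • fun j => bar (u j) - bar (v j))
        = ev (k + 1) (pd j g) (pt τ u v) := by
    intro τ j u v; rw [ev, pt_bar, pt_base]
  have hX : ∀ τ ∈ Icc (0 : ℝ) 1, ∀ j, P r (ev (k + 1) (pd j g) (pt τ w' y')
      - α (ev (k + 1) (pd j g) (pt τ w y))) ≤ K₁ * (A + 1) * r ^ (k + 1) := by
    intro τ hτ j
    have := comp (pd j g) (hpd j) r hr hrΛ α hα (pt τ w y) (pt τ w' y')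
      (fun i => (pt_bar_le τ hτ w y hw hy i).trans hAA₂)
      (fun i => (pt_bar_le τ hτ w' y' hw' hy' i).trans hAA₂) (segU τ hτ j) (A * r ^ (k + 1))
      (by positivity) ?_ ?_
    · refine this.trans_eq ?_
      ring
    · rw [pow_succ, ← mul_assoc]
      refine mul_le_mul_of_nonneg_right (mul_le_mul_of_nonneg_left ?_ hA) hr.le
      exact (pow_le_pow_left₀ hr.le hrΓ k).trans (pow_le_pow_right₀ hΓ1 (Nat.le_succ k))
    · intro i
      have e1 : pt τ w' y' i - α (pt τ w y i)
          = (y' i - α (y i)) + τ • ((w' i - α (w i)) - (y' i - α (y i))) := by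
        simp only [pt, map_add, map_smul, map_sub, smul_sub]
        abel
      rw [e1]
      exact conv_le _ hτ (hwα i) (hyα i)
  have hY : ∀ s, 0 < s → s ≤ Λ → ∀ τ ∈ Icc (0 : ℝ) 1, ∀ j,
      P s (ev (k + 1) (pd j g) (pt τ w y)) ≤ K₂ := fun s hs hsΛ τ hτ j =>
    have hsΓ := hsΛ.trans hP.range_le
    bdd _ (hpd j) s hs hsΛ _ (fun i => (hP.bar_le hs hsΛ (pt_bar_le τ hτ w y hw hy i)).trans
      (by gcongr)) fun n hn => hpdM j n hn.le _ (pt_mem τ hτ _ _ bw by_)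
  have hJ : ∀ τ ∈ Icc (0 : ℝ) 1, ∀ j, ∀ u v : ι → H, (∀ j, P 1 (bar (u j)) ≤ A) →
      (∀ j, P 1 (bar (v j)) ≤ A) → base u ∈ U → base v ∈ U → (∀ j, P 1 (u j - v j) ≤ κ) →
      P r ((bar (u j) - bar (v j)) * jet k (pd j g) (base v + τ • (base u - base v))
        ((fun j => bar (v j)) + τ • fun j => bar (u j) - bar (v j)))
        ≤ Γ * (1 + Γ ^ 2) * (Γ * M * (e * (Γ * A)) ^ k) * (κ * r ^ (k + 1)) := by
    intro τ hτ j u v hu hv bu bv huv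
    rw [← pt_base, ← pt_bar, ← bar_sub]
    have B1 := hP.bar_le hr hrΛ (hP.bar_le_self (huv j))
    have B2 := jet_le (hP.mul_le r) (hP.one r) k ((hpd j).of_le (by exact_mod_cast Nat.le_succ k))
      (hpdM j k (Nat.le_succ k) _ (pt_mem τ hτ u v bu bv))
      (fun i => hP.bar_le hr hrΛ (pt_bar_le τ hτ u v hu hv i))
    refine (seminorm_mul_le (hP.mul_le r) B1 B2).trans_eq ?_
    have : (Fintype.card ι : ℝ) * (Γ * r * A) = e * (Γ * A) * r := by rw [he]; ring
    rw [this, mul_pow]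
    ring
  have vec : ∀ u v : ι → H, ∀ j,
      (base u - base v) j • (1 : H) + (bar (u j) - bar (v j)) = u j - v j := by
    intro u v j
    rw [bar_eq, bar_eq]
    simp only [Pi.sub_apply, base, sub_smul]
    abel
  have key := lift_defect_sub_le (p := P r) (p₁ := P 1) (η := Γ * r ^ (k + 1))
    (X := K₁ * (A + 1) * r ^ (k + 1)) (Y := Γ * K₂) (W := D * (κ * r ^ (k + 1)))
    (κ₀ := Γ * κ) (κ₁ := κ * r ^ (k + 1)) (κ₂ := κ) (α := α) (hP.mul_le r) hα.map_mul
    (by positivity) k (hg.of_le (by norm_cast; omega)) (x := base y) (a := base w - base y)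
    (x' := base y') (a' := base w' - base y') (b := fun j => bar (y j))
    (c := fun j => bar (w j) - bar (y j)) (b' := fun j => bar (y' j))
    (c' := fun j => bar (w' j) - bar (y' j)) ?_ ?_ ?_ ?_ ?_ ?_ ?_ ?_
  · have e2 : ∀ u v : ι → H, ((fun j => bar (v j)) + fun j => bar (u j) - bar (v j))
        = fun j => bar (u j) := fun u v => by ext j; simp
    rw [add_sub_cancel, add_sub_cancel, e2, e2] at key
    refine key.trans_eq ?_
    rw [← he]
    ring
  · intro τ hτ j
    rw [lift_eq, lift_eq]
    exact hX τ hτ j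
  · intro τ hτ j
    rw [lift_eq]
    exact (hα.bound _).trans (mul_le_mul_of_nonneg_left (hY r hr hrΛ τ hτ j) hΓ)
  · intro τ hτ j
    rw [lift_eq]
    exact (hY 1 one_pos hP.one_le_range τ hτ j).trans (le_mul_of_one_le_left hK₂ hΓ1)
  · intro τ hτ j
    refine (hJ τ hτ j w' y' hw' hy' bw' by' h2).trans ?_
    refine mul_le_mul_of_nonneg_right ?_ (by positivity)
    rw [hD]
    exact le_mul_of_one_le_left (by positivity) hΓ1
  · intro τ hτ j
    refine (hα.bound _).trans ((mul_le_mul_of_nonneg_left (hJ τ hτ j w y hw hy bw by_ h1)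
      hΓ).trans_eq ?_)
    rw [hD]; ring
  · intro j
    rw [vec]
    exact (hP.le r hr hrΛ _).trans (mul_le_mul_of_nonneg_left (h2 j) hΓ)
  · intro j
    rw [vec, vec]
    have e1 : w' j - y' j - α (w j - y j) = (w' j - α (w j)) - (y' j - α (y j)) := by
      rw [map_sub]; abel
    rw [e1]
    exact h3 j
  · intro j
    rw [vec]
    exact h1 j

end ScaleDifference

/-! ### Gradings and dilations -/

/-- Two linear maps on `H ⊗ H` which agree on the tensors of the bidegrees `(p, q)` satisfying `S`
agree on the sum of these bidegrees. -/
theorem eq_of_mem_iSup_bidegree {H : Type*} [CommRing H] [Algebra ℝ H]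
    (𝒜 : ℕ → Submodule ℝ H) {V : Type*} [AddCommGroup V] [Module ℝ V]
    {S : ℕ → ℕ → Prop} (f g : H ⊗[ℝ] H →ₗ[ℝ] V)
    (h : ∀ p q, S p q → ∀ u ∈ 𝒜 p, ∀ v ∈ 𝒜 q, f (u ⊗ₜ v) = g (u ⊗ₜ v)) {w : H ⊗[ℝ] H}
    (hw : w ∈ ⨆ (p : ℕ) (q : ℕ) (_ : S p q), bidegree 𝒜 p q) : f w = g w := by
  have hle : (⨆ (p : ℕ) (q : ℕ) (_ : S p q), bidegree 𝒜 p q) ≤ LinearMap.eqLocus f g := by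
    refine iSup_le fun p => iSup_le fun q => iSup_le fun hpq => ?_
    rintro _ ⟨t, rfl⟩
    rw [LinearMap.mem_eqLocus]
    induction t using TensorProduct.induction_on with
    | zero => simp
    | tmul a b => exact h p q hpq _ a.2 _ b.2
    | add a b ha hb => rw [map_add, map_add, map_add, ha, hb]
  exact hle hw

section Grading

variable {H : Type*} [CommRing H] [Algebra ℝ H] {𝒜 : ℕ → Submodule ℝ H} [GradedAlgebra 𝒜]

variable (𝒜) in
/-- The projection onto the component of degree `j`. -/
noncomputable abbrev gproj (j : ℕ) : H →ₗ[ℝ] H := GradedAlgebra.proj 𝒜 j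

theorem gproj_mem (j : ℕ) (h : H) : gproj 𝒜 j h ∈ 𝒜 j := by
  rw [GradedAlgebra.proj_apply]; exact SetLike.coe_mem _

theorem gproj_same {j : ℕ} {h : H} (hh : h ∈ 𝒜 j) : gproj 𝒜 j h = h := by
  rw [GradedAlgebra.proj_apply, DirectSum.decompose_of_mem_same _ hh]

theorem gproj_ne {j n : ℕ} (hne : n ≠ j) {h : H} (hh : h ∈ 𝒜 n) : gproj 𝒜 j h = 0 := by
  rw [GradedAlgebra.proj_apply, DirectSum.decompose_of_mem_ne _ hh hne]

theorem linearMap_ext_grading {V : Type*} [AddCommGroup V] [Module ℝ V] {f g : H →ₗ[ℝ] V}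
    (h : ∀ n, ∀ x ∈ 𝒜 n, f x = g x) : f = g := by
  ext x
  induction x using DirectSum.Decomposition.inductionOn 𝒜 with
  | zero => simp
  | homogeneous m => exact h _ _ m.2
  | add a b ha hb => rw [map_add, map_add, ha, hb]

theorem sum_gproj {N : ℕ} (htr : ∀ n, N < n → 𝒜 n = ⊥) (h : H) :
    ∑ j ∈ Finset.range (N + 1), gproj 𝒜 j h = h := by
  have : ∑ j ∈ Finset.range (N + 1), gproj 𝒜 j = LinearMap.id := by
    refine linearMap_ext_grading (𝒜 := 𝒜) fun n x hx => ?_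
    rw [LinearMap.sum_apply, LinearMap.id_apply]
    by_cases hn : n ≤ N
    · rw [Finset.sum_eq_single n (fun j _ hj => gproj_ne hj.symm hx)
        (fun hn' => absurd (Finset.mem_range.2 (Nat.lt_succ_of_le hn)) hn'), gproj_same hx]
    · have h0 : x = 0 := by
        rw [htr n (not_le.1 hn), Submodule.mem_bot] at hx
        exact hx
      simp [h0]
  simpa using congrArg (fun f => f h) this

theorem finite_of_grading {N : ℕ} (htr : ∀ n, N < n → 𝒜 n = ⊥)
    (hfin : ∀ n, Module.Finite ℝ (𝒜 n)) : Module.Finite ℝ H := by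
  let f : ((j : Fin (N + 1)) → 𝒜 j) →ₗ[ℝ] H :=
    ∑ j : Fin (N + 1), (𝒜 j).subtype ∘ₗ LinearMap.proj j
  refine Module.Finite.of_surjective f fun h => ⟨fun j => ⟨gproj 𝒜 j h, gproj_mem _ _⟩, ?_⟩
  simp only [f, LinearMap.sum_apply, LinearMap.comp_apply, LinearMap.proj_apply,
    Submodule.subtype_apply]
  rw [← Finset.sum_range (fun j => gproj 𝒜 j h), sum_gproj htr]

variable (𝒜) in
/-- The dilation acting by `r^j` on the component of degree `j`. -/
noncomputable def dil (N : ℕ) (r : ℝ) : H →ₗ[ℝ] H :=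
  ∑ j ∈ Finset.range (N + 1), r ^ j • gproj 𝒜 j

theorem dil_of_mem {N : ℕ} (htr : ∀ n, N < n → 𝒜 n = ⊥) (r : ℝ) {n : ℕ} {x : H} (hx : x ∈ 𝒜 n) :
    dil 𝒜 N r x = r ^ n • x := by
  rw [dil, LinearMap.sum_apply]
  by_cases hn : n ≤ N
  · rw [Finset.sum_eq_single n, LinearMap.smul_apply, gproj_same hx]
    · intro j _ hj
      rw [LinearMap.smul_apply, gproj_ne hj.symm hx, smul_zero]
    · exact fun hn' => absurd (Finset.mem_range.2 (Nat.lt_succ_of_le hn)) hn'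
  · have h0 : x = 0 := by
      rw [htr n (not_le.1 hn), Submodule.mem_bot] at hx
      exact hx
    simp [h0]

theorem gproj_dil {N : ℕ} (htr : ∀ n, N < n → 𝒜 n = ⊥) (r : ℝ) (j : ℕ) (x : H) :
    gproj 𝒜 j (dil 𝒜 N r x) = r ^ j • gproj 𝒜 j x := by
  have : gproj 𝒜 j ∘ₗ dil 𝒜 N r = r ^ j • gproj 𝒜 j := by
    refine linearMap_ext_grading (𝒜 := 𝒜) fun n x hx => ?_
    rw [LinearMap.comp_apply, dil_of_mem htr r hx, map_smul, LinearMap.smul_apply]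
    rcases eq_or_ne n j with rfl | hne
    · rfl
    · rw [gproj_ne hne hx, smul_zero, smul_zero]
  exact congrArg (fun f => f x) this

theorem dil_one_apply {N : ℕ} (htr : ∀ n, N < n → 𝒜 n = ⊥) (r : ℝ) : dil 𝒜 N r 1 = 1 := by
  rw [dil_of_mem htr r (SetLike.GradedOne.one_mem : (1 : H) ∈ 𝒜 0), pow_zero, one_smul]

theorem dil_mul {N : ℕ} (htr : ∀ n, N < n → 𝒜 n = ⊥) (r : ℝ) (x y : H) :
    dil 𝒜 N r (x * y) = dil 𝒜 N r x * dil 𝒜 N r y := by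
  have h1 : ∀ n, ∀ x ∈ 𝒜 n, ∀ y, dil 𝒜 N r (x * y) = dil 𝒜 N r x * dil 𝒜 N r y := by
    intro n x hx y
    have : dil 𝒜 N r ∘ₗ LinearMap.mulLeft ℝ x = LinearMap.mulLeft ℝ (dil 𝒜 N r x) ∘ₗ dil 𝒜 N r := by
      refine linearMap_ext_grading (𝒜 := 𝒜) fun m y hy => ?_
      simp only [LinearMap.comp_apply, LinearMap.mulLeft_apply]
      rw [dil_of_mem htr r hx, dil_of_mem htr r hy, dil_of_mem htr r (SetLike.mul_mem_graded hx hy),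
        pow_add, smul_mul_smul_comm]
    exact congrArg (fun f => f y) this
  have : dil 𝒜 N r ∘ₗ LinearMap.mulRight ℝ y
      = LinearMap.mulRight ℝ (dil 𝒜 N r y) ∘ₗ dil 𝒜 N r := by
    refine linearMap_ext_grading (𝒜 := 𝒜) fun n x hx => ?_
    simpa using h1 n x hx y
  exact congrArg (fun f => f x) this

theorem dil_dil {N : ℕ} (htr : ∀ n, N < n → 𝒜 n = ⊥) (r s : ℝ) (x : H) :
    dil 𝒜 N r (dil 𝒜 N s x) = dil 𝒜 N (r * s) x := by
  have : dil 𝒜 N r ∘ₗ dil 𝒜 N s = dil 𝒜 N (r * s) := by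
    refine linearMap_ext_grading (𝒜 := 𝒜) fun n x hx => ?_
    rw [LinearMap.comp_apply, dil_of_mem htr s hx, map_smul, dil_of_mem htr r hx,
      dil_of_mem htr _ hx, smul_smul, mul_pow, mul_comm]
  exact congrArg (fun f => f x) this

theorem dil_one {N : ℕ} (htr : ∀ n, N < n → 𝒜 n = ⊥) (x : H) : dil 𝒜 N 1 x = x := by
  simp only [dil, one_pow, one_smul, LinearMap.sum_apply]
  exact sum_gproj htr x

end Grading

/-! ### The coproduct of a truncated Hopf algebra -/

section Hopf

variable {H : Type*} [CommRing H] [Algebra ℝ H] [Coalgebra ℝ H] {𝒜 : ℕ → Submodule ℝ H}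
  [GradedAlgebra 𝒜] {N : ℕ}

local notation "Δ" => Coalgebra.comul (R := ℝ) (A := H)
local notation "ε" => Coalgebra.counit (R := ℝ) (A := H)

theorem IsTruncatedHopf.one_ne_zero (hH : IsTruncatedHopf 𝒜 N) : (1 : H) ≠ 0 := by
  intro h
  have hs : Subsingleton H := ⟨fun a b => by rw [← mul_one a, ← mul_one b, h, mul_zero, mul_zero]⟩
  have : Subsingleton (𝒜 0) := inferInstance
  have h1 := hH.connected
  rw [Module.finrank_zero_of_subsingleton] at h1
  exact zero_ne_one h1

theorem IsTruncatedHopf.exists_smul_one (hH : IsTruncatedHopf 𝒜 N) {x : H} (hx : x ∈ 𝒜 0) :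
    ∃ c : ℝ, x = c • 1 := by
  have hone : (1 : H) ∈ 𝒜 0 := SetLike.GradedOne.one_mem
  have h1 : (⟨1, hone⟩ : 𝒜 0) ≠ 0 := fun h => hH.one_ne_zero (congrArg Subtype.val h)
  obtain ⟨c, hc⟩ := (finrank_eq_one_iff_of_nonzero' _ h1).1 hH.connected ⟨x, hx⟩
  exact ⟨c, (congrArg Subtype.val hc).symm⟩

theorem IsTruncatedHopf.comul_one_and_counit_one (hH : IsTruncatedHopf 𝒜 N) :
    Δ 1 = 1 ⊗ₜ 1 ∧ ε 1 = 1 := by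
  have hone : (1 : H) ∈ 𝒜 0 := SetLike.GradedOne.one_mem
  obtain ⟨c, hc⟩ : ∃ c : ℝ, c • ((1 : H) ⊗ₜ[ℝ] (1 : H)) = Δ 1 := by
    rw [← Submodule.mem_span_singleton]
    have hle : (⨆ (p : ℕ) (q : ℕ) (_ : p + q = 0), bidegree 𝒜 p q)
        ≤ Submodule.span ℝ {(1 : H) ⊗ₜ[ℝ] (1 : H)} := by
      refine iSup_le fun p => iSup_le fun q => iSup_le fun hpq => ?_
      obtain ⟨rfl, rfl⟩ : p = 0 ∧ q = 0 := by omega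
      rintro _ ⟨t, rfl⟩
      induction t using TensorProduct.induction_on with
      | zero => simp
      | tmul a b =>
        obtain ⟨s, hs⟩ := hH.exists_smul_one a.2
        obtain ⟨t, ht⟩ := hH.exists_smul_one b.2
        rw [TensorProduct.mapIncl, TensorProduct.map_tmul, Submodule.subtype_apply,
          Submodule.subtype_apply, hs, ht, TensorProduct.smul_tmul_smul]
        exact Submodule.smul_mem _ _ (Submodule.mem_span_singleton_self _)
      | add a b ha hb => rw [map_add]; exact Submodule.add_mem _ ha hb
    exact hle (hH.comul_graded 0 1 hone)
  have hlid : ∀ w : H ⊗[ℝ] H, w = c • ((1 : H) ⊗ₜ[ℝ] (1 : H)) →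
      TensorProduct.lid ℝ H ((ε).rTensor H w) = (c * ε 1) • (1 : H) := by
    rintro _ rfl
    simp [smul_smul]
  have h1 : c * ε 1 = 1 := by
    have h := hlid _ hc.symm
    rw [Coalgebra.rTensor_counit_comul, TensorProduct.lid_tmul, one_smul] at h
    have : (1 - c * ε 1) • (1 : H) = 0 := by rw [sub_smul, one_smul, ← h, sub_self]
    rcases smul_eq_zero.1 this with h' | h'
    · linarith
    · exact absurd h' hH.one_ne_zero
  have hcc : c = c * c := by
    have hm := hH.comul_mul 1 1
    rw [mul_one] at hm
    have h := eq_of_mem_iSup_bidegree 𝒜 (TensorProduct.map (gproj 𝒜 0) (gproj 𝒜 0)) 0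
      (fun p q hpq u hu v hv => ?_) hm
    · rw [← hc, smul_mul_smul_comm, Algebra.TensorProduct.tmul_mul_tmul, one_mul, ← sub_smul,
        map_smul, TensorProduct.map_tmul, gproj_same hone, LinearMap.zero_apply] at h
      have h2 : (c - c * c) • (1 : H) = 0 := by
        have := congrArg (fun w => TensorProduct.lid ℝ H ((ε).rTensor H w)) h
        simp only [map_smul, LinearMap.rTensor_tmul, TensorProduct.lid_tmul, map_zero,
          smul_smul] at this
        rcases smul_eq_zero.1 this with h' | h'
        · rcases mul_eq_zero.1 h' with h'' | h''
          · rw [h'', zero_smul]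
          · rw [h'', mul_zero] at h1; exact absurd h1 zero_ne_one
        · exact absurd h' hH.one_ne_zero
      rcases smul_eq_zero.1 h2 with h' | h'
      · linarith
      · exact absurd h' hH.one_ne_zero
    · rw [TensorProduct.map_tmul, LinearMap.zero_apply]
      by_cases hp : p = 0
      · rw [gproj_ne (by omega) hv, TensorProduct.tmul_zero]
      · rw [gproj_ne hp hu, TensorProduct.zero_tmul]
  have hc0 : c ≠ 0 := by rintro rfl; simp at h1
  have hc1 : c = 1 := by
    have : c * (c - 1) = 0 := by linarith
    rcases mul_eq_zero.1 this with h | h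
    · exact absurd h hc0
    · linarith
  subst hc1
  exact ⟨by rw [← hc, one_smul], by linarith⟩

theorem IsTruncatedHopf.counit_of_mem (hH : IsTruncatedHopf 𝒜 N) {n : ℕ} (hn : n ≠ 0) {x : H}
    (hx : x ∈ 𝒜 n) : ε x = 0 := by
  let F₁ : H ⊗[ℝ] H →ₗ[ℝ] ℝ :=
    ε ∘ₗ gproj 𝒜 n ∘ₗ (TensorProduct.rid ℝ H).toLinearMap ∘ₗ (ε).lTensor H
  let F₂ : H ⊗[ℝ] H →ₗ[ℝ] ℝ :=
    ε ∘ₗ gproj 𝒜 0 ∘ₗ (TensorProduct.lid ℝ H).toLinearMap ∘ₗ (ε).rTensor H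
  have h := eq_of_mem_iSup_bidegree 𝒜 F₁ F₂ (fun p q hpq u hu v hv => ?_) (hH.comul_graded n x hx)
  · simp only [F₁, F₂, LinearMap.comp_apply, LinearEquiv.coe_coe,
      Coalgebra.rTensor_counit_comul, Coalgebra.lTensor_counit_comul, TensorProduct.lid_tmul,
      TensorProduct.rid_tmul, one_smul] at h
    rwa [gproj_same hx, gproj_ne hn hx, map_zero] at h
  · simp only [F₁, F₂, LinearMap.comp_apply, LinearEquiv.coe_coe, LinearMap.lTensor_tmul,
      LinearMap.rTensor_tmul, TensorProduct.lid_tmul, TensorProduct.rid_tmul, map_smul]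
    by_cases hq : q = 0
    · subst hq
      obtain rfl : p = n := by omega
      rw [gproj_same hu, gproj_same hv, smul_eq_mul, smul_eq_mul, mul_comm]
    · rw [gproj_ne hq hv, gproj_ne (by omega) hu]
      simp

theorem IsTruncatedHopf.gproj_zero_eq (hH : IsTruncatedHopf 𝒜 N) (x : H) :
    gproj 𝒜 0 x = ε x • (1 : H) := by
  have h1 := hH.comul_one_and_counit_one.2
  have : gproj 𝒜 0 = (ε).smulRight (1 : H) := by
    refine linearMap_ext_grading (𝒜 := 𝒜) fun n x hx => ?_
    rw [LinearMap.smulRight_apply]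
    rcases eq_or_ne n 0 with rfl | hn
    · obtain ⟨c, rfl⟩ := hH.exists_smul_one hx
      rw [gproj_same hx, map_smul, h1, smul_eq_mul, mul_one]
    · rw [gproj_ne hn hx, hH.counit_of_mem hn hx, zero_smul]
  exact congrArg (fun f => f x) this

theorem act_eq (ξ : Module.Dual ℝ H) (x : H) :
    act ξ x = TensorProduct.lid ℝ H (ξ.rTensor H (Δ x)) := rfl

theorem IsTruncatedHopf.act_one (hH : IsTruncatedHopf 𝒜 N) (ξ : Module.Dual ℝ H) :
    act ξ 1 = ξ 1 • (1 : H) := by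
  rw [act_eq, hH.comul_one_and_counit_one.1, LinearMap.rTensor_tmul, TensorProduct.lid_tmul]

theorem IsTruncatedHopf.dil_act (hH : IsTruncatedHopf 𝒜 N) (ξ : Module.Dual ℝ H) {r : ℝ}
    (hr : r ≠ 0) (x : H) :
    dil 𝒜 N r (act ξ x) = act (ξ ∘ₗ dil 𝒜 N r⁻¹) (dil 𝒜 N r x) := by
  have : dil 𝒜 N r ∘ₗ act ξ = act (ξ ∘ₗ dil 𝒜 N r⁻¹) ∘ₗ dil 𝒜 N r := by
    refine linearMap_ext_grading (𝒜 := 𝒜) fun n x hx => ?_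
    rw [LinearMap.comp_apply, LinearMap.comp_apply, dil_of_mem hH.truncated r hx, map_smul,
      act_eq, act_eq]
    refine eq_of_mem_iSup_bidegree 𝒜
      (dil 𝒜 N r ∘ₗ (TensorProduct.lid ℝ H).toLinearMap ∘ₗ ξ.rTensor H)
      (r ^ n • ((TensorProduct.lid ℝ H).toLinearMap ∘ₗ (ξ ∘ₗ dil 𝒜 N r⁻¹).rTensor H))
      (fun p q hpq u hu v hv => ?_) (hH.comul_graded n x hx)
    simp only [LinearMap.smul_apply, LinearMap.comp_apply, LinearEquiv.coe_coe,
      LinearMap.rTensor_tmul, TensorProduct.lid_tmul, map_smul, dil_of_mem hH.truncated _ hu,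
      dil_of_mem hH.truncated _ hv, smul_smul, smul_eq_mul, inv_pow, ← hpq]
    congr 1
    field_simp
    ring
  exact congrArg (fun f => f x) this

/-- In total degree at most `N` the coproduct is multiplicative, and so is `act ξ` for a
truncated character `ξ`. -/
theorem IsTruncatedHopf.act_mul (hH : IsTruncatedHopf 𝒜 N) {ξ : Module.Dual ℝ H}
    (hξ : IsTruncatedCharacter 𝒜 N ξ) {a b : ℕ} (hab : a + b ≤ N) {x y : H} (hx : x ∈ 𝒜 a)
    (hy : y ∈ 𝒜 b) : act ξ (x * y) = act ξ x * act ξ y := by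
  -- the projection of `H ⊗ H` onto total degree `a + b`
  let T : H ⊗[ℝ] H →ₗ[ℝ] H ⊗[ℝ] H := ∑ k ∈ Finset.range (a + b + 1),
    TensorProduct.map (gproj 𝒜 k) (gproj 𝒜 (a + b - k))
  have T_same : ∀ p q, p + q = a + b → ∀ u ∈ 𝒜 p, ∀ v ∈ 𝒜 q, T (u ⊗ₜ v) = u ⊗ₜ v := by
    intro p q hpq u hu v hv
    simp only [T, LinearMap.sum_apply, TensorProduct.map_tmul]
    rw [Finset.sum_eq_single p]
    · rw [gproj_same hu, show a + b - p = q by omega, gproj_same hv]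
    · intro k _ hk
      rw [gproj_ne hk.symm hu, TensorProduct.zero_tmul]
    · intro hp
      exact absurd (Finset.mem_range.2 (by omega)) hp
  have T_ne : ∀ p q, p + q ≠ a + b → ∀ u ∈ 𝒜 p, ∀ v ∈ 𝒜 q, T (u ⊗ₜ v) = 0 := by
    intro p q hpq u hu v hv
    simp only [T, LinearMap.sum_apply, TensorProduct.map_tmul]
    refine Finset.sum_eq_zero fun k hk => ?_
    have hk' := Finset.mem_range.1 hk
    by_cases hkp : p = k
    · rw [gproj_ne (j := a + b - k) (n := q) (by omega) hv, TensorProduct.tmul_zero]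
    · rw [gproj_ne hkp hu, TensorProduct.zero_tmul]
  have e1 : T (Δ (x * y)) = Δ (x * y) :=
    eq_of_mem_iSup_bidegree 𝒜 T LinearMap.id (fun p q hpq u hu v hv => T_same p q hpq u hu v hv)
      (hH.comul_graded (a + b) _ (SetLike.mul_mem_graded hx hy))
  have e2 : T (Δ x * Δ y) = Δ x * Δ y := by
    refine eq_of_mem_iSup_bidegree 𝒜 (T ∘ₗ LinearMap.mulRight ℝ (Δ y))
      (LinearMap.mulRight ℝ (Δ y)) (fun p q hpq u hu v hv => ?_) (hH.comul_graded a x hx)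
    refine eq_of_mem_iSup_bidegree 𝒜 (T ∘ₗ LinearMap.mulLeft ℝ (u ⊗ₜ v))
      (LinearMap.mulLeft ℝ (u ⊗ₜ v)) (fun p' q' hpq' u' hu' v' hv' => ?_) (hH.comul_graded b y hy)
    simp only [LinearMap.comp_apply, LinearMap.mulLeft_apply, Algebra.TensorProduct.tmul_mul_tmul]
    exact T_same (p + p') (q + q') (by omega) _ (SetLike.mul_mem_graded hu hu') _
      (SetLike.mul_mem_graded hv hv')
  have e3 : T (Δ (x * y) - Δ x * Δ y) = 0 :=
    eq_of_mem_iSup_bidegree 𝒜 T 0 (fun p q hpq u hu v hv => T_ne p q (by omega) u hu v hv)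
      (hH.comul_mul x y)
  have hΔ : Δ (x * y) = Δ x * Δ y := by
    rw [map_sub, e1, e2, sub_eq_zero] at e3
    exact e3
  let F : H ⊗[ℝ] H →ₗ[ℝ] H := (TensorProduct.lid ℝ H).toLinearMap ∘ₗ ξ.rTensor H
  have hF : ∀ w, TensorProduct.lid ℝ H (ξ.rTensor H w) = F w := fun _ => rfl
  rw [act_eq, act_eq, act_eq, hΔ, hF, hF, hF]
  refine eq_of_mem_iSup_bidegree 𝒜 (F ∘ₗ LinearMap.mulRight ℝ (Δ y))
    (LinearMap.mulRight ℝ (F (Δ y)) ∘ₗ F) (fun p q hpq u hu v hv => ?_) (hH.comul_graded a x hx)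
  refine eq_of_mem_iSup_bidegree 𝒜 (F ∘ₗ LinearMap.mulLeft ℝ (u ⊗ₜ v))
    (LinearMap.mulLeft ℝ (F (u ⊗ₜ v)) ∘ₗ F) (fun p' q' hpq' u' hu' v' hv' => ?_)
    (hH.comul_graded b y hy)
  simp only [F, LinearMap.comp_apply, LinearMap.mulLeft_apply, LinearEquiv.coe_coe,
    Algebra.TensorProduct.tmul_mul_tmul, LinearMap.rTensor_tmul, TensorProduct.lid_tmul]
  rw [hξ.map_mul p p' (by omega) u hu u' hu', smul_mul_smul_comm]

/-- The cocycle identity, transposed. -/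
theorem act_cocycle {L : H →ₗ[ℝ] H} {x : H}
    (h : Δ (L x) = L.lTensor H (Δ x) + L x ⊗ₜ[ℝ] (1 : H)) (ξ : Module.Dual ℝ H) :
    act ξ (L x) = L (act ξ x) + ξ (L x) • (1 : H) := by
  have key : ∀ w : H ⊗[ℝ] H, TensorProduct.lid ℝ H (ξ.rTensor H (L.lTensor H w))
      = L (TensorProduct.lid ℝ H (ξ.rTensor H w)) := by
    intro w
    induction w using TensorProduct.induction_on with
    | zero => simp
    | tmul a b => simp
    | add a b ha hb => simp only [map_add, ha, hb]
  rw [act_eq, h, map_add, map_add, key, LinearMap.rTensor_tmul, TensorProduct.lid_tmul, act_eq]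

end Hopf

/-! ### Norms on finite-dimensional spaces -/

section FiniteDim

theorem exists_dual_bound {V : Type*} [AddCommGroup V] [Module ℝ V] [Module.Finite ℝ V]
    (p : Seminorm ℝ V) (hp : ∀ v, p v = 0 → v = 0) (ℓ : V →ₗ[ℝ] ℝ) :
    ∃ K : ℝ, 0 ≤ K ∧ ∀ v, |ℓ v| ≤ K * p v := by
  let : Norm V := ⟨p⟩
  have core : NormedSpace.Core ℝ V :=
    { norm_nonneg := fun x => apply_nonneg p x
      norm_smul := fun c x => map_smul_eq_mul p c x
      norm_triangle := fun x y => map_add_le_add p x y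
      norm_eq_zero_iff := fun x => ⟨hp x, fun h => by rw [h]; exact map_zero p⟩ }
  let : NormedAddCommGroup V := NormedAddCommGroup.ofCore core
  let : NormedSpace ℝ V := NormedSpace.ofCore core
  exact ⟨‖LinearMap.toContinuousLinearMap ℓ‖, norm_nonneg _,
    fun v => (LinearMap.toContinuousLinearMap ℓ).le_opNorm v⟩

theorem exists_map_bound {V : Type*} [AddCommGroup V] [Module ℝ V] [Module.Finite ℝ V]
    (p : Seminorm ℝ V) (hp : ∀ v, p v = 0 → v = 0) (T : V →ₗ[ℝ] V) :
    ∃ K : ℝ, 0 ≤ K ∧ ∀ v, p (T v) ≤ K * p v := by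
  let B := Module.finBasis ℝ V
  choose K hK0 hK using fun i => exists_dual_bound p hp (B.coord i)
  refine ⟨∑ i, K i * p (T (B i)), Finset.sum_nonneg fun i _ =>
    mul_nonneg (hK0 i) (apply_nonneg _ _), fun v => ?_⟩
  conv_lhs => rw [← B.sum_repr v, map_sum]
  refine (seminorm_sum_le p _ _).trans ?_
  rw [Finset.sum_mul]
  refine Finset.sum_le_sum fun i _ => ?_
  rw [map_smul, map_smul_eq_mul]
  have := mul_le_mul_of_nonneg_right (hK i v) (apply_nonneg p (T (B i)))
  rw [Module.Basis.coord_apply, ← Real.norm_eq_abs] at this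
  linarith

theorem exists_mul_bound {A : Type*} [CommRing A] [Algebra ℝ A] [Module.Finite ℝ A]
    (p : Seminorm ℝ A) (hp : ∀ v, p v = 0 → v = 0) :
    ∃ K : ℝ, 1 ≤ K ∧ ∀ x y, p (x * y) ≤ K * (p x * p y) := by
  let B := Module.finBasis ℝ A
  choose K hK0 hK using fun i => exists_dual_bound p hp (B.coord i)
  choose K' hK0' hK' using fun i => exists_map_bound p hp (LinearMap.mulLeft ℝ (B i))
  refine ⟨1 + ∑ i, K i * K' i, le_add_of_nonneg_right (Finset.sum_nonneg fun i _ =>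
    mul_nonneg (hK0 i) (hK0' i)), fun x y => ?_⟩
  have e : p (x * y) ≤ ∑ i, K i * K' i * (p x * p y) := by
    conv_lhs => rw [← B.sum_repr x, Finset.sum_mul]
    refine (seminorm_sum_le p _ _).trans (Finset.sum_le_sum fun i _ => ?_)
    rw [smul_mul_assoc, map_smul_eq_mul]
    have h1 := hK i x
    rw [Module.Basis.coord_apply, ← Real.norm_eq_abs] at h1
    have := mul_le_mul h1 (hK' i y) (apply_nonneg _ _) (mul_nonneg (hK0 i) (apply_nonneg _ _))
    rw [LinearMap.mulLeft_apply] at this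
    linarith
  rw [← Finset.sum_mul] at e
  have : 0 ≤ p x * p y := mul_nonneg (apply_nonneg _ _) (apply_nonneg _ _)
  linarith

variable {H : Type*} [CommRing H] [Algebra ℝ H] [Coalgebra ℝ H]

/-- The action of `H^*` on `H` is bounded, uniformly in the functional. -/
theorem exists_act_bound [Module.Finite ℝ H] (p : Seminorm ℝ H) (hp : ∀ v, p v = 0 → v = 0) :
    ∃ K : ℝ, 0 ≤ K ∧ ∀ (ξ : Module.Dual ℝ H) (C : ℝ), (∀ h, |ξ h| ≤ C * p h) →
      ∀ x, p (act ξ x) ≤ K * C * p x := by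
  let B := Module.finBasis ℝ H
  choose K hK0 hK using fun i => exists_map_bound p hp (act (B.coord i))
  refine ⟨∑ i, p (B i) * K i, Finset.sum_nonneg fun i _ =>
    mul_nonneg (apply_nonneg _ _) (hK0 i), fun ξ C hξ x => ?_⟩
  have e : act ξ x = ∑ i, ξ (B i) • act (B.coord i) x := by
    simp only [act_eq]
    generalize Coalgebra.comul (R := ℝ) x = w
    induction w using TensorProduct.induction_on with
    | zero => simp
    | tmul a b =>
      simp only [LinearMap.rTensor_tmul, TensorProduct.lid_tmul, smul_smul, ← Finset.sum_smul]
      congr 1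
      conv_lhs => rw [← B.sum_repr a, map_sum]
      refine Finset.sum_congr rfl fun i _ => ?_
      rw [map_smul, smul_eq_mul, mul_comm, Module.Basis.coord_apply]
    | add a b ha hb => simp only [map_add, ha, hb, smul_add, Finset.sum_add_distrib]
  rw [e]
  refine (seminorm_sum_le p _ _).trans ?_
  rw [Finset.sum_mul, Finset.sum_mul]
  refine Finset.sum_le_sum fun i _ => ?_
  rw [map_smul_eq_mul, Real.norm_eq_abs]
  have := mul_le_mul (hξ (B i)) (hK i x) (apply_nonneg _ _) ((abs_nonneg _).trans (hξ (B i)))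
  linarith

end FiniteDim

/-! ### The weighted norms -/

section Weighted

variable {H : Type*} [CommRing H] [Algebra ℝ H] {𝒜 : ℕ → Submodule ℝ H} [GradedAlgebra 𝒜]

variable (𝒜) in
/-- The norm `h ↦ C ∑_j |r|^j ‖π_j h‖`. -/
noncomputable def wnorm (nrm : Seminorm ℝ H) (N : ℕ) (C r : ℝ) : Seminorm ℝ H :=
  Seminorm.of (fun h => |C| * ∑ j ∈ Finset.range (N + 1), |r| ^ j * nrm (gproj 𝒜 j h))
    (fun x y => by
      rw [← mul_add, ← Finset.sum_add_distrib]
      refine mul_le_mul_of_nonneg_left (Finset.sum_le_sum fun j _ => ?_) (abs_nonneg _)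
      rw [map_add, ← mul_add]
      exact mul_le_mul_of_nonneg_left (map_add_le_add _ _ _) (by positivity))
    (fun a x => by
      simp only [map_smul, map_smul_eq_mul]
      rw [mul_left_comm ‖a‖]
      congr 1
      rw [Finset.mul_sum]
      exact Finset.sum_congr rfl fun j _ => by ring)

variable {nrm : Seminorm ℝ H} {N : ℕ} {C : ℝ}

theorem wnorm_apply (hC : 0 ≤ C) {r : ℝ} (hr : 0 ≤ r) (h : H) : wnorm 𝒜 nrm N C r h
    = C * ∑ j ∈ Finset.range (N + 1), r ^ j * nrm (gproj 𝒜 j h) := by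
  change |C| * ∑ j ∈ Finset.range (N + 1), |r| ^ j * nrm (gproj 𝒜 j h) = _
  rw [abs_of_nonneg hC, abs_of_nonneg hr]

theorem wnorm_abs (r : ℝ) : wnorm 𝒜 nrm N C |r| = wnorm 𝒜 nrm N C r := by
  ext h
  change |C| * ∑ j ∈ Finset.range (N + 1), |(|r|)| ^ j * nrm (gproj 𝒜 j h)
    = |C| * ∑ j ∈ Finset.range (N + 1), |r| ^ j * nrm (gproj 𝒜 j h)
  rw [abs_abs]

theorem wnorm_eq_dil (htr : ∀ n, N < n → 𝒜 n = ⊥) (hC : 0 ≤ C) {r : ℝ} (hr : 0 ≤ r) (h : H) :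
    wnorm 𝒜 nrm N C r h = C * wnorm 𝒜 nrm N 1 1 (dil 𝒜 N r h) := by
  rw [wnorm_apply hC hr, wnorm_apply zero_le_one zero_le_one, one_mul]
  congr 1
  refine Finset.sum_congr rfl fun j _ => ?_
  rw [gproj_dil htr, map_smul_eq_mul, one_pow, one_mul, Real.norm_of_nonneg (pow_nonneg hr j)]

theorem comp_le_wnorm (hC : 1 ≤ C) {r : ℝ} (hr : 0 ≤ r) {j : ℕ} (hj : j ≤ N) (h : H) :
    r ^ j * nrm (gproj 𝒜 j h) ≤ wnorm 𝒜 nrm N C r h := by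
  rw [wnorm_apply (zero_le_one.trans hC) hr]
  have h1 : ∀ j ∈ Finset.range (N + 1), 0 ≤ r ^ j * nrm (gproj 𝒜 j h) := fun j _ =>
    mul_nonneg (pow_nonneg hr j) (apply_nonneg _ _)
  have h2 := Finset.single_le_sum h1 (Finset.mem_range.2 (Nat.lt_succ_of_le hj))
  exact h2.trans (le_mul_of_one_le_left (Finset.sum_nonneg h1) hC)

theorem wnorm_definite (htr : ∀ n, N < n → 𝒜 n = ⊥) (hnrm : ∀ h, nrm h = 0 → h = 0) (hC : 1 ≤ C)
    {r : ℝ} (hr : 0 < r) (h : H) (h0 : wnorm 𝒜 nrm N C r h = 0) : h = 0 := by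
  rw [← sum_gproj htr h]
  refine Finset.sum_eq_zero fun j hj => hnrm _ ?_
  have h1 := comp_le_wnorm (𝒜 := 𝒜) (nrm := nrm) hC hr.le
    (Nat.lt_succ_iff.1 (Finset.mem_range.1 hj)) h
  rw [h0] at h1
  have h2 : 0 < r ^ j := pow_pos hr j
  have h3 : 0 ≤ nrm (gproj 𝒜 j h) := apply_nonneg _ _
  nlinarith

theorem wnorm_mul_le (htr : ∀ n, N < n → 𝒜 n = ⊥) (hC : 0 ≤ C)
    (h : ∀ x y, wnorm 𝒜 nrm N 1 1 (x * y) ≤ C * (wnorm 𝒜 nrm N 1 1 x * wnorm 𝒜 nrm N 1 1 y))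
    (r : ℝ) (x y : H) :
    wnorm 𝒜 nrm N C r (x * y) ≤ wnorm 𝒜 nrm N C r x * wnorm 𝒜 nrm N C r y := by
  rw [← wnorm_abs r, wnorm_eq_dil htr hC (abs_nonneg r), wnorm_eq_dil htr hC (abs_nonneg r),
    wnorm_eq_dil htr hC (abs_nonneg r), dil_mul htr]
  refine (mul_le_mul_of_nonneg_left (h _ _) hC).trans_eq ?_
  ring

/-- If the component of degree `j` of `h` is of order `r^(N - j)`, then `h` is of order `r^N`. -/
theorem wnorm_le_of_comp_le (hC : 0 ≤ C) {r A : ℝ} (hr : 0 ≤ r) {h : H}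
    (hA : ∀ j ≤ N, nrm (gproj 𝒜 j h) ≤ A * r ^ (N - j)) :
    wnorm 𝒜 nrm N C r h ≤ C * (N + 1) * (A * r ^ N) := by
  rw [wnorm_apply hC hr, mul_assoc]
  refine mul_le_mul_of_nonneg_left ?_ hC
  calc _ ≤ ∑ j ∈ Finset.range (N + 1), A * r ^ N := by
        refine Finset.sum_le_sum fun j hj => ?_
        have hj' : j ≤ N := Nat.lt_succ_iff.1 (Finset.mem_range.1 hj)
        have := mul_le_mul_of_nonneg_left (hA j hj') (pow_nonneg hr j)
        refine this.trans_eq ?_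
        rw [mul_left_comm, ← pow_add, Nat.add_sub_cancel' hj']
    _ = _ := by simp

theorem wnorm_le_wnorm (hC : 0 ≤ C) {r s c : ℝ} (hr : 0 ≤ r) (hs : 0 ≤ s) {h : H}
    (hc : ∀ j ≤ N, gproj 𝒜 j h ≠ 0 → r ^ j ≤ c * s ^ j) :
    wnorm 𝒜 nrm N C r h ≤ c * wnorm 𝒜 nrm N C s h := by
  rw [wnorm_apply hC hr, wnorm_apply hC hs, mul_left_comm]
  refine mul_le_mul_of_nonneg_left ?_ hC
  rw [Finset.mul_sum]
  refine Finset.sum_le_sum fun j hj => ?_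
  by_cases h0 : gproj 𝒜 j h = 0
  · simp [h0]
  · rw [← mul_assoc]
    exact mul_le_mul_of_nonneg_right (hc j (Nat.lt_succ_iff.1 (Finset.mem_range.1 hj)) h0)
      (apply_nonneg _ _)

theorem gproj_gproj (i j : ℕ) (h : H) :
    gproj 𝒜 i (gproj 𝒜 j h) = if i = j then gproj 𝒜 j h else 0 := by
  split_ifs with hij
  · rw [hij, gproj_same (gproj_mem j h)]
  · exact gproj_ne (Ne.symm hij) (gproj_mem j h)

theorem wnorm_sub_gproj_le (hC : 0 ≤ C) {r : ℝ} (hr : 0 ≤ r) (k : ℕ) (h : H) :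
    wnorm 𝒜 nrm N C r (h - gproj 𝒜 k h) ≤ wnorm 𝒜 nrm N C r h := by
  rw [wnorm_apply hC hr, wnorm_apply hC hr]
  refine mul_le_mul_of_nonneg_left (Finset.sum_le_sum fun j _ =>
    mul_le_mul_of_nonneg_left ?_ (pow_nonneg hr j)) hC
  rw [map_sub, gproj_gproj]
  split_ifs with hjk
  · rw [hjk, sub_self, map_zero]; exact apply_nonneg _ _
  · rw [sub_zero]

theorem wnorm_gproj (hC : 0 ≤ C) {r : ℝ} (hr : 0 ≤ r) {k : ℕ} (hk : k ≤ N) (h : H) :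
    wnorm 𝒜 nrm N C r (gproj 𝒜 k h) = C * (r ^ k * nrm (gproj 𝒜 k h)) := by
  rw [wnorm_apply hC hr, Finset.sum_eq_single k]
  · rw [gproj_gproj, if_pos rfl]
  · intro j _ hj
    rw [gproj_gproj, if_neg hj, map_zero, mul_zero]
  · intro hk'
    exact absurd (Finset.mem_range.2 (Nat.lt_succ_of_le hk)) hk'

end Weighted

/-! ### The scale of norms of a graded Hopf algebra -/

section Dilations

variable {H : Type*} [CommRing H] [Algebra ℝ H]
variable {𝒜 : ℕ → Submodule ℝ H} [GradedAlgebra 𝒜] {N : ℕ}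

theorem dil_degree_one (htr : ∀ n, N < n → 𝒜 n = ⊥) {L : H →ₗ[ℝ] H}
    (hL : ∀ n, ∀ x ∈ 𝒜 n, L x ∈ 𝒜 (n + 1)) (r : ℝ) (x : H) :
    dil 𝒜 N r (L x) = r • L (dil 𝒜 N r x) := by
  have : dil 𝒜 N r ∘ₗ L = r • (L ∘ₗ dil 𝒜 N r) := by
    refine linearMap_ext_grading (𝒜 := 𝒜) fun n x hx => ?_
    rw [LinearMap.comp_apply, LinearMap.smul_apply, LinearMap.comp_apply,
      dil_of_mem htr r (hL n x hx), dil_of_mem htr r hx, map_smul, smul_smul, pow_succ, mul_comm]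
  exact congrArg (fun f => f x) this

/-- A linear form whose values in degree `j` are of order `r^j` is of order one after a dilation. -/
theorem abs_comp_dil_le {nrm : Seminorm ℝ H} {ξ : Module.Dual ℝ H}
    {C ℓ r : ℝ} (hC : 0 ≤ C) (hℓ : 0 ≤ ℓ) (hr : 0 < r) (hℓr : ℓ ≤ r)
    (h : ∀ n, ∀ h ∈ 𝒜 n, |ξ h| ≤ C * nrm h * ℓ ^ n) (x : H) :
    |(ξ ∘ₗ dil 𝒜 N r⁻¹) x| ≤ C * wnorm 𝒜 nrm N 1 1 x := by
  rw [LinearMap.comp_apply, dil, LinearMap.sum_apply, map_sum,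
    wnorm_apply zero_le_one zero_le_one, one_mul, Finset.mul_sum]
  refine (Finset.abs_sum_le_sum_abs _ _).trans (Finset.sum_le_sum fun j _ => ?_)
  rw [LinearMap.smul_apply, map_smul, smul_eq_mul, abs_mul, one_pow, one_mul,
    abs_of_pos (pow_pos (inv_pos.2 hr) j)]
  have h1 := h j _ (gproj_mem j x)
  have h2 : ℓ ^ j ≤ r ^ j := pow_le_pow_left₀ hℓ hℓr j
  have h3 : 0 ≤ C * nrm (gproj 𝒜 j x) := mul_nonneg hC (apply_nonneg _ _)
  have h4 : 0 < r ^ j := pow_pos hr j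
  rw [inv_pow, inv_mul_le_iff₀ h4]
  nlinarith

end Dilations

section GradedScale

variable {H : Type*} [CommRing H] [Algebra ℝ H] [Coalgebra ℝ H]

/-- A scale of norms `P r`, comparable to `h ↦ ∑_j r^j ‖π_j h‖` with `‖ ‖` the norm `nrm`, together
with the bounds of the cocycles `L i` and of the components of an element. -/
structure IsGradedScale (𝒜 : ℕ → Submodule ℝ H) [GradedAlgebra 𝒜] (nrm : Seminorm ℝ H) (N : ℕ)
    {d : ℕ} (L : Fin d → H →ₗ[ℝ] H) (P : ℝ → Seminorm ℝ H) (Γ Λ : ℝ) : Prop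
    extends IsScale P Γ Λ where
  comp_le : ∀ r, 0 ≤ r → ∀ j ≤ N, ∀ h, r ^ j * nrm (gproj 𝒜 j h) ≤ P r h
  le_of_comp_le : ∀ r, 0 ≤ r → ∀ A, 0 ≤ A → ∀ h, (∀ j ≤ N, nrm (gproj 𝒜 j h) ≤ A * r ^ (N - j)) →
    P r h ≤ Γ * (A * r ^ N)
  cocycle_le : ∀ i r, 0 < r → ∀ h, P r (L i h) ≤ Γ * r * P r h
  top_le : ∀ r, 0 ≤ r → ∀ h, P r (gproj 𝒜 N h) ≤ Γ * r ^ N * P 1 h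
  sub_top_le : ∀ r, 0 ≤ r → ∀ h, P r (h - gproj 𝒜 N h) ≤ P r h
  pow_mul_le : ∀ r, 0 ≤ r → r ≤ 1 → ∀ h, r ^ N * P 1 h ≤ P r h
  transfer : ∀ r s, 0 < r → r ≤ s → ∀ h, gproj 𝒜 N h = 0 →
    r ^ (N - 1) * P s h ≤ s ^ (N - 1) * P r h
  definite : ∀ h, P 1 h = 0 → h = 0

variable {𝒜 : ℕ → Submodule ℝ H} [GradedAlgebra 𝒜] {N : ℕ}

/-- The scale consists of the norms `wnorm`, with the factor `C` large enough to make them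
submultiplicative. The last clause applies to the functionals `X s t` of a rough path, with
`ℓ = ω(s,t)^γ`. -/
theorem exists_isGradedScale (hH : IsTruncatedHopf 𝒜 N) (hN : 1 ≤ N) {nrm : Seminorm ℝ H}
    (hnrm : ∀ h, nrm h = 0 → h = 0) {d : ℕ} {L : Fin d → H →ₗ[ℝ] H}
    (hL : ∀ i n, ∀ x ∈ 𝒜 n, L i x ∈ 𝒜 (n + 1)) {Λ : ℝ} (hΛ : 1 ≤ Λ) (C : ℝ) :
    ∃ (P : ℝ → Seminorm ℝ H) (Γ : ℝ), IsGradedScale 𝒜 nrm N L P Γ Λ ∧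
      ∀ (ξ : Module.Dual ℝ H) (ℓ r : ℝ), IsTruncatedCharacter 𝒜 N ξ →
        (∀ n, ∀ h ∈ 𝒜 n, |ξ h| ≤ C * nrm h * ℓ ^ n) → 0 ≤ ℓ → ℓ ≤ r → 0 < r → r ≤ Λ →
        IsScaled P N Γ r (act ξ) ∧ ∀ h, |ξ h| ≤ Γ * P r h := by
  have htr := hH.truncated
  have hfin : Module.Finite ℝ H := finite_of_grading htr hH.finite
  set Q := wnorm 𝒜 nrm N 1 1 with hQ
  have hQd : ∀ h, Q h = 0 → h = 0 := wnorm_definite htr hnrm le_rfl one_pos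
  obtain ⟨C₀, hC₀, hmul⟩ := exists_mul_bound Q hQd
  obtain ⟨K, hK, hact⟩ := exists_act_bound Q hQd
  choose KL hKL hLb using fun i => exists_map_bound Q hQd (L i)
  have hC₀' : 0 ≤ C₀ := zero_le_one.trans hC₀
  have hΛ0 : 0 ≤ Λ := zero_le_one.trans hΛ
  let P : ℝ → Seminorm ℝ H := fun r => wnorm 𝒜 nrm N C₀ r
  have hone : 0 < nrm 1 := lt_of_le_of_ne (apply_nonneg _ _)
    (fun h => hH.one_ne_zero (hnrm _ h.symm))
  have hone_mem : (1 : H) ∈ 𝒜 0 := SetLike.GradedOne.one_mem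
  set D := K * |C| with hD
  have hD0 : 0 ≤ D := by positivity
  set S := ∑ i, KL i with hS
  have hS0 : 0 ≤ S := Finset.sum_nonneg fun i _ => hKL i
  set M := (N + 1 : ℝ) * ((N + 1 : ℝ) * (D ^ 2 * C₀ ^ 2 * Λ ^ N)) with hM
  have hM0 : 0 ≤ M := by positivity
  set Γ := Λ + C₀ * nrm 1 + (nrm 1)⁻¹ + Λ ^ N + C₀ * (N + 1) + S + D + |C| + M with hΓ
  have i1 : 0 ≤ C₀ * nrm 1 := by positivity
  have i2 : 0 ≤ (nrm 1)⁻¹ := by positivity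
  have i3 : 0 ≤ Λ ^ N := by positivity
  have i4 : 0 ≤ C₀ * (N + 1 : ℝ) := by positivity
  have i5 : 0 ≤ |C| := abs_nonneg C
  have pow_le : ∀ r, 0 ≤ r → r ≤ Λ → ∀ j ≤ N, r ^ j ≤ Λ ^ N := fun r hr hrΛ j hj =>
    (pow_le_pow_left₀ hr hrΛ j).trans (pow_le_pow_right₀ hΛ hj)
  have P_dil : ∀ r, 0 ≤ r → ∀ h, P r h = C₀ * Q (dil 𝒜 N r h) := fun r hr h =>
    wnorm_eq_dil htr hC₀' hr h
  have hcomp : ∀ r, 0 ≤ r → ∀ j ≤ N, ∀ h, r ^ j * nrm (gproj 𝒜 j h) ≤ P r h :=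
    fun r hr j hj h => comp_le_wnorm hC₀ hr hj h
  have hmul' : ∀ r x y, P r (x * y) ≤ P r x * P r y := wnorm_mul_le htr hC₀' hmul
  refine ⟨P, Γ, ⟨⟨hΛ, ?_, hmul', ?_, hH.comul_one_and_counit_one.2, ?_, ?_, ?_⟩, hcomp,
    ?_, ?_, ?_, ?_, ?_, ?_, ?_⟩, ?_⟩
  · linarith
  · intro r
    have e : P r 1 = C₀ * nrm 1 := by
      change wnorm 𝒜 nrm N C₀ r 1 = _
      rw [← wnorm_abs, wnorm_eq_dil htr hC₀' (abs_nonneg r), dil_one_apply htr,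
        ← gproj_same hone_mem, wnorm_gproj zero_le_one zero_le_one (Nat.zero_le N)]
      simp
    rw [e]; linarith
  · intro r x
    have h1 := hcomp |r| (abs_nonneg r) 0 (Nat.zero_le N) x
    rw [pow_zero, one_mul, hH.gproj_zero_eq, map_smul_eq_mul, Real.norm_eq_abs] at h1
    have h2 : P |r| = P r := wnorm_abs r
    rw [h2] at h1
    have h3 : |Coalgebra.counit (R := ℝ) x| ≤ (nrm 1)⁻¹ * P r x := by
      rw [le_inv_mul_iff₀ hone]; linarith
    exact h3.trans (mul_le_mul_of_nonneg_right (by linarith) (apply_nonneg _ _))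
  · intro r hr hrΛ x
    have h1 : P r x ≤ Λ ^ N * P 1 x := wnorm_le_wnorm hC₀' hr.le zero_le_one fun j hj _ => by
      rw [one_pow, mul_one]; exact pow_le r hr.le hrΛ j hj
    exact h1.trans (mul_le_mul_of_nonneg_right (by linarith) (apply_nonneg _ _))
  · intro r hr hrΛ x hx
    have h1 : P r x ≤ (r * Λ ^ N) * P 1 x :=
      wnorm_le_wnorm hC₀' hr.le zero_le_one fun j hj hj0 => by
        have hj1 : j ≠ 0 := by
          rintro rfl
          rw [hH.gproj_zero_eq, hx, zero_smul] at hj0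
          exact hj0 rfl
        obtain ⟨k, rfl⟩ := Nat.exists_eq_succ_of_ne_zero hj1
        rw [one_pow, mul_one, Nat.succ_eq_add_one, pow_succ']
        exact mul_le_mul_of_nonneg_left (pow_le r hr.le hrΛ k (by omega)) hr.le
    refine h1.trans (mul_le_mul_of_nonneg_right ?_ (apply_nonneg _ _))
    rw [mul_comm]
    exact mul_le_mul_of_nonneg_right (by linarith) hr.le
  · intro r hr A hA h hh
    exact (wnorm_le_of_comp_le hC₀' hr hh).trans
      (mul_le_mul_of_nonneg_right (by linarith) (by positivity))
  · intro i r hr h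
    have h1 : KL i ≤ S := Finset.single_le_sum (fun i _ => hKL i) (Finset.mem_univ i)
    have h2 : P r (L i h) ≤ KL i * r * P r h := by
      rw [P_dil r hr.le, P_dil r hr.le, dil_degree_one htr (hL i), map_smul_eq_mul,
        Real.norm_of_nonneg hr.le]
      have := mul_le_mul_of_nonneg_left (hLb i (dil 𝒜 N r h)) (mul_nonneg hC₀' hr.le)
      linarith
    refine h2.trans (mul_le_mul_of_nonneg_right ?_ (apply_nonneg _ _))
    exact mul_le_mul_of_nonneg_right (by linarith) hr.le
  · intro r hr h
    have h1 : P r (gproj 𝒜 N h) = C₀ * (r ^ N * nrm (gproj 𝒜 N h)) := wnorm_gproj hC₀' hr le_rfl h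
    have h2 := hcomp 1 zero_le_one N le_rfl h
    rw [one_pow, one_mul] at h2
    have h3 : C₀ ≤ Γ := by
      have : C₀ ≤ C₀ * (N + 1) := le_mul_of_one_le_right hC₀' (by norm_cast; omega)
      linarith
    rw [h1, mul_assoc]
    exact mul_le_mul h3 (mul_le_mul_of_nonneg_left h2 (pow_nonneg hr N))
      (mul_nonneg (pow_nonneg hr N) (apply_nonneg _ _)) (hC₀'.trans h3)
  · exact fun r hr h => wnorm_sub_gproj_le hC₀' hr N h
  · intro r hr hr1 h
    change r ^ N * wnorm 𝒜 nrm N C₀ 1 h ≤ wnorm 𝒜 nrm N C₀ r h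
    rw [wnorm_apply hC₀' zero_le_one, wnorm_apply hC₀' hr, mul_left_comm]
    refine mul_le_mul_of_nonneg_left ?_ hC₀'
    rw [Finset.mul_sum]
    refine Finset.sum_le_sum fun j hj => ?_
    rw [one_pow, one_mul]
    exact mul_le_mul_of_nonneg_right
      (pow_le_pow_of_le_one hr hr1 (Nat.lt_succ_iff.1 (Finset.mem_range.1 hj))) (apply_nonneg _ _)
  · intro r s hr hrs h hN0
    change r ^ (N - 1) * wnorm 𝒜 nrm N C₀ s h ≤ s ^ (N - 1) * wnorm 𝒜 nrm N C₀ r h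
    have hs := hr.trans_le hrs
    rw [wnorm_apply hC₀' hs.le, wnorm_apply hC₀' hr.le, mul_left_comm, mul_left_comm (s ^ (N - 1))]
    refine mul_le_mul_of_nonneg_left ?_ hC₀'
    rw [Finset.mul_sum, Finset.mul_sum]
    refine Finset.sum_le_sum fun j hj => ?_
    rcases eq_or_ne j N with rfl | hjN
    · rw [hN0, map_zero, mul_zero, mul_zero, mul_zero, mul_zero]
    have hj' : j + (N - 1 - j) = N - 1 := by
      have := Finset.mem_range.1 hj
      omega
    rw [← mul_assoc, ← mul_assoc]
    refine mul_le_mul_of_nonneg_right ?_ (apply_nonneg _ _)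
    have h1 : r ^ (N - 1 - j) ≤ s ^ (N - 1 - j) := pow_le_pow_left₀ hr.le hrs _
    calc r ^ (N - 1) * s ^ j = (r ^ j * s ^ j) * r ^ (N - 1 - j) := by
          rw [← hj', pow_add, hj']; ring
      _ ≤ (r ^ j * s ^ j) * s ^ (N - 1 - j) := mul_le_mul_of_nonneg_left h1 (by positivity)
      _ = s ^ (N - 1) * r ^ j := by
          conv_rhs => rw [← hj', pow_add]
          ring
  · exact wnorm_definite htr hnrm hC₀ one_pos
  · intro ξ ℓ r hξ hb hℓ hℓr hr hrΛ
    have hb' : ∀ n, ∀ h ∈ 𝒜 n, |ξ h| ≤ |C| * nrm h * ℓ ^ n := fun n h hh =>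
      (hb n h hh).trans (mul_le_mul_of_nonneg_right (mul_le_mul_of_nonneg_right (le_abs_self C)
        (apply_nonneg _ _)) (pow_nonneg hℓ n))
    have hξ' := abs_comp_dil_le (N := N) (abs_nonneg C) hℓ hr hℓr hb'
    have hbound : ∀ x, P r (act ξ x) ≤ D * P r x := fun x => by
      rw [P_dil r hr.le, P_dil r hr.le, hH.dil_act ξ hr.ne']
      have := mul_le_mul_of_nonneg_left (hact _ _ hξ' (dil 𝒜 N r x)) hC₀'
      linarith
    refine ⟨⟨?_, fun x => ?_, fun x y => ?_⟩, fun h => ?_⟩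
    · rw [hH.act_one, hξ.map_one, one_smul]
    · exact (hbound x).trans (mul_le_mul_of_nonneg_right (by linarith) (apply_nonneg _ _))
    · have hterm : ∀ a ≤ N, ∀ b ≤ N, P r (act ξ (gproj 𝒜 a x * gproj 𝒜 b y)
          - act ξ (gproj 𝒜 a x) * act ξ (gproj 𝒜 b y))
          ≤ D ^ 2 * C₀ ^ 2 * Λ ^ N * (r ^ N * (P 1 x * P 1 y)) := by
        intro a ha b hb
        by_cases hab : a + b ≤ N
        · rw [hH.act_mul hξ hab (gproj_mem a x) (gproj_mem b y), sub_self, map_zero]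
          have : 0 ≤ P 1 x * P 1 y := mul_nonneg (apply_nonneg _ _) (apply_nonneg _ _)
          positivity
        · have h0 : gproj 𝒜 a x * gproj 𝒜 b y = 0 := by
            have := SetLike.mul_mem_graded (gproj_mem (𝒜 := 𝒜) a x) (gproj_mem (𝒜 := 𝒜) b y)
            rwa [htr _ (not_le.1 hab), Submodule.mem_bot] at this
          rw [h0, map_zero, zero_sub, map_neg_eq_map]
          have hc : ∀ k ≤ N, ∀ z, P r (act ξ (gproj 𝒜 k z)) ≤ D * (C₀ * (r ^ k * P 1 z)) := by
            intro k hk z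
            refine (hbound _).trans (mul_le_mul_of_nonneg_left ?_ hD0)
            have e : P r (gproj 𝒜 k z) = C₀ * (r ^ k * nrm (gproj 𝒜 k z)) :=
              wnorm_gproj hC₀' hr.le hk z
            rw [e]
            have h1 := hcomp 1 zero_le_one k hk z
            rw [one_pow, one_mul] at h1
            gcongr
          refine (hmul' _ _ _).trans ((mul_le_mul (hc a ha x) (hc b hb y) (apply_nonneg _ _)
            ((apply_nonneg _ _).trans (hc a ha x))).trans ?_)
          have e : r ^ a * r ^ b = r ^ N * r ^ (a + b - N) := by
            rw [← pow_add, ← pow_add]; congr 1; omega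
          have h2 : r ^ (a + b - N) ≤ Λ ^ N := pow_le r hr.le hrΛ _ (by omega)
          have h3 : 0 ≤ P 1 x * P 1 y := mul_nonneg (apply_nonneg _ _) (apply_nonneg _ _)
          calc D * (C₀ * (r ^ a * P 1 x)) * (D * (C₀ * (r ^ b * P 1 y)))
              = D ^ 2 * C₀ ^ 2 * (r ^ a * r ^ b) * (P 1 x * P 1 y) := by ring
            _ = D ^ 2 * C₀ ^ 2 * (r ^ N * r ^ (a + b - N)) * (P 1 x * P 1 y) := by rw [e]
            _ ≤ D ^ 2 * C₀ ^ 2 * (r ^ N * Λ ^ N) * (P 1 x * P 1 y) := by gcongr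
            _ = _ := by ring
      have hsum : act ξ (x * y) - act ξ x * act ξ y = ∑ a ∈ Finset.range (N + 1),
          ∑ b ∈ Finset.range (N + 1), (act ξ (gproj 𝒜 a x * gproj 𝒜 b y)
            - act ξ (gproj 𝒜 a x) * act ξ (gproj 𝒜 b y)) := by
        simp only [Finset.sum_sub_distrib, ← map_sum, ← Finset.mul_sum, ← Finset.sum_mul,
          sum_gproj htr]
      rw [hsum]
      have hfinal : ∀ a ∈ Finset.range (N + 1), P r (∑ b ∈ Finset.range (N + 1),
          (act ξ (gproj 𝒜 a x * gproj 𝒜 b y) - act ξ (gproj 𝒜 a x) * act ξ (gproj 𝒜 b y)))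
          ≤ (N + 1) * (D ^ 2 * C₀ ^ 2 * Λ ^ N * (r ^ N * (P 1 x * P 1 y))) := by
        intro a ha
        refine (seminorm_sum_le _ _ _).trans ((Finset.sum_le_sum fun b hb =>
          hterm a (Nat.lt_succ_iff.1 (Finset.mem_range.1 ha)) b
            (Nat.lt_succ_iff.1 (Finset.mem_range.1 hb))).trans_eq ?_)
        simp
      refine (seminorm_sum_le _ _ _).trans ((Finset.sum_le_sum hfinal).trans ?_)
      have h3 : 0 ≤ P 1 x * P 1 y := mul_nonneg (apply_nonneg _ _) (apply_nonneg _ _)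
      calc _ = M * (r ^ N * (P 1 x * P 1 y)) := by
            rw [hM, Finset.sum_const, Finset.card_range, nsmul_eq_mul]; push_cast; ring
        _ ≤ Γ * (r ^ N * (P 1 x * P 1 y)) := by
            refine mul_le_mul_of_nonneg_right (by linarith) (by positivity)
        _ = _ := by ring
    · have h1 := hξ' (dil 𝒜 N r h)
      rw [LinearMap.comp_apply, dil_dil htr, inv_mul_cancel₀ hr.ne', dil_one htr] at h1
      refine h1.trans ?_
      have h2 : Q (dil 𝒜 N r h) ≤ P r h := by
        rw [P_dil r hr.le]
        exact le_mul_of_one_le_left (apply_nonneg _ _) hC₀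
      exact mul_le_mul (by linarith) h2 (apply_nonneg _ _) (by linarith)

end GradedScale

/-! ### Rough integrals -/

section Driver

variable {H : Type*} [CommRing H] [Algebra ℝ H] [Coalgebra ℝ H]

/-- The properties of a rough path `X` over a Hopf algebra with cocycles `L i` which the theory of
differential equations uses, stated with a scale of norms. An estimate in terms of `ω(s,t)^γ` is
replaced by the same estimate in terms of all the numbers `r ≥ ω(s,t)^γ` with `0 < r ≤ Λ`, which
avoids the dilation of ratio zero. -/
structure IsDriver (𝒜 : ℕ → Submodule ℝ H) [GradedAlgebra 𝒜] (nrm : Seminorm ℝ H) (N : ℕ)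
    {d : ℕ} (L : Fin d → H →ₗ[ℝ] H) (γ T : ℝ) (ω : ℝ → ℝ → ℝ) (X : ℝ → ℝ → Module.Dual ℝ H)
    (P : ℝ → Seminorm ℝ H) (Γ Λ : ℝ) : Prop
    extends IsGradedScale 𝒜 nrm N L P Γ Λ where
  control : IsControl T ω
  right : IsRightContinuous T ω
  exponent_pos : 0 < γ
  one_lt_mul : 1 < (N + 1) * γ
  mul_le_one : N * γ ≤ 1
  one_le_order : 1 ≤ N
  rpow_lt : ∀ s t, 0 ≤ s → s ≤ t → t ≤ T → ω s t ^ γ < Λ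
  scaled : ∀ s t r, 0 ≤ s → s ≤ t → t ≤ T → ω s t ^ γ ≤ r → 0 < r → r ≤ Λ →
    IsScaled P N Γ r (act (X s t))
  bound : ∀ s t r, 0 ≤ s → s ≤ t → t ≤ T → ω s t ^ γ ≤ r → 0 < r → r ≤ Λ → ∀ h,
    |X s t h| ≤ Γ * P r h
  pairing_one : ∀ s t, 0 ≤ s → s ≤ t → t ≤ T → X s t 1 = 1
  act_one : ∀ s t, 0 ≤ s → s ≤ t → t ≤ T → act (X s t) 1 = 1
  chen : ∀ s u t, 0 ≤ s → s ≤ u → u ≤ t → t ≤ T → ∀ h, X s t h = X u t (act (X s u) h)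
  act_cocycle : ∀ i s t h, gproj 𝒜 N h = 0 →
    act (X s t) (L i h) = L i (act (X s t) h) + X s t (L i h) • (1 : H)
  cocycle_top : ∀ i h, L i (gproj 𝒜 N h) = 0
  counit_cocycle : ∀ i h, Coalgebra.counit (R := ℝ) (L i h) = 0

/-- The range of the scale is taken larger than `ω(0,T)^γ`, so that every `ω(s,t)^γ` is below it. -/
theorem exists_isDriver {𝒜 : ℕ → Submodule ℝ H} [GradedAlgebra 𝒜] {N d : ℕ}
    (hH : IsTruncatedHopf 𝒜 N) {B : LinearMap.BilinForm ℝ H} {L : Fin d → H →ₗ[ℝ] H}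
    (hL : IsCocycleSystem 𝒜 N B L) {nrm : Seminorm ℝ H} (hnrm : ∀ h, nrm h = 0 → h = 0)
    {γ : ℝ} (hγ : 0 < γ) (hγ' : γ ≤ 1) (hN : N = ⌊1 / γ⌋₊) {T : ℝ} (hT : 0 < T)
    {ω : ℝ → ℝ → ℝ} (hω : IsControl T ω) (hω' : IsRightContinuous T ω)
    {x : ℝ → Module.Dual ℝ (𝒜 1)} {X : ℝ → ℝ → Module.Dual ℝ H}
    (hX : IsRoughPath 𝒜 nrm N γ T ω x X) :
    ∃ (P : ℝ → Seminorm ℝ H) (Γ Λ : ℝ), IsDriver 𝒜 nrm N L γ T ω X P Γ Λ := by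
  have hN1 : 1 ≤ N := by
    rw [hN, Nat.one_le_floor_iff, le_div_iff₀ hγ, one_mul]; exact hγ'
  obtain ⟨C, hC⟩ := hX.bound
  have hmass := hω.nonneg 0 T le_rfl hT.le le_rfl
  have hpos : 0 ≤ ω 0 T ^ γ := Real.rpow_nonneg hmass γ
  have hlt : ∀ s t, 0 ≤ s → s ≤ t → t ≤ T → ω s t ^ γ < ω 0 T ^ γ + 1 := by
    intro s t h1 h2 h3
    have := Real.rpow_le_rpow (hω.nonneg s t h1 h2 h3)
      (hω.isControlOn.mono le_rfl h1 h2 h3 le_rfl) hγ.le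
    linarith
  obtain ⟨P, Γ, hP, hscaled⟩ := exists_isGradedScale hH hN1 hnrm (L := L) hL.degree_one
    (Λ := ω 0 T ^ γ + 1) (by linarith) C
  have key : ∀ s t r, 0 ≤ s → s ≤ t → t ≤ T → ω s t ^ γ ≤ r → 0 < r → r ≤ ω 0 T ^ γ + 1 →
      IsScaled P N Γ r (act (X s t)) ∧ ∀ h, |X s t h| ≤ Γ * P r h := by
    intro s t r h1 h2 h3 h4 h5 h6
    refine hscaled _ (ω s t ^ γ) r (hX.character s t h1 h2 h3) (fun n h hh => ?_)
      (Real.rpow_nonneg (hω.nonneg s t h1 h2 h3) γ) h4 h5 h6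
    rw [← Real.rpow_natCast, ← Real.rpow_mul (hω.nonneg s t h1 h2 h3), mul_comm γ]
    exact hC s t h1 h2 h3 n h hh
  refine ⟨P, Γ, ω 0 T ^ γ + 1, ⟨hP, hω, hω', hγ, ?_, ?_, hN1, hlt,
    fun s t r h1 h2 h3 h4 h5 h6 => (key s t r h1 h2 h3 h4 h5 h6).1,
    fun s t r h1 h2 h3 h4 h5 h6 => (key s t r h1 h2 h3 h4 h5 h6).2,
    fun s t h1 h2 h3 => (hX.character s t h1 h2 h3).map_one, fun s t h1 h2 h3 => ?_, ?_, ?_, ?_,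
    ?_⟩⟩
  · have := Nat.lt_floor_add_one (1 / γ)
    rw [← hN, div_lt_iff₀ hγ] at this
    exact this
  · have := Nat.floor_le (a := 1 / γ) (by positivity)
    rwa [← hN, le_div_iff₀ hγ] at this
  · rw [hH.act_one, (hX.character s t h1 h2 h3).map_one, one_smul]
  · intro s u t h1 h2 h3 h4 h
    rw [pairing_act, ← hX.chen s u t h1 h2 h3 h4]
  · intro i s t h hh
    have hsum := sum_gproj hH.truncated h
    rw [Finset.sum_range_succ, hh, add_zero] at hsum
    rw [← hsum]
    simp only [map_sum, Finset.sum_smul, ← Finset.sum_add_distrib]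
    exact Finset.sum_congr rfl fun n hn =>
      act_cocycle (hL.cocycle i n (Finset.mem_range.1 hn) _ (gproj_mem n h)) _
  · intro i h
    have := hL.degree_one i N _ (gproj_mem N h)
    rwa [hH.truncated _ (Nat.lt_succ_self N), Submodule.mem_bot] at this
  · intro i h
    have : Coalgebra.counit (R := ℝ) ∘ₗ L i = 0 :=
      linearMap_ext_grading (𝒜 := 𝒜) fun n x hx =>
        hH.counit_of_mem (Nat.succ_ne_zero n) (hL.degree_one i n x hx)
    exact congrArg (fun f => f h) this

/-- `P r h ≤ A r^N` for all `r` between `ℓ` and `ρ`. For the weighted norms `P r`, this says that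
the component of degree `j` of `h` is of order `ℓ^(N - j)`. -/
def HasOrder (P : ℝ → Seminorm ℝ H) (N : ℕ) (ℓ ρ A : ℝ) (h : H) : Prop :=
  ∀ r, 0 < r → ℓ ≤ r → r ≤ ρ → P r h ≤ A * r ^ N

theorem le_apply_of_forall_gt {f : ℝ → ℝ} (hf : Continuous f) {a ℓ ρ : ℝ} (hℓ : ℓ < ρ)
    (h : ∀ r, ℓ < r → r ≤ ρ → a ≤ f r) : a ≤ f ℓ :=
  ge_of_tendsto ((hf.tendsto ℓ).mono_left (nhdsWithin_le_nhds (s := Ioi ℓ)))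
    (Filter.mem_of_superset (Ioc_mem_nhdsGT hℓ) fun r hr => h r hr.1 hr.2)

variable {𝒜 : ℕ → Submodule ℝ H} [GradedAlgebra 𝒜] {nrm : Seminorm ℝ H} {N d : ℕ}
  {L : Fin d → H →ₗ[ℝ] H} {γ T : ℝ} {ω : ℝ → ℝ → ℝ} {X : ℝ → ℝ → Module.Dual ℝ H}
  {P : ℝ → Seminorm ℝ H} {Γ Λ : ℝ}

theorem IsDriver.rpow_nonneg (hX : IsDriver 𝒜 nrm N L γ T ω X P Γ Λ) {s t : ℝ} (h1 : 0 ≤ s)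
    (h2 : s ≤ t) (h3 : t ≤ T) : 0 ≤ ω s t ^ γ :=
  Real.rpow_nonneg (hX.control.nonneg s t h1 h2 h3) γ

theorem IsDriver.rpow_mono (hX : IsDriver 𝒜 nrm N L γ T ω X P Γ Λ) {s s' t' t : ℝ} (h1 : 0 ≤ s)
    (h2 : s ≤ s') (h3 : s' ≤ t') (h4 : t' ≤ t) (h5 : t ≤ T) : ω s' t' ^ γ ≤ ω s t ^ γ :=
  Real.rpow_le_rpow (hX.control.nonneg s' t' (h1.trans h2) h3 (h4.trans h5))
    (hX.control.isControlOn.mono h1 h2 h3 h4 h5) hX.exponent_pos.le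

theorem IsDriver.cocycle_sub_top (hX : IsDriver 𝒜 nrm N L γ T ω X P Γ Λ) (i : Fin d) (h : H) :
    L i (h - gproj 𝒜 N h) = L i h := by
  rw [map_sub, hX.cocycle_top, sub_zero]

theorem IsDriver.pairing_cocycle_le (hX : IsDriver 𝒜 nrm N L γ T ω X P Γ Λ) {s t : ℝ}
    (h1 : 0 ≤ s) (h2 : s ≤ t) (h3 : t ≤ T) (i : Fin d) (h : H) :
    |X s t (L i h)| ≤ Γ ^ 3 * P 1 h * ω s t ^ γ := by
  have hΓ := zero_le_one.trans hX.one_le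
  refine le_apply_of_forall_gt (f := fun r => Γ ^ 3 * P 1 h * r) (by fun_prop)
    (hX.rpow_lt s t h1 h2 h3) fun r hr hrΛ => ?_
  have hr0 := (hX.rpow_nonneg h1 h2 h3).trans_lt hr
  have e1 := hX.bound s t r h1 h2 h3 hr.le hr0 hrΛ (L i h)
  have e2 := hX.cocycle_le i r hr0 h
  have e3 := hX.le r hr0 hrΛ h
  calc |X s t (L i h)| ≤ Γ * (Γ * r * (Γ * P 1 h)) := by
        refine e1.trans (mul_le_mul_of_nonneg_left (e2.trans ?_) hΓ)
        exact mul_le_mul_of_nonneg_left e3 (by positivity)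
    _ = _ := by ring

/-- The defect of `y' - act (X s u) y` after removal of the top component of `y`, which the
cocycles do not see. -/
theorem IsDriver.sub_act_sub_top_le (hX : IsDriver 𝒜 nrm N L γ T ω X P Γ Λ) {s u r : ℝ}
    (h1 : 0 ≤ s) (h2 : s ≤ u) (h3 : u ≤ T) (hr : ω s u ^ γ ≤ r) (hr0 : 0 < r) (hrΛ : r ≤ Λ)
    {y y' : H} {A : ℝ} (hy' : P r (y' - act (X s u) y) ≤ A) :
    P r (y' - act (X s u) (y - gproj 𝒜 N y)) ≤ A + Γ ^ 2 * r ^ N * P 1 y := by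
  have e : y' - act (X s u) (y - gproj 𝒜 N y)
      = (y' - act (X s u) y) + act (X s u) (gproj 𝒜 N y) := by rw [map_sub]; abel
  rw [e]
  refine (map_add_le_add _ _ _).trans (add_le_add hy' ?_)
  refine ((hX.scaled s u r h1 h2 h3 hr hr0 hrΛ).bound _).trans ?_
  calc Γ * P r (gproj 𝒜 N y) ≤ Γ * (Γ * r ^ N * P 1 y) :=
        mul_le_mul_of_nonneg_left (hX.top_le r hr0.le y) (zero_le_one.trans hX.one_le)
    _ = _ := by ring

/-- The germ `X s t (L y)` is almost additive along `y` controlled by `X`. The cocycle identity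
and Chen's relation turn its defect into `X u t (L ρ)` with `ρ` the defect of `y`. -/
theorem IsDriver.defect_le (hX : IsDriver 𝒜 nrm N L γ T ω X P Γ Λ) {s u t : ℝ} (h1 : 0 ≤ s)
    (h2 : s ≤ u) (h3 : u ≤ t) (h4 : t ≤ T) {ρ : ℝ} (hρ : ω s u ^ γ < ρ) (hρΛ : ρ ≤ Λ) {y y' : H}
    {A : ℝ} (hy : P 1 y ≤ A)
    (hy' : HasOrder P N (ω s u ^ γ) ρ A (y' - act (X s u) y)) (i : Fin d) :
    |X s t (L i y) - X s u (L i y) - X u t (L i y')|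
      ≤ Γ ^ 2 * (1 + Γ ^ 2) * A * (ω s u ^ γ * (ω s t ^ γ) ^ N) := by
  have hΓ := zero_le_one.trans hX.one_le
  set z := y' - act (X s u) (y - gproj 𝒜 N y) with hz
  set v := z - gproj 𝒜 N z with hv
  have e1 : X s t (L i y) - X s u (L i y) - X u t (L i y') = - X u t (L i v) := by
    rw [hv, hX.cocycle_sub_top, hz, map_sub, hX.chen s u t h1 h2 h3 h4 (L i y),
      ← hX.cocycle_sub_top i y, hX.act_cocycle i s u (y - gproj 𝒜 N y), map_add, map_smul,
      hX.pairing_one u t (h1.trans h2) h3 h4, map_sub, smul_eq_mul, mul_one]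
    · simp only [map_sub]; ring
    · rw [map_sub, gproj_gproj, if_pos rfl, sub_self]
  have hvN : gproj 𝒜 N v = 0 := by rw [hv, map_sub, gproj_gproj, if_pos rfl, sub_self]
  rw [e1, abs_neg]
  set B := Γ ^ 2 * (1 + Γ ^ 2) * A with hB
  have hℓ0 := hX.rpow_nonneg h1 h2 (h3.trans h4)
  have hmono := hX.rpow_mono (s := s) (s' := s) h1 le_rfl h2 h3 h4
  have hmono' := hX.rpow_mono (t := t) (t' := t) h1 h2 h3 le_rfl h4
  have two : ∀ r r', ω s u ^ γ < r → r ≤ ρ → r ≤ r' → ω s t ^ γ < r' → r' ≤ Λ →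
      |X u t (L i v)| ≤ B * (r * r' ^ N) := by
    intro r r' hr hrρ hrr' hr' hr'Λ
    have hr0 := hℓ0.trans_lt hr
    have hr'0 := hr0.trans_le hrr'
    have g1 := hX.sub_act_sub_top_le h1 h2 (h3.trans h4) hr.le hr0 (hrρ.trans hρΛ)
      (hy' r hr0 hr.le hrρ)
    have g2 : P r v ≤ (1 + Γ ^ 2) * A * r ^ N := by
      refine (hX.sub_top_le r hr0.le z).trans (g1.trans ?_)
      have : Γ ^ 2 * r ^ N * P 1 y ≤ Γ ^ 2 * r ^ N * A :=
        mul_le_mul_of_nonneg_left hy (by positivity)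
      linarith
    have g3 := hX.transfer r r' hr0 hrr' v hvN
    have g4 := hX.bound u t r' (h1.trans h2) h3 h4 (hmono'.trans hr'.le) hr'0 hr'Λ (L i v)
    have g5 := hX.cocycle_le i r' hr'0 v
    obtain ⟨k, rfl⟩ : ∃ k, N = k + 1 := ⟨N - 1, by have := hX.one_le_order; omega⟩
    rw [Nat.add_sub_cancel] at g3
    have g6 : P r' v ≤ r' ^ k * ((1 + Γ ^ 2) * A * r) := by
      have hrk : 0 < r ^ k := pow_pos hr0 k
      refine le_of_mul_le_mul_left ?_ hrk
      calc r ^ k * P r' v ≤ r' ^ k * P r v := g3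
        _ ≤ r' ^ k * ((1 + Γ ^ 2) * A * r ^ (k + 1)) := by gcongr
        _ = _ := by ring
    calc |X u t (L i v)| ≤ Γ * (Γ * r' * (r' ^ k * ((1 + Γ ^ 2) * A * r))) :=
          g4.trans (mul_le_mul_of_nonneg_left (g5.trans (by gcongr)) hΓ)
      _ = _ := by rw [hB]; ring
  refine le_apply_of_forall_gt (f := fun r' => B * (ω s u ^ γ * r' ^ N)) (by fun_prop)
    (hX.rpow_lt s t h1 (h2.trans h3) h4) fun r' hr' hr'Λ => ?_
  refine le_apply_of_forall_gt (f := fun r => B * (r * r' ^ N)) (by fun_prop)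
    (ρ := min ρ r') (lt_min hρ (hmono.trans_lt hr')) fun r hr hrρ => ?_
  exact two r r' hr (hrρ.trans (min_le_left _ _)) (hrρ.trans (min_le_right _ _)) hr' hr'Λ

theorem IsDriver.isControlOn (hX : IsDriver 𝒜 nrm N L γ T ω X P Γ Λ) {a b : ℝ} (ha : 0 ≤ a)
    (hb : b ≤ T) : IsControlOn a b ω :=
  hX.control.isControlOn.restrict ha hb

/-- The rough integral of `Y` against `L i`, with a bound that is linear in the size `A` of `Y` and
of its remainder, and uniform in the interval. -/
theorem IsDriver.exists_integral (hX : IsDriver 𝒜 nrm N L γ T ω X P Γ Λ) (hT : 0 ≤ T) (e : ℕ) :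
    ∃ K : ℝ, 0 ≤ K ∧ ∀ a b, 0 ≤ a → a ≤ b → b ≤ T → ∀ ρ, ω a b ^ γ < ρ → ρ ≤ Λ → ∀ A, 0 < A →
      ∀ Y : ℝ → Fin e → H, (∀ s, a ≤ s → s ≤ b → ∀ m, P 1 (Y s m) ≤ A) →
      (∀ s u, a ≤ s → s ≤ u → u ≤ b → ∀ m,
        HasOrder P N (ω s u ^ γ) ρ A (Y u m - act (X s u) (Y s m))) →
      ∀ i, ∃ G : ℝ → Fin e → ℝ,
        SewingBound a b ω γ N (K * A) fun s t => G t - G s - fun m => X s t (L i (Y s m)) := by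
  have hΓ := zero_le_one.trans hX.one_le
  set K₁ := Γ ^ 3 + Γ ^ 2 * (1 + Γ ^ 2) with hK₁
  have hK₁0 : 0 ≤ K₁ := by positivity
  obtain ⟨K, hK, hsew⟩ := exists_path_of_isAlmostFlow (E := Fin e → ℝ) (N := N)
    hX.exponent_pos hX.one_lt_mul hK₁0 (hX.control.nonneg 0 T le_rfl hT le_rfl)
  refine ⟨K, hK, fun a b ha hab hb ρ hρ hρΛ A hA Y hY hY' i => ?_⟩
  let Ξ : ℝ → ℝ → (Fin e → ℝ) → (Fin e → ℝ) := fun s t _ m => A⁻¹ * X s t (L i (Y s m))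
  have hflow : IsAlmostFlow a b ω γ N K₁ Ξ := by
    refine ⟨fun s t z h1 h2 h3 => ?_, fun s u t z z' h1 h2 h3 h4 _ => ?_⟩
    · have hℓ := hX.rpow_nonneg (ha.trans h1) h2 (h3.trans hb)
      refine (pi_norm_le_iff_of_nonneg (mul_nonneg hK₁0 hℓ)).2 fun m => ?_
      rw [Real.norm_eq_abs, abs_mul, abs_of_pos (inv_pos.2 hA), inv_mul_le_iff₀ hA]
      refine (hX.pairing_cocycle_le (ha.trans h1) h2 (h3.trans hb) i _).trans ?_
      have := hY s h1 (h2.trans h3) m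
      calc Γ ^ 3 * P 1 (Y s m) * ω s t ^ γ ≤ Γ ^ 3 * A * ω s t ^ γ := by gcongr
        _ ≤ (Γ ^ 3 + Γ ^ 2 * (1 + Γ ^ 2)) * A * ω s t ^ γ := by
            gcongr; exact le_add_of_nonneg_right (by positivity)
        _ = _ := by rw [hK₁]; ring
    · have hℓ := hX.rpow_nonneg (ha.trans h1) h2 (h3.trans (h4.trans hb))
      have hℓ' := hX.rpow_nonneg (ha.trans h1) (h2.trans h3) (h4.trans hb)
      refine (pi_norm_le_iff_of_nonneg (by positivity)).2 fun m => ?_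
      have e1 : (Ξ s t z - Ξ s u z - Ξ u t z') m = A⁻¹ *
          (X s t (L i (Y s m)) - X s u (L i (Y s m)) - X u t (L i (Y u m))) := by
        simp only [Ξ, Pi.sub_apply]; ring
      rw [e1, Real.norm_eq_abs, abs_mul, abs_of_pos (inv_pos.2 hA), inv_mul_le_iff₀ hA]
      have hub := h3.trans h4
      have hlt : ω s u ^ γ < ρ := (hX.rpow_mono ha h1 h2 hub hb).trans_lt hρ
      refine (hX.defect_le (ha.trans h1) h2 h3 (h4.trans hb) hlt hρΛ
        (hY s h1 (h2.trans hub) m) (hY' s u h1 h2 hub m) i).trans ?_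
      calc _ ≤ (Γ ^ 3 + Γ ^ 2 * (1 + Γ ^ 2)) * A * (ω s u ^ γ * (ω s t ^ γ) ^ N) := by
            gcongr; exact le_add_of_nonneg_left (by positivity)
        _ = _ := by rw [hK₁]; ring
  have hmass : ω a b ≤ ω 0 T := hX.control.isControlOn.mono le_rfl ha hab hb le_rfl
  obtain ⟨G, -, hG⟩ := hsew a b ω (hX.isControlOn ha hb) hab hmass Ξ hflow
    (fun s t _ _ _ => continuous_const) 0
  refine ⟨fun t => A • G t, fun s t ε h1 h2 h3 hε h => ?_⟩
  have e1 : (A • G t - A • G s - fun m => X s t (L i (Y s m)))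
      = A • (G t - G s - Ξ s t (G s)) := by
    ext m
    simp only [Ξ, Pi.sub_apply, Pi.smul_apply, smul_eq_mul, mul_sub, mul_inv_cancel_left₀ hA.ne']
  have := hG s t ε h1 h2 h3 hε h
  simp only [e1]
  rw [norm_smul, Real.norm_of_nonneg hA.le, mul_comm K, mul_assoc]
  exact mul_le_mul_of_nonneg_left this hA.le

/-- The Riemann sums converge to the increments of a path with the bound of the sewing lemma. -/
theorem IsDriver.hasRRSLimit (hX : IsDriver 𝒜 nrm N L γ T ω X P Γ Λ) {V : Type*}
    [NormedAddCommGroup V] {a b K : ℝ} (ha : 0 ≤ a) (hb : b ≤ T) (hK : 0 ≤ K) {Ξ : ℝ → ℝ → V}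
    {G : ℝ → V} (h : SewingBound a b ω γ N K fun s t => G t - G s - Ξ s t) {s t : ℝ} (has : a ≤ s)
    (hst : s ≤ t) (htb : t ≤ b) : HasRRSLimit Ξ s t (G t - G s) := by
  refine h.hasRRSLimit (hX.isControlOn ha hb) (fun s u h1 h2 h3 => ?_) hX.one_lt_mul
    hX.mul_le_one hK has hst htb
  exact (hX.right s u (ha.trans h1) h2 (h3.trans hb)).mono_left
    (nhdsWithin_mono _ (Ioc_subset_Ioc_right hb))

end Driver

/-! ### The algebraic part of the equation -/

section FixedPoint

variable {H : Type*} [CommRing H] [Algebra ℝ H] [Coalgebra ℝ H]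

/-- The right-hand side of the equation, as a function of the value `w` of the solution, when the
real part of the solution is `x`. -/
noncomputable def cocycleMap {d e : ℕ} (N : ℕ) (L : Fin d → H →ₗ[ℝ] H)
    (g : Fin d → Fin e → (Fin e → ℝ) → ℝ) (c : Fin e → H) (x : Fin e → ℝ) (w : Fin e → H)
    (m : Fin e) : H :=
  bar (c m) + x m • (1 : H) + ∑ i, L i (ev N (g i m) w)

theorem exists_small {c : ℝ} (hc : 0 ≤ c) : ∃ r : ℝ, 0 < r ∧ r ≤ 1 ∧ c * r ≤ 1 / 2 := by
  refine ⟨1 / (2 * (c + 1)), by positivity, ?_, ?_⟩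
  · rw [div_le_one (by positivity)]; linarith
  · rw [mul_one_div, div_le_div_iff₀ (by positivity) (by norm_num)]; linarith

theorem le_zero_of_forall_le_mul {a C : ℝ} (h : ∀ r, 0 < r → r ≤ 1 → a ≤ C * r) : a ≤ 0 := by
  have := le_apply_of_forall_gt (f := fun r => C * r) (by fun_prop) one_pos h
  simpa using this

variable {𝒜 : ℕ → Submodule ℝ H} [GradedAlgebra 𝒜] {nrm : Seminorm ℝ H} {N d e : ℕ}
  {L : Fin d → H →ₗ[ℝ] H} {γ T : ℝ} {ω : ℝ → ℝ → ℝ} {X : ℝ → ℝ → Module.Dual ℝ H}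
  {P : ℝ → Seminorm ℝ H} {Γ Λ : ℝ} {g : Fin d → Fin e → (Fin e → ℝ) → ℝ} {M : ℝ}
  {c : Fin e → H} {x : Fin e → ℝ}

theorem IsDriver.counit_cocycleMap (hX : IsDriver 𝒜 nrm N L γ T ω X P Γ Λ) (w : Fin e → H)
    (m : Fin e) : Coalgebra.counit (R := ℝ) (cocycleMap N L g c x w m) = x m := by
  rw [cocycleMap, map_add, map_add, counit_bar hX.counit_one, map_smul, hX.counit_one, map_sum,
    Finset.sum_eq_zero fun i _ => hX.counit_cocycle i _]
  simp

theorem IsDriver.bar_cocycleMap (hX : IsDriver 𝒜 nrm N L γ T ω X P Γ Λ) (w : Fin e → H)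
    (m : Fin e) : bar (cocycleMap N L g c x w m)
      = bar (c m) + ∑ i, L i (ev N (g i m) w) := by
  rw [bar_eq, hX.counit_cocycleMap, cocycleMap]; abel

theorem IsDriver.sum_cocycle_le (hX : IsDriver 𝒜 nrm N L γ T ω X P Γ Λ) {r C : ℝ} (hr : 0 < r)
    {y : Fin d → H} (hy : ∀ i, P r (y i) ≤ C) : P r (∑ i, L i (y i)) ≤ d * Γ * C * r := by
  have hΓ := zero_le_one.trans hX.one_le
  refine (seminorm_sum_le _ _ _).trans ((Finset.sum_le_sum fun i _ => (hX.cocycle_le i r hr _).trans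
    (mul_le_mul_of_nonneg_left (hy i) (mul_nonneg hΓ hr.le))).trans_eq ?_)
  simp; ring

/-- The Lipschitz bound of the fixed point map, whose factor `r` is gained from the cocycles. -/
theorem IsDriver.cocycleMap_sub_le [Module.Finite ℝ H]
    (hX : IsDriver 𝒜 nrm N L γ T ω X P Γ Λ) (hg : ∀ i m, ContDiff ℝ N (g i m)) (hM0 : 0 ≤ M)
    (hM : ∀ i m, ∀ n ≤ N, ∀ z, ‖iteratedFDeriv ℝ n (g i m) z‖ ≤ M) (c : Fin e → H)
    {A : ℝ} (hA : 0 ≤ A) :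
    ∃ K : ℝ, 0 ≤ K ∧ ∀ r, 0 < r → r ≤ Λ → ∀ x x' : Fin e → ℝ, ∀ w w' : Fin e → H,
      (∀ j, P 1 (bar (w j)) ≤ A) → (∀ j, P 1 (bar (w' j)) ≤ A) →
      ∀ R, 0 ≤ R → (∀ j, P r (w' j - w j) ≤ R) → ∀ m,
      P r (cocycleMap N L g c x' w' m - cocycleMap N L g c x w m)
        ≤ Γ * ‖x' - x‖ + K * r * R := by
  have hΓ := zero_le_one.trans hX.one_le
  obtain ⟨K, hK, hev⟩ := hX.ev_sub_le hA hM0 hX.one_le_order (Fin e)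
  refine ⟨d * Γ * K, by positivity, fun r hr hrΛ x x' w w' hw hw' R hR hwR m => ?_⟩
  have e1 : cocycleMap N L g c x' w' m - cocycleMap N L g c x w m
      = (x' - x) m • (1 : H) + ∑ i, L i (ev N (g i m) w' - ev N (g i m) w) := by
    simp only [cocycleMap, map_sub, Finset.sum_sub_distrib, Pi.sub_apply, sub_smul]; abel
  rw [e1]
  refine (map_add_le_add _ _ _).trans (add_le_add ?_ ?_)
  · rw [map_smul_eq_mul, mul_comm]
    exact mul_le_mul (hX.one r) (norm_le_pi_norm _ _) (norm_nonneg _) hΓ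
  · refine (hX.sum_cocycle_le hr fun i => hev (g i m) (hg i m) r hr hrΛ w w' hw hw'
      (fun n hn τ _ => hM i m n hn _) R hR hwR).trans_eq ?_
    ring

/-- A system of inequalities with a small factor. -/
theorem sum_le_of_forall_le_add {a : Fin e → ℝ} {b δ : ℝ} (ha : ∀ m, 0 ≤ a m)
    (hδ : e * δ ≤ 1 / 2) (h : ∀ m, a m ≤ b + δ * ∑ k, a k) : ∑ k, a k ≤ 2 * e * b := by
  have h1 := Finset.sum_le_sum fun m (_ : m ∈ Finset.univ) => h m
  rw [Finset.sum_const, Finset.card_univ, Fintype.card_fin, nsmul_eq_mul] at h1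
  have h2 : 0 ≤ ∑ k, a k := Finset.sum_nonneg fun k _ => ha k
  nlinarith [mul_le_mul_of_nonneg_right hδ h2]

/-- A fixed point is unique: by the Lipschitz bound, with a small `r` which depends on the two fixed
points, the `P r`-distance of the two is at most half of itself. -/
theorem IsDriver.eq_of_fixed [Module.Finite ℝ H] (hX : IsDriver 𝒜 nrm N L γ T ω X P Γ Λ)
    (hg : ∀ i m, ContDiff ℝ N (g i m)) (hM0 : 0 ≤ M)
    (hM : ∀ i m, ∀ n ≤ N, ∀ z, ‖iteratedFDeriv ℝ n (g i m) z‖ ≤ M) {w w' : Fin e → H}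
    (hw : w = cocycleMap N L g c x w) (hw' : w' = cocycleMap N L g c x w') : w' = w := by
  set A := ∑ m, (P 1 (bar (w m)) + P 1 (bar (w' m))) with hA
  have h0 : ∀ m, 0 ≤ P 1 (bar (w m)) + P 1 (bar (w' m)) := fun m =>
    add_nonneg (apply_nonneg _ _) (apply_nonneg _ _)
  have hle : ∀ m, P 1 (bar (w m)) + P 1 (bar (w' m)) ≤ A := fun m =>
    Finset.single_le_sum (f := fun m => P 1 (bar (w m)) + P 1 (bar (w' m))) (fun m _ => h0 m)
      (Finset.mem_univ m)
  obtain ⟨K, hK, hLip⟩ := hX.cocycleMap_sub_le hg hM0 hM c (Finset.sum_nonneg fun m _ => h0 m)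
  obtain ⟨r, hr, hr1, hKr⟩ := exists_small (mul_nonneg (Nat.cast_nonneg e) hK)
  have hS : ∀ m, P r (w' m - w m) ≤ 0 + K * r * ∑ k, P r (w' k - w k) := by
    intro m
    have := hLip r hr (hr1.trans hX.one_le_range) x x w w'
      (fun j => (le_add_of_nonneg_right (apply_nonneg _ _)).trans (hle j))
      (fun j => (le_add_of_nonneg_left (apply_nonneg _ _)).trans (hle j))
      (∑ k, P r (w' k - w k)) (Finset.sum_nonneg fun k _ => apply_nonneg _ _)
      (fun j => Finset.single_le_sum (f := fun k => P r (w' k - w k))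
        (fun k _ => apply_nonneg _ _) (Finset.mem_univ j)) m
    rwa [← hw, ← hw', sub_self, norm_zero, mul_zero] at this
  have hsum := sum_le_of_forall_le_add (fun m => apply_nonneg _ _)
    (by rw [← mul_assoc]; exact hKr) hS
  rw [mul_zero] at hsum
  ext m
  have h1 : P r (w' m - w m) ≤ 0 := (Finset.single_le_sum (f := fun k => P r (w' k - w k))
        (fun k _ => apply_nonneg _ _) (Finset.mem_univ m)).trans hsum
  have h2 := hX.pow_mul_le r hr.le hr1 (w' m - w m)
  have h3 : 0 < r ^ N := pow_pos hr N
  have h4 : P 1 (w' m - w m) = 0 :=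
    le_antisymm (by nlinarith) (apply_nonneg _ _)
  exact sub_eq_zero.1 (hX.definite _ h4)

/-- The fixed point is reached after `N + 2` iterations, as each iteration fixes one more degree.
All iterates stay in the unit ball of a norm `P r` which depends neither on `x` nor on the
iterate. -/
theorem IsDriver.exists_fixed [Module.Finite ℝ H] (hX : IsDriver 𝒜 nrm N L γ T ω X P Γ Λ)
    (hg : ∀ i m, ContDiff ℝ N (g i m)) (hM0 : 0 ≤ M)
    (hM : ∀ i m, ∀ n ≤ N, ∀ z, ‖iteratedFDeriv ℝ n (g i m) z‖ ≤ M) (c : Fin e → H) :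
    ∃ A : ℝ, 0 ≤ A ∧ ∀ x : Fin e → ℝ, ∃ w : Fin e → H, w = cocycleMap N L g c x w ∧
      ∀ m, P 1 (bar (w m)) ≤ A := by
  have hΓ := zero_le_one.trans hX.one_le
  obtain ⟨K₀, hK₀, hev⟩ := hX.ev_le zero_le_one hM0 N (Fin e)
  set p := ∑ m, P 1 (bar (c m)) with hp
  have hp0 : 0 ≤ p := Finset.sum_nonneg fun m _ => apply_nonneg _ _
  have hpm : ∀ m, P 1 (bar (c m)) ≤ p := fun m => Finset.single_le_sum
    (f := fun m => P 1 (bar (c m))) (fun m _ => apply_nonneg _ _) (Finset.mem_univ m)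
  obtain ⟨r₀, hr₀, hr₀1, hsmall⟩ := exists_small (c := Γ * p + d * Γ * K₀) (by positivity)
  have hr₀N : 0 < r₀ ^ N := pow_pos hr₀ N
  have ball : ∀ x (w : Fin e → H), (∀ m, P r₀ (bar (w m)) ≤ 1) →
      ∀ m, P r₀ (bar (cocycleMap N L g c x w m)) ≤ 1 := by
    intro x w hw m
    rw [hX.bar_cocycleMap]
    have h1 := hX.bar_le hr₀ (hr₀1.trans hX.one_le_range) (hpm m)
    have h2 := hX.sum_cocycle_le hr₀ fun i => hev (g i m) (hg i m) r₀ hr₀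
      (hr₀1.trans hX.one_le_range) w hw fun n hn => hM i m n hn.le _
    have h3 := map_add_le_add (P r₀) (bar (c m)) (∑ i, L i (ev N (g i m) w))
    linarith
  have hone : ∀ {w : Fin e → H}, (∀ m, P r₀ (bar (w m)) ≤ 1) →
      ∀ m, P 1 (bar (w m)) ≤ 1 / r₀ ^ N := by
    intro w hw m
    rw [le_div_iff₀ hr₀N, mul_comm]
    exact (hX.pow_mul_le r₀ hr₀.le hr₀1 _).trans (hw m)
  have hA : (0 : ℝ) ≤ 1 / r₀ ^ N := by positivity
  obtain ⟨K, hK, hLip⟩ := hX.cocycleMap_sub_le hg hM0 hM c hA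
  refine ⟨1 / r₀ ^ N, hA, fun x => ?_⟩
  let W : ℕ → Fin e → H := fun k => (cocycleMap N L g c x)^[k] fun m => x m • (1 : H)
  have hWs : ∀ k, W (k + 1) = cocycleMap N L g c x (W k) := fun k =>
    Function.iterate_succ_apply' _ _ _
  have hWb : ∀ k m, P r₀ (bar (W k m)) ≤ 1 := by
    intro k
    induction k with
    | zero =>
      intro m
      have : bar (W 0 m) = 0 := by
        change bar (x m • (1 : H)) = 0
        rw [bar_eq, map_smul, hX.counit_one, smul_eq_mul, mul_one, sub_self]
      rw [this, map_zero]; exact zero_le_one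
    | succ k ih => rw [hWs]; exact ball x _ ih
  have hstep : ∀ k, ∃ C : ℝ, 0 ≤ C ∧ ∀ r, 0 < r → r ≤ 1 → ∀ m,
      P r (W (k + 1) m - W k m) ≤ C * r ^ k := by
    intro k
    induction k with
    | zero =>
      refine ⟨Γ * ∑ m, P 1 (W 1 m - W 0 m), mul_nonneg hΓ (Finset.sum_nonneg fun m _ =>
        apply_nonneg _ _), fun r hr hr1 m => ?_⟩
      rw [pow_zero, mul_one]
      refine (hX.le r hr (hr1.trans hX.one_le_range) _).trans (mul_le_mul_of_nonneg_left ?_ hΓ)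
      exact Finset.single_le_sum (f := fun m => P 1 (W 1 m - W 0 m))
        (fun m _ => apply_nonneg _ _) (Finset.mem_univ m)
    | succ k ih =>
      obtain ⟨C, hC, h⟩ := ih
      refine ⟨K * C, mul_nonneg hK hC, fun r hr hr1 m => ?_⟩
      have := hLip r hr (hr1.trans hX.one_le_range) x x (W k) (W (k + 1)) (hone (hWb k))
        (hone (hWb (k + 1))) (C * r ^ k) (by positivity) (h r hr hr1) m
      rw [← hWs, ← hWs, sub_self, norm_zero, mul_zero, zero_add] at this
      refine this.trans_eq ?_
      ring
  refine ⟨W (N + 1), ?_, hone (hWb (N + 1))⟩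
  rw [← hWs]
  obtain ⟨C, hC, h⟩ := hstep (N + 1)
  ext m
  have h1 : P 1 (W (N + 1 + 1) m - W (N + 1) m) ≤ 0 := by
    refine le_zero_of_forall_le_mul (C := C) fun r hr hr1 => ?_
    have h2 := (hX.pow_mul_le r hr.le hr1 _).trans (h r hr hr1 m)
    have h3 : 0 < r ^ N := pow_pos hr N
    rw [pow_succ] at h2
    refine le_of_mul_le_mul_left ?_ h3
    linarith
  exact (sub_eq_zero.1 (hX.definite _ (le_antisymm h1 (apply_nonneg _ _)))).symm

/-- The solution is a Lipschitz function `F` of its real part. -/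
theorem IsDriver.exists_section [Module.Finite ℝ H] (hX : IsDriver 𝒜 nrm N L γ T ω X P Γ Λ)
    (hg : ∀ i m, ContDiff ℝ N (g i m)) (hM0 : 0 ≤ M)
    (hM : ∀ i m, ∀ n ≤ N, ∀ z, ‖iteratedFDeriv ℝ n (g i m) z‖ ≤ M) (c : Fin e → H) :
    ∃ (F : (Fin e → ℝ) → Fin e → H) (A K : ℝ), 0 ≤ A ∧ 0 ≤ K ∧
      (∀ x w, w = cocycleMap N L g c x w ↔ w = F x) ∧ (∀ x m, P 1 (bar (F x m)) ≤ A) ∧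
      ∀ x x' m, P 1 (F x' m - F x m) ≤ K * ‖x' - x‖ := by
  have hΓ := zero_le_one.trans hX.one_le
  obtain ⟨A, hA, hF⟩ := hX.exists_fixed hg hM0 hM c
  choose F hF hFA using hF
  obtain ⟨K, hK, hLip⟩ := hX.cocycleMap_sub_le hg hM0 hM c hA
  obtain ⟨r, hr, hr1, hKr⟩ := exists_small (mul_nonneg (Nat.cast_nonneg e) hK)
  have hrN : 0 < r ^ N := pow_pos hr N
  refine ⟨F, A, 2 * e * Γ / r ^ N, hA, by positivity, fun x w => ⟨fun hw =>
    hX.eq_of_fixed hg hM0 hM (hF x) hw, fun hw => by rw [hw]; exact hF x⟩, hFA, fun x x' m => ?_⟩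
  have hS : ∀ m, P r (F x' m - F x m)
      ≤ Γ * ‖x' - x‖ + K * r * ∑ k, P r (F x' k - F x k) := by
    intro m
    have := hLip r hr (hr1.trans hX.one_le_range) x x' (F x) (F x') (hFA x) (hFA x')
      (∑ k, P r (F x' k - F x k)) (Finset.sum_nonneg fun k _ => apply_nonneg _ _)
      (fun j => Finset.single_le_sum (f := fun k => P r (F x' k - F x k))
        (fun k _ => apply_nonneg _ _) (Finset.mem_univ j)) m
    rwa [← hF, ← hF] at this
  have hsum := sum_le_of_forall_le_add (fun m => apply_nonneg _ _)
    (by rw [← mul_assoc]; exact hKr) hS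
  have h1 := (Finset.single_le_sum (f := fun k => P r (F x' k - F x k))
        (fun k _ => apply_nonneg _ _) (Finset.mem_univ m)).trans hsum
  have h2 := (hX.pow_mul_le r hr.le hr1 _).trans h1
  rw [div_mul_eq_mul_div, le_div_iff₀ hrN]
  linarith

end FixedPoint

/-! ### Existence -/

section Existence

variable {H : Type*} [CommRing H] [Algebra ℝ H] [Coalgebra ℝ H]
variable {𝒜 : ℕ → Submodule ℝ H} [GradedAlgebra 𝒜] {nrm : Seminorm ℝ H} {N d e : ℕ}
  {L : Fin d → H →ₗ[ℝ] H} {γ T : ℝ} {ω : ℝ → ℝ → ℝ} {X : ℝ → ℝ → Module.Dual ℝ H}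
  {P : ℝ → Seminorm ℝ H} {Γ Λ : ℝ} {g : Fin d → Fin e → (Fin e → ℝ) → ℝ} {M : ℝ}
  {c : Fin e → H}

theorem IsDriver.pow_le_mul (hX : IsDriver 𝒜 nrm N L γ T ω X P Γ Λ) {r : ℝ} (hr : 0 < r)
    (hrΛ : r ≤ Λ) : r ^ N ≤ Λ ^ N * r := by
  obtain ⟨k, rfl⟩ : ∃ k, N = k + 1 := ⟨N - 1, by have := hX.one_le_order; omega⟩
  rw [pow_succ]
  refine mul_le_mul_of_nonneg_right ?_ hr.le
  exact (pow_le_pow_left₀ hr.le hrΛ k).trans (pow_le_pow_right₀ hX.one_le_range (Nat.le_succ k))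

/-- The image of a controlled path under `g` is controlled. -/
theorem IsDriver.exists_ev_order [Module.Finite ℝ H] (hX : IsDriver 𝒜 nrm N L γ T ω X P Γ Λ)
    (hM0 : 0 ≤ M) {A : ℝ} (hA : 0 ≤ A) (e : ℕ) :
    ∃ K : ℝ, 0 < K ∧ ∀ f : (Fin e → ℝ) → ℝ, ContDiff ℝ N f →
      (∀ n ≤ N, ∀ z, ‖iteratedFDeriv ℝ n f z‖ ≤ M) → ∀ s u, 0 ≤ s → s ≤ u → u ≤ T →
      ∀ w w' : Fin e → H, (∀ j, P 1 (bar (w j)) ≤ A) → (∀ j, P 1 (bar (w' j)) ≤ A) →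
      (∀ j, HasOrder P N (ω s u ^ γ) Λ A (w' j - act (X s u) (w j))) →
      P 1 (ev N f w) ≤ K ∧ HasOrder P N (ω s u ^ γ) Λ K (ev N f w' - act (X s u) (ev N f w)) := by
  have hΛ0 := zero_le_one.trans hX.one_le_range
  have hAΛ : A ≤ A * Λ ^ N := le_mul_of_one_le_right hA (one_le_pow₀ hX.one_le_range)
  obtain ⟨K₁, hK₁, h1⟩ := hX.ev_le hA hM0 N (Fin e)
  obtain ⟨K₂, hK₂, h2⟩ := hX.ev_sub_map_le (A := A * Λ ^ N) (by positivity) hM0 N (Fin e)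
  refine ⟨1 + K₁ + K₂ * (A + 1), by positivity,
    fun f hf hfM s u hs hsu hu w w' hw hw' hww' => ⟨?_, fun r hr hr' hrΛ => ?_⟩⟩
  · refine (h1 f hf 1 one_pos hX.one_le_range w hw fun n hn => hfM n hn.le _).trans ?_
    have : 0 ≤ K₂ * (A + 1) := by positivity
    linarith
  · have hrN : 0 ≤ r ^ N := by positivity
    refine (h2 f hf r hr hrΛ _ (hX.scaled s u r hs hsu hu hr' hr hrΛ) w w'
      (fun j => (hw j).trans hAΛ) (fun j => (hw' j).trans hAΛ) (fun n hn τ _ => hfM n hn _)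
      (A * r ^ N) (by positivity) ?_ fun j => hww' j r hr hr' hrΛ).trans ?_
    · rw [mul_assoc]
      exact mul_le_mul_of_nonneg_left (hX.pow_le_mul hr hrΛ) hA
    · nlinarith [mul_nonneg hK₁ hrN]

theorem IsDriver.cocycleMap_sub_act (hX : IsDriver 𝒜 nrm N L γ T ω X P Γ Λ) {s u : ℝ}
    (hs : 0 ≤ s) (hsu : s ≤ u) (hu : u ≤ T) (x x' : Fin e → ℝ) (w w' : Fin e → H) (m : Fin e) :
    cocycleMap N L g c x' w' m - act (X s u) (cocycleMap N L g c x w m)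
      = (c m - act (X s u) (c m))
        + (x' m - x m - ∑ i, X s u (L i (ev N (g i m) w))) • (1 : H)
        + ∑ i, L i (ev N (g i m) w'
          - act (X s u) (ev N (g i m) w - gproj 𝒜 N (ev N (g i m) w))) := by
  have e1 : ∀ i, act (X s u) (L i (ev N (g i m) w))
      = L i (act (X s u) (ev N (g i m) w - gproj 𝒜 N (ev N (g i m) w)))
        + X s u (L i (ev N (g i m) w)) • (1 : H) := by
    intro i
    rw [← hX.cocycle_sub_top i (ev N (g i m) w), hX.act_cocycle]
    rw [map_sub, gproj_gproj, if_pos rfl, sub_self]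
  simp only [cocycleMap, map_add, map_sum, map_smul, hX.act_one s u hs hsu hu, bar_eq, map_sub,
    Finset.sum_sub_distrib, sub_smul, Finset.sum_smul]
  simp only [e1, map_sub, Finset.sum_add_distrib, Finset.sum_sub_distrib]
  abel

/-- The defect of a fixed point is at least of order one. -/
theorem IsDriver.fixed_sub_act_le (hX : IsDriver 𝒜 nrm N L γ T ω X P Γ Λ) {A B K : ℝ}
    (hB : 0 ≤ B) {s u : ℝ} (hs : 0 ≤ s) (hsu : s ≤ u) (hu : u ≤ T) {x x' : Fin e → ℝ}
    {w w' : Fin e → H} (hw : w = cocycleMap N L g c x w)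
    (hw' : w' = cocycleMap N L g c x' w') (hwA : ∀ j, P 1 (bar (w j)) ≤ A)
    (hwA' : ∀ j, P 1 (bar (w' j)) ≤ A) (hy : ∀ i m, P 1 (ev N (g i m) w) ≤ K)
    (hxx' : ∀ m, |x' m - x m - ∑ i, X s u (L i (ev N (g i m) w))| ≤ B * (ω s u ^ γ) ^ N)
    (m : Fin e) {r : ℝ} (hr : 0 < r) (hℓr : ω s u ^ γ ≤ r) (hrΛ : r ≤ Λ) :
    P r (w' m - act (X s u) (w m))
      ≤ (Γ * (B * Λ ^ N + d * Γ ^ 3 * K) + Γ * A + Γ * (Γ * A)) * r := by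
  have hΓ := zero_le_one.trans hX.one_le
  have hℓ0 := hX.rpow_nonneg hs hsu hu
  have bw : ∀ x w, w = cocycleMap N L g c x w → Coalgebra.counit (R := ℝ) (w m) = x m := by
    intro x w hw; rw [hw]; exact hX.counit_cocycleMap _ m
  have e1 : w' m - act (X s u) (w m)
      = (x' m - x m) • (1 : H) + (bar (w' m) - act (X s u) (bar (w m))) := by
    rw [bar_eq, bar_eq, map_sub, map_smul, hX.act_one s u hs hsu hu, bw x w hw, bw x' w' hw',
      sub_smul]
    abel
  rw [e1]
  have g1 : |x' m - x m| ≤ (B * Λ ^ N + d * Γ ^ 3 * K) * r := by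
    have g2 : |∑ i, X s u (L i (ev N (g i m) w))| ≤ d * Γ ^ 3 * K * r := by
      refine (Finset.abs_sum_le_sum_abs _ _).trans ((Finset.sum_le_sum fun i _ =>
        (hX.pairing_cocycle_le hs hsu hu i _).trans (?_ : _ ≤ Γ ^ 3 * K * r)).trans_eq ?_)
      · have h0 := hy i m
        have h1 := (apply_nonneg (P 1) _).trans h0
        gcongr
      · simp; ring
    have g3 : B * (ω s u ^ γ) ^ N ≤ B * (Λ ^ N * r) := by
      refine mul_le_mul_of_nonneg_left ?_ hB
      exact (pow_le_pow_left₀ hℓ0 hℓr N).trans (hX.pow_le_mul hr hrΛ)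
    have g4 := (abs_sub_abs_le_abs_sub _ _).trans (hxx' m)
    linarith
  have g5 : P r ((x' m - x m) • (1 : H)) ≤ (B * Λ ^ N + d * Γ ^ 3 * K) * r * Γ := by
    rw [map_smul_eq_mul, Real.norm_eq_abs]
    exact mul_le_mul g1 (hX.one r) (apply_nonneg _ _) ((abs_nonneg _).trans g1)
  have g6 := hX.bar_le hr hrΛ (hwA' m)
  have g7 := ((hX.scaled s u r hs hsu hu hℓr hr hrΛ).bound (bar (w m))).trans
    (mul_le_mul_of_nonneg_left (hX.bar_le hr hrΛ (hwA m)) hΓ)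
  refine (map_add_le_add _ _ _).trans ((add_le_add g5 ((map_sub_le_add _ _ _).trans
    (add_le_add g6 g7))).trans ?_)
  linarith

/-- A path `w` that is determined by its real part `x` is controlled as soon as the increments of
`x` are those of the equation up to an error of order `N`. -/
theorem IsDriver.exists_fixed_order [Module.Finite ℝ H] (hX : IsDriver 𝒜 nrm N L γ T ω X P Γ Λ)
    (hg : ∀ i m, ContDiff ℝ N (g i m)) (hM0 : 0 ≤ M)
    (hM : ∀ i m, ∀ n ≤ N, ∀ z, ‖iteratedFDeriv ℝ n (g i m) z‖ ≤ M) {A B C : ℝ} (hA : 0 ≤ A)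
    (hB : 0 ≤ B) (hC : 0 ≤ C) (hc : ∀ s u, 0 ≤ s → s ≤ u → u ≤ T → ∀ m,
      HasOrder P N (ω s u ^ γ) Λ C (c m - act (X s u) (c m))) :
    ∃ K : ℝ, 0 ≤ K ∧ ∀ s u, 0 ≤ s → s ≤ u → u ≤ T → ∀ (x x' : Fin e → ℝ) (w w' : Fin e → H),
      w = cocycleMap N L g c x w → w' = cocycleMap N L g c x' w' →
      (∀ j, P 1 (bar (w j)) ≤ A) → (∀ j, P 1 (bar (w' j)) ≤ A) →
      (∀ m, |x' m - x m - ∑ i, X s u (L i (ev N (g i m) w))| ≤ B * (ω s u ^ γ) ^ N) →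
      ∀ m, HasOrder P N (ω s u ^ γ) Λ K (w' m - act (X s u) (w m)) := by
  have hΓ := zero_le_one.trans hX.one_le
  have hΛ0 := zero_le_one.trans hX.one_le_range
  obtain ⟨Ky, hKy, hev⟩ := hX.ev_le hA hM0 N (Fin e)
  set A₂ := Γ * (B * Λ ^ N + d * Γ ^ 3 * Ky) + Γ * A + Γ * (Γ * A) with hA₂
  have hA₂0 : 0 ≤ A₂ := by positivity
  set A₃ := A + e * A₂ with hA₃
  have hAA₃ : A ≤ A₃ := le_add_of_nonneg_right (by positivity)
  obtain ⟨K₁, hK₁, hmap⟩ := hX.ev_sub_map_le (A := A₃) (hA.trans hAA₃) hM0 N (Fin e)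
  obtain ⟨r₂, hr₂, hr₂1, hsmall⟩ := exists_small (c := e * (d * Γ * K₁)) (by positivity)
  set b := C + Γ * B + d * Γ * (K₁ + Γ ^ 2 * Ky) * Λ with hb
  have hb0 : 0 ≤ b := by positivity
  refine ⟨2 * e * b + A₂ * Λ / r₂ ^ N, by positivity,
    fun s u hs hsu hu x x' w w' hw hw' hwA hwA' hxx' => ?_⟩
  have hy : ∀ i m, P 1 (ev N (g i m) w) ≤ Ky := fun i m =>
    hev _ (hg i m) 1 one_pos hX.one_le_range w hwA fun n hn => hM i m n hn.le _
  have hℓ0 := hX.rpow_nonneg hs hsu hu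
  have hfirst : ∀ m r, 0 < r → ω s u ^ γ ≤ r → r ≤ Λ → P r (w' m - act (X s u) (w m)) ≤ A₂ * r :=
    fun m r hr hℓr hrΛ => hX.fixed_sub_act_le hB hs hsu hu hw hw' hwA hwA' hy hxx' m hr hℓr hrΛ
  intro m r hr hℓr hrΛ
  have hrN : 0 ≤ r ^ N := by positivity
  rcases le_or_gt r r₂ with hrr₂ | hrr₂
  · set S := ∑ k, P r (w' k - act (X s u) (w k)) with hS
    have hSk : ∀ k, P r (w' k - act (X s u) (w k)) ≤ S := fun k =>
      Finset.single_le_sum (f := fun k => P r (w' k - act (X s u) (w k)))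
        (fun k _ => apply_nonneg _ _) (Finset.mem_univ k)
    have hS0 : 0 ≤ S := Finset.sum_nonneg fun k _ => apply_nonneg _ _
    have hSr : S ≤ A₃ * r := by
      refine (Finset.sum_le_sum fun k _ => hfirst k r hr hℓr hrΛ).trans ?_
      simp only [Finset.sum_const, Finset.card_univ, Fintype.card_fin, nsmul_eq_mul]
      nlinarith [mul_nonneg hA hr.le]
    have hrow : ∀ k, P r (w' k - act (X s u) (w k)) ≤ b * r ^ N + d * Γ * K₁ * r * S := by
      intro k
      have e1 := hX.cocycleMap_sub_act (g := g) (c := c) hs hsu hu x x' w w' k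
      rw [← hw, ← hw'] at e1
      rw [e1]
      have g1 : P r (c k - act (X s u) (c k)) ≤ C * r ^ N := hc s u hs hsu hu k r hr hℓr hrΛ
      have g2 : P r ((x' k - x k - ∑ i, X s u (L i (ev N (g i k) w))) • (1 : H))
          ≤ B * r ^ N * Γ := by
        rw [map_smul_eq_mul, Real.norm_eq_abs]
        refine mul_le_mul ((hxx' k).trans ?_) (hX.one r) (apply_nonneg _ _) (by positivity)
        exact mul_le_mul_of_nonneg_left (pow_le_pow_left₀ hℓ0 hℓr N) hB
      have g3 := hX.sum_cocycle_le hr (y := fun i => ev N (g i k) w'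
          - act (X s u) (ev N (g i k) w - gproj 𝒜 N (ev N (g i k) w)))
        (C := K₁ * (S + r ^ N) + Γ ^ 2 * r ^ N * Ky) fun i => by
        refine (hX.sub_act_sub_top_le hs hsu hu hℓr hr hrΛ (hmap (g i k) (hg i k) r hr hrΛ _
          (hX.scaled s u r hs hsu hu hℓr hr hrΛ) w w' (fun j => (hwA j).trans hAA₃)
          (fun j => (hwA' j).trans hAA₃) (fun n hn τ _ => hM i k n hn _) S hS0 hSr hSk)).trans ?_
        have := hy i k
        gcongr
      have g6 : d * Γ * (K₁ + Γ ^ 2 * Ky) * r * r ^ N ≤ d * Γ * (K₁ + Γ ^ 2 * Ky) * Λ * r ^ N := by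
        gcongr
      refine (map_add_le_add _ _ _).trans ((add_le_add ((map_add_le_add _ _ _).trans
        (add_le_add g1 g2)) g3).trans ?_)
      rw [hb]
      linarith
    have hδ : e * (d * Γ * K₁ * r) ≤ 1 / 2 := by
      refine le_trans ?_ hsmall
      rw [← mul_assoc]
      gcongr
    have := (hSk m).trans (sum_le_of_forall_le_add (fun k => apply_nonneg _ _) hδ hrow)
    have h2 : 0 ≤ A₂ * Λ / r₂ ^ N * r ^ N := by positivity
    nlinarith
  · refine (hfirst m r hr hℓr hrΛ).trans ?_
    have h1 : r₂ ^ N ≤ r ^ N := pow_le_pow_left₀ hr₂.le hrr₂.le N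
    have h2 : 0 < r₂ ^ N := pow_pos hr₂ N
    have h3 : A₂ * r ≤ A₂ * Λ / r₂ ^ N * r ^ N := by
      rw [div_mul_eq_mul_div, le_div_iff₀ h2]
      gcongr
    have h4 : 0 ≤ 2 * e * b * r ^ N := by positivity
    linarith

end Existence

section Flow

theorem HasOrder.mono {H : Type*} [CommRing H] [Algebra ℝ H] {P : ℝ → Seminorm ℝ H} {N : ℕ}
    {ℓ ρ A A' : ℝ} {h : H}
    (hh : HasOrder P N ℓ ρ A h) (hA : A ≤ A') :
    HasOrder P N ℓ ρ A' h := fun r hr h1 h2 =>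
  (hh r hr h1 h2).trans (mul_le_mul_of_nonneg_right hA (pow_nonneg hr.le N))

variable {H : Type*} [CommRing H] [Algebra ℝ H] [Coalgebra ℝ H]
variable {𝒜 : ℕ → Submodule ℝ H} [GradedAlgebra 𝒜] {nrm : Seminorm ℝ H} {N d e : ℕ}
  {L : Fin d → H →ₗ[ℝ] H} {γ T : ℝ} {ω : ℝ → ℝ → ℝ} {X : ℝ → ℝ → Module.Dual ℝ H}
  {P : ℝ → Seminorm ℝ H} {Γ Λ : ℝ} {g : Fin d → Fin e → (Fin e → ℝ) → ℝ} {M : ℝ}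
  {c : Fin e → H}

/-- The equation in terms of Taylor series cut after `N` terms (the cocycles do not see the term of
order `N`) and of real parts. -/
def IsEvSolution (N : ℕ) (T : ℝ) (X : ℝ → ℝ → Module.Dual ℝ H) (L : Fin d → H →ₗ[ℝ] H)
    (g : Fin d → Fin e → (Fin e → ℝ) → ℝ) (c : Fin e → H) (Z : ℝ → Fin e → H) : Prop :=
  ∃ K : Fin d → ℝ → Fin e → ℝ,
    (∀ i, ∀ t ∈ Icc 0 T, HasRRSLimit (fun u v m => X u v (L i (ev N (g i m) (Z u)))) 0 t (K i t)) ∧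
    ∀ t ∈ Icc 0 T, Z t = cocycleMap N L g c (base c + ∑ i, K i t) (Z t)

theorem SewingBound.sum {E : Type*} [NormedAddCommGroup E] {a b K : ℝ} {D : Fin d → ℝ → ℝ → E}
    (h : ∀ i, SewingBound a b ω γ N K (D i)) :
    SewingBound a b ω γ N (d * K) fun s t => ∑ i, D i s t := by
  intro s t ε h1 h2 h3 hε hr
  refine (norm_sum_le _ _).trans ((Finset.sum_le_sum fun i _ =>
    h i s t ε h1 h2 h3 hε hr).trans_eq ?_)
  simp; ring

/-- The bound of the sewing lemma implies the bound `ω(s,t)^((N+1)γ)`. -/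
theorem IsDriver.norm_le_of_sewingBound (hX : IsDriver 𝒜 nrm N L γ T ω X P Γ Λ) {a b K : ℝ}
    (ha : 0 ≤ a) (hb : b ≤ T) {D : ℝ → ℝ → Fin e → ℝ} (h : SewingBound a b ω γ N K D)
    {s t : ℝ} (h1 : a ≤ s) (h2 : s < t) (h3 : t ≤ b) :
    ‖D s t‖ ≤ K * (ω s t ^ γ * (ω s t ^ γ) ^ N) :=
  h s t (ω s t) h1 h2 h3 (hX.control.nonneg s t (ha.trans h1) h2.le (h3.trans hb)) fun _ hr hrt =>
    hX.control.isControlOn.mono (ha.trans h1) le_rfl hr hrt.le (h3.trans hb)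

theorem IsDriver.rpow_self (hX : IsDriver 𝒜 nrm N L γ T ω X P Γ Λ) {t : ℝ}
    (h1 : 0 ≤ t) (h2 : t ≤ T) : ω t t ^ γ = 0 := by
  rw [hX.control.diag t h1 h2, Real.zero_rpow hX.exponent_pos.ne']

theorem IsDriver.pairing_cocycle_self (hX : IsDriver 𝒜 nrm N L γ T ω X P Γ Λ) {t : ℝ}
    (h1 : 0 ≤ t) (h2 : t ≤ T) (i : Fin d) (h : H) :
    X t t (L i h) = 0 := by
  have := hX.pairing_cocycle_le h1 le_rfl h2 i h
  rw [hX.rpow_self h1 h2, mul_zero] at this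
  exact abs_nonpos_iff.1 this

/-- The equation follows an almost flow on the real parts. -/
theorem IsDriver.exists_isAlmostFlow [Module.Finite ℝ H]
    (hX : IsDriver 𝒜 nrm N L γ T ω X P Γ Λ)
    (hg : ∀ i m, ContDiff ℝ N (g i m)) (hM0 : 0 ≤ M)
    (hM : ∀ i m, ∀ n ≤ N, ∀ z, ‖iteratedFDeriv ℝ n (g i m) z‖ ≤ M) {A C : ℝ} (hA : 0 ≤ A)
    (hC : 0 ≤ C) (hc : ∀ s u, 0 ≤ s → s ≤ u → u ≤ T → ∀ m,
      HasOrder P N (ω s u ^ γ) Λ C (c m - act (X s u) (c m)))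
    {F : (Fin e → ℝ) → Fin e → H} (hF : ∀ x, F x = cocycleMap N L g c x (F x))
    (hFA : ∀ x m, P 1 (bar (F x m)) ≤ A) :
    ∃ K : ℝ, 0 ≤ K ∧ IsAlmostFlow 0 T ω γ N K
      fun s t x m => ∑ i, X s t (L i (ev N (g i m) (F x))) := by
  have hΓ := zero_le_one.trans hX.one_le
  obtain ⟨K₁, hK₁, hord⟩ := hX.exists_fixed_order hg hM0 hM hA zero_le_one hC hc
  obtain ⟨K₂, hK₂, hev⟩ := hX.exists_ev_order hM0 (add_nonneg hA hK₁) e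
  have hAK : A ≤ A + K₁ := le_add_of_nonneg_right hK₁
  have hy : ∀ s u, 0 ≤ s → s ≤ u → u ≤ T → ∀ x x',
      (∀ m, |x' m - x m - ∑ i, X s u (L i (ev N (g i m) (F x)))| ≤ 1 * (ω s u ^ γ) ^ N) →
      ∀ i m, P 1 (ev N (g i m) (F x)) ≤ K₂ ∧
        HasOrder P N (ω s u ^ γ) Λ K₂ (ev N (g i m) (F x') - act (X s u) (ev N (g i m) (F x))) := by
    intro s u hs hsu hu x x' hxx' i m
    exact hev _ (hg i m) (hM i m) s u hs hsu hu (F x) (F x') (fun j => (hFA x j).trans hAK)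
      (fun j => (hFA x' j).trans hAK) fun j => (hord s u hs hsu hu x x' (F x) (F x') (hF x) (hF x')
        (hFA x) (hFA x') hxx' j).mono (le_add_of_nonneg_left hA)
  obtain ⟨K₃, hK₃, hev₁⟩ := hX.ev_le hA hM0 N (Fin e)
  set B₁ := Γ ^ 3 * K₃ with hB₁
  set B₂ := Γ ^ 2 * (1 + Γ ^ 2) * K₂ with hB₂
  have hB₁0 : 0 ≤ B₁ := by positivity
  have hB₂0 : 0 ≤ B₂ := by positivity
  refine ⟨d * (B₁ + B₂), by positivity, fun s t x h1 h2 h3 => ?_,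
    fun s u t x x' h1 h2 h3 h4 hxx' => ?_⟩
  · have hℓ := hX.rpow_nonneg h1 h2 h3
    refine (pi_norm_le_iff_of_nonneg (by positivity)).2 fun m => ?_
    refine (norm_sum_le _ _).trans ((Finset.sum_le_sum fun i _ =>
      (?_ : _ ≤ (B₁ + B₂) * ω s t ^ γ)).trans_eq ?_)
    · rw [Real.norm_eq_abs]
      refine (hX.pairing_cocycle_le h1 h2 h3 i _).trans ?_
      refine mul_le_mul_of_nonneg_right ?_ hℓ
      have h5 := hev₁ _ (hg i m) 1 one_pos hX.one_le_range (F x) (hFA x)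
        fun n hn => hM i m n hn.le _
      have h6 : Γ ^ 3 * P 1 (ev N (g i m) (F x)) ≤ B₁ :=
        mul_le_mul_of_nonneg_left h5 (by positivity)
      linarith
    · simp; ring
  · have hℓ := hX.rpow_nonneg h1 h2 (h3.trans h4)
    have hℓ' := hX.rpow_nonneg h1 (h2.trans h3) h4
    refine (pi_norm_le_iff_of_nonneg (by positivity)).2 fun m => ?_
    have hcomp : ∀ m, |x' m - x m - ∑ i, X s u (L i (ev N (g i m) (F x)))|
        ≤ 1 * (ω s u ^ γ) ^ N := fun m => by
      rw [one_mul]; exact (norm_le_pi_norm _ m).trans hxx'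
    have e1 : ∀ f₁ f₂ f₃ : Fin d → ℝ, ∑ i, f₁ i - ∑ i, f₂ i - ∑ i, f₃ i
        = ∑ i, (f₁ i - f₂ i - f₃ i) := by simp [Finset.sum_sub_distrib]
    simp only [Pi.sub_apply]
    rw [e1]
    refine (norm_sum_le _ _).trans ((Finset.sum_le_sum fun i _ =>
      (?_ : _ ≤ (B₁ + B₂) * (ω s u ^ γ * (ω s t ^ γ) ^ N))).trans_eq ?_)
    · obtain ⟨g1, g2⟩ := hy s u h1 h2 (h3.trans h4) x x' hcomp i m
      rw [Real.norm_eq_abs]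
      refine (hX.defect_le h1 h2 h3 h4 (hX.rpow_lt s u h1 h2 (h3.trans h4)) le_rfl g1 g2 i).trans ?_
      exact mul_le_mul_of_nonneg_right (le_add_of_nonneg_left hB₁0) (by positivity)
    · simp; ring

theorem IsDriver.continuous_flow [Module.Finite ℝ H]
    (hX : IsDriver 𝒜 nrm N L γ T ω X P Γ Λ)
    (hg : ∀ i m, ContDiff ℝ N (g i m)) (hM0 : 0 ≤ M)
    (hM : ∀ i m, ∀ n ≤ N, ∀ z, ‖iteratedFDeriv ℝ n (g i m) z‖ ≤ M) {A K : ℝ} (hA : 0 ≤ A)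
    (hK : 0 ≤ K) {F : (Fin e → ℝ) → Fin e → H} (hFA : ∀ x m, P 1 (bar (F x m)) ≤ A)
    (hFK : ∀ x x' m, P 1 (F x' m - F x m) ≤ K * ‖x' - x‖) {s t : ℝ} (h1 : 0 ≤ s) (h2 : s ≤ t)
    (h3 : t ≤ T) : Continuous fun (x : Fin e → ℝ) m => ∑ i, X s t (L i (ev N (g i m) (F x))) := by
  have hΓ := zero_le_one.trans hX.one_le
  obtain ⟨K₁, hK₁, hev⟩ := hX.ev_sub_le hA hM0 hX.one_le_order (Fin e)
  have hℓ := hX.rpow_nonneg h1 h2 h3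
  refine continuous_pi fun m => continuous_finsetSum _ fun i _ => ?_
  refine (LipschitzWith.of_dist_le' (K := Γ ^ 3 * (K₁ * K) * ω s t ^ γ) fun x' x => ?_).continuous
  rw [Real.dist_eq, ← map_sub, ← map_sub, dist_eq_norm]
  refine (hX.pairing_cocycle_le h1 h2 h3 i _).trans ?_
  have := hev (g i m) (hg i m) 1 one_pos hX.one_le_range (F x) (F x') (hFA x) (hFA x')
    (fun n hn τ _ => hM i m n hn _) (K * ‖x' - x‖) (by positivity) (hFK x x')
  calc _ ≤ Γ ^ 3 * (K₁ * (K * ‖x' - x‖)) * ω s t ^ γ := by gcongr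
    _ = _ := by ring

/-- The solution is `F z`, with `z` a path which follows the almost flow
`x ↦ x + ∑ i, X s t (L i (g i (F x)))`. -/
theorem IsDriver.exists_evSolution [Module.Finite ℝ H]
    (hX : IsDriver 𝒜 nrm N L γ T ω X P Γ Λ) (hT : 0 ≤ T)
    (hg : ∀ i m, ContDiff ℝ N (g i m)) (hM0 : 0 ≤ M)
    (hM : ∀ i m, ∀ n ≤ N, ∀ z, ‖iteratedFDeriv ℝ n (g i m) z‖ ≤ M) {C : ℝ}
    (hC : 0 ≤ C) (hc : ∀ s u, 0 ≤ s → s ≤ u → u ≤ T → ∀ m,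
      HasOrder P N (ω s u ^ γ) Λ C (c m - act (X s u) (c m))) :
    ∃ Z : ℝ → Fin e → H, IsEvSolution N T X L g c Z ∧ ∃ A : ℝ, 0 ≤ A ∧
      ∀ s u, 0 ≤ s → s ≤ u → u ≤ T → ∀ m,
        HasOrder P N (ω s u ^ γ) Λ A (Z u m - act (X s u) (Z s m)) := by
  obtain ⟨F, A, KF, hA, hKF, hF, hFA, hFK⟩ := hX.exists_section hg hM0 hM c
  have hF' : ∀ x, F x = cocycleMap N L g c x (F x) := fun x => (hF x _).2 rfl
  obtain ⟨K, hK, hflow⟩ := hX.exists_isAlmostFlow hg hM0 hM hA hC hc hF' hFA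
  obtain ⟨K', hK', hpath⟩ := exists_path_of_isAlmostFlow (E := Fin e → ℝ) (N := N)
    hX.exponent_pos hX.one_lt_mul hK (hX.control.nonneg 0 T le_rfl hT le_rfl)
  obtain ⟨z, hz0, hz⟩ := hpath 0 T ω hX.control.isControlOn hT le_rfl _ hflow
    (fun s t h1 h2 h3 => hX.continuous_flow hg hM0 hM hA hKF hFA hFK h1 h2 h3) (base c)
  have hΛ0 := zero_le_one.trans hX.one_le_range
  obtain ⟨K₁, hK₁, hord⟩ := hX.exists_fixed_order hg hM0 hM hA (mul_nonneg hK' hΛ0) hC hc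
  have hZ : ∀ s u, 0 ≤ s → s ≤ u → u ≤ T → ∀ m,
      HasOrder P N (ω s u ^ γ) Λ K₁ (F (z u) m - act (X s u) (F (z s) m)) := by
    intro s u h1 h2 h3
    refine hord s u h1 h2 h3 (z s) (z u) _ _ (hF' _) (hF' _) (hFA _) (hFA _) fun m => ?_
    have hℓ := hX.rpow_nonneg h1 h2 h3
    rcases h2.eq_or_lt with rfl | h2'
    · rw [Finset.sum_eq_zero fun i _ => hX.pairing_cocycle_self h1 h3 i _]
      simp; positivity
    · have e1 := hX.norm_le_of_sewingBound le_rfl le_rfl hz h1 h2' h3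
      have e2 := (norm_le_pi_norm _ m).trans e1
      refine e2.trans ?_
      rw [mul_assoc]
      have := (hX.rpow_lt s u h1 h2 h3).le
      gcongr
  obtain ⟨K₂, hK₂, hev⟩ := hX.exists_ev_order hM0 (add_nonneg hA hK₁) e
  have hAK : A ≤ A + K₁ := le_add_of_nonneg_right hK₁
  have hY : ∀ i m s u, 0 ≤ s → s ≤ u → u ≤ T → P 1 (ev N (g i m) (F (z s))) ≤ K₂ ∧
      HasOrder P N (ω s u ^ γ) Λ K₂
        (ev N (g i m) (F (z u)) - act (X s u) (ev N (g i m) (F (z s)))) :=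
    fun i m s u h1 h2 h3 => hev _ (hg i m) (hM i m) s u h1 h2 h3 _ _
      (fun j => (hFA _ j).trans hAK) (fun j => (hFA _ j).trans hAK)
      fun j => (hZ s u h1 h2 h3 j).mono (le_add_of_nonneg_left hA)
  obtain ⟨K₃, hK₃, hint⟩ := hX.exists_integral hT e
  have hG := fun i => hint 0 T le_rfl hT le_rfl Λ (hX.rpow_lt 0 T le_rfl hT le_rfl) le_rfl K₂ hK₂
    (fun s m => ev N (g i m) (F (z s))) (fun s h1 h2 m => (hY i m s s h1 le_rfl h2).1)
    (fun s u h1 h2 h3 m => (hY i m s u h1 h2 h3).2) i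
  choose G hG using hG
  have hsum := SewingBound.sum hG
  refine ⟨fun t => F (z t), ⟨fun i t => G i t - G i 0, fun i t ht => ?_, fun t ht => ?_⟩,
    K₁, hK₁, hZ⟩
  · exact hX.hasRRSLimit le_rfl le_rfl (by positivity) (hG i) le_rfl ht.1 ht.2
  · -- the increments of `z` and the sum of the integrals are limits of the same Riemann sums
    have l1 := hX.hasRRSLimit le_rfl le_rfl hK' hz le_rfl ht.1 ht.2
    have l2 := hX.hasRRSLimit (G := fun t => ∑ i, G i t)
      (Ξ := fun s t m => ∑ i, X s t (L i (ev N (g i m) (F (z s))))) le_rfl le_rfl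
      (by positivity) (a := 0) (b := T) (K := d * (K₃ * K₂)) ?_ le_rfl ht.1 ht.2
    · have e1 := l1.unique l2
      have e2 : base c + ∑ i, (G i t - G i 0) = z t := by
        rw [Finset.sum_sub_distrib, ← e1, hz0, add_sub_cancel]
      rw [e2]
      exact hF' _
    · convert hsum using 3 with s t
      rw [Finset.sum_sub_distrib, Finset.sum_sub_distrib]
      congr 1
      ext m
      rw [Finset.sum_apply]

end Flow

/-! ### Uniqueness -/

section Uniqueness

variable {H : Type*} [CommRing H] [Algebra ℝ H] [Coalgebra ℝ H]
variable {𝒜 : ℕ → Submodule ℝ H} [GradedAlgebra 𝒜] {nrm : Seminorm ℝ H} {N d e : ℕ}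
  {L : Fin d → H →ₗ[ℝ] H} {γ T : ℝ} {ω : ℝ → ℝ → ℝ} {X : ℝ → ℝ → Module.Dual ℝ H}
  {P : ℝ → Seminorm ℝ H} {Γ Λ : ℝ} {g : Fin d → Fin e → (Fin e → ℝ) → ℝ} {M : ℝ}
  {c : Fin e → H}

theorem exists_iteratedFDeriv_bound {k : ℕ} (hg : ∀ i m, ContDiff ℝ k (g i m)) (A : ℝ) :
    ∃ M : ℝ, 0 ≤ M ∧ ∀ i m, ∀ x ∈ Metric.closedBall (0 : Fin e → ℝ) A, ∀ n ≤ k,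
      ‖iteratedFDeriv ℝ n (g i m) x‖ ≤ M := by
  have h : ∀ (i : Fin d) (m : Fin e) (n : Fin (k + 1)), ∃ M : ℝ,
      ∀ x ∈ Metric.closedBall (0 : Fin e → ℝ) A, ‖iteratedFDeriv ℝ n (g i m) x‖ ≤ M := by
    intro i m n
    have hc : Continuous (iteratedFDeriv ℝ n (g i m)) :=
      (hg i m).continuous_iteratedFDeriv (by exact_mod_cast Nat.lt_succ_iff.1 n.2)
    exact (isCompact_closedBall _ _).exists_bound_of_continuousOn hc.continuousOn
  choose M hM using h
  refine ⟨∑ i, ∑ m, ∑ n, |M i m n|, by positivity, fun i m x hx n hn => ?_⟩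
  refine (hM i m ⟨n, Nat.lt_succ_of_le hn⟩ x hx).trans ((le_abs_self _).trans ?_)
  refine (Finset.single_le_sum (f := fun n => |M i m n|) (fun _ _ => abs_nonneg _)
    (Finset.mem_univ _)).trans ?_
  refine (Finset.single_le_sum (f := fun m => ∑ n, |M i m n|) (fun _ _ => by positivity)
    (Finset.mem_univ _)).trans ?_
  exact Finset.single_le_sum (f := fun i => ∑ m, ∑ n, |M i m n|) (fun _ _ => by positivity)
    (Finset.mem_univ _)

/-- The difference of the images of two controlled paths is controlled in a Lipschitz way. -/
theorem IsDriver.exists_ev_diff_order [Module.Finite ℝ H]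
    (hX : IsDriver 𝒜 nrm N L γ T ω X P Γ Λ) (hg : ∀ i m, ContDiff ℝ (N + 1 : ℕ) (g i m))
    {A : ℝ} (hA : 0 ≤ A) :
    ∃ K : ℝ, 0 < K ∧ ∀ i m s u ρ, 0 ≤ s → s ≤ u → u ≤ T → ρ ≤ Λ → ∀ w w' y y' : Fin e → H,
      (∀ j, P 1 (bar (w j)) ≤ A) → (∀ j, P 1 (bar (w' j)) ≤ A) →
      (∀ j, P 1 (bar (y j)) ≤ A) → (∀ j, P 1 (bar (y' j)) ≤ A) →
      ‖base w‖ ≤ A → ‖base w'‖ ≤ A → ‖base y‖ ≤ A → ‖base y'‖ ≤ A →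
      (∀ j, HasOrder P N (ω s u ^ γ) ρ A (w' j - act (X s u) (w j))) →
      (∀ j, HasOrder P N (ω s u ^ γ) ρ A (y' j - act (X s u) (y j))) →
      ∀ κ, 0 ≤ κ → (∀ j, P 1 (w j - y j) ≤ κ) → (∀ j, P 1 (w' j - y' j) ≤ κ) →
      (∀ j, HasOrder P N (ω s u ^ γ) ρ κ
        ((w' j - act (X s u) (w j)) - (y' j - act (X s u) (y j)))) →
      P 1 (ev N (g i m) w - ev N (g i m) y) ≤ K * κ ∧
      HasOrder P N (ω s u ^ γ) ρ (K * κ) ((ev N (g i m) w' - ev N (g i m) y')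
        - act (X s u) (ev N (g i m) w - ev N (g i m) y)) := by
  obtain ⟨M, hM0, hM⟩ := exists_iteratedFDeriv_bound hg A
  obtain ⟨K₁, hK₁, h1⟩ := hX.ev_sub_le hA hM0 hX.one_le_order (Fin e)
  obtain ⟨K₂, hK₂, h2⟩ := hX.ev_defect_sub_le hA hM0 hX.one_le_order (Fin e)
  refine ⟨1 + K₁ + K₂, by positivity, fun i m s u ρ hs hsu hu hρ w w' y y' hw hw' hy hy' bw bw' bY
    bY' ow oy κ hκ k1 k2 k3 => ⟨?_, fun r hr hℓr hrρ => ?_⟩⟩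
  · refine (h1 (g i m) ((hg i m).of_le (by exact_mod_cast Nat.le_succ N)) 1 one_pos
      hX.one_le_range y w hy hw (fun n hn τ hτ => ?_) κ hκ k1).trans ?_
    · refine hM i m _ ?_ n (hn.trans (Nat.le_succ N))
      exact (convex_closedBall (0 : Fin e → ℝ) A).add_smul_sub_mem (mem_closedBall_zero_iff.2 bY)
        (mem_closedBall_zero_iff.2 bw) hτ
    · exact mul_le_mul_of_nonneg_right (by linarith) hκ
  · have e1 : (ev N (g i m) w' - ev N (g i m) y') - act (X s u) (ev N (g i m) w - ev N (g i m) y)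
        = (ev N (g i m) w' - act (X s u) (ev N (g i m) w))
          - (ev N (g i m) y' - act (X s u) (ev N (g i m) y)) := by rw [map_sub]; abel
    rw [e1]
    refine (h2 (g i m) (hg i m) r hr (hrρ.trans hρ) _
      (hX.scaled s u r hs hsu hu hℓr hr (hrρ.trans hρ)) w w' y y' hw hw' hy hy'
      (Metric.closedBall 0 A) (convex_closedBall _ _) (hM i m) (mem_closedBall_zero_iff.2 bw)
      (mem_closedBall_zero_iff.2 bw') (mem_closedBall_zero_iff.2 bY)
      (mem_closedBall_zero_iff.2 bY') (fun j => ow j r hr hℓr hrρ) (fun j => oy j r hr hℓr hrρ) κ hκ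
      k1 k2 fun j => k3 j r hr hℓr hrρ).trans ?_
    have : 0 ≤ κ * r ^ N := by positivity
    rw [mul_assoc]
    exact mul_le_mul_of_nonneg_right (by linarith) this

/-- A controlled solution `Z` with real part `z` and rough integrals `G i`, together with the bounds
that enter the comparison of two solutions. -/
structure IsSewnSolution (N : ℕ) (γ T : ℝ) (ω : ℝ → ℝ → ℝ) (X : ℝ → ℝ → Module.Dual ℝ H)
    (P : ℝ → Seminorm ℝ H) (Λ : ℝ) (L : Fin d → H →ₗ[ℝ] H)
    (g : Fin d → Fin e → (Fin e → ℝ) → ℝ) (c : Fin e → H) (A K : ℝ) (Z : ℝ → Fin e → H)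
    (z : ℝ → Fin e → ℝ) (G : Fin d → ℝ → Fin e → ℝ) : Prop where
  fixed : ∀ t ∈ Icc 0 T, Z t = cocycleMap N L g c (z t) (Z t)
  bar_le : ∀ t ∈ Icc 0 T, ∀ m, P 1 (bar (Z t m)) ≤ A
  base_le : ∀ t ∈ Icc 0 T, ‖base (Z t)‖ ≤ A
  order : ∀ s u, 0 ≤ s → s ≤ u → u ≤ T → ∀ m,
    HasOrder P N (ω s u ^ γ) Λ A (Z u m - act (X s u) (Z s m))
  sewing : ∀ i, SewingBound 0 T ω γ N K
    fun s t => G i t - G i s - fun m => X s t (L i (ev N (g i m) (Z s)))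
  incr : ∀ t ∈ Icc 0 T, z t = z 0 + ∑ i, (G i t - G i 0)

theorem IsSewnSolution.mono {A A' K : ℝ} {Z : ℝ → Fin e → H} {z : ℝ → Fin e → ℝ}
    {G : Fin d → ℝ → Fin e → ℝ} (h : IsSewnSolution N γ T ω X P Λ L g c A K Z z G) (hA : A ≤ A') :
    IsSewnSolution N γ T ω X P Λ L g c A' K Z z G :=
  ⟨h.fixed, fun t ht m => (h.bar_le t ht m).trans hA, fun t ht => (h.base_le t ht).trans hA,
    fun s u h1 h2 h3 m => (h.order s u h1 h2 h3 m).mono hA, h.sewing, h.incr⟩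

theorem IsDriver.base_eq (hX : IsDriver 𝒜 nrm N L γ T ω X P Γ Λ) {x : Fin e → ℝ} {w : Fin e → H}
    (hw : w = cocycleMap N L g c x w) : base w = x := by
  ext m
  conv_lhs => rw [hw]
  exact hX.counit_cocycleMap w m

/-- Every controlled solution satisfies the sewing bound: its integrals are limits of Riemann sums,
hence coincide with the paths obtained by sewing. -/
theorem IsDriver.exists_isSewnSolution [Module.Finite ℝ H]
    (hX : IsDriver 𝒜 nrm N L γ T ω X P Γ Λ) (hT : 0 ≤ T)
    (hg : ∀ i m, ContDiff ℝ N (g i m)) (hM0 : 0 ≤ M)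
    (hM : ∀ i m, ∀ n ≤ N, ∀ z, ‖iteratedFDeriv ℝ n (g i m) z‖ ≤ M) {Z : ℝ → Fin e → H} {A : ℝ}
    (hA : 0 ≤ A) (hZ : ∀ s u, 0 ≤ s → s ≤ u → u ≤ T → ∀ m,
      HasOrder P N (ω s u ^ γ) Λ A (Z u m - act (X s u) (Z s m)))
    (hsol : IsEvSolution N T X L g c Z) :
    ∃ A' K z G, 0 ≤ A' ∧ 0 ≤ K ∧ IsSewnSolution N γ T ω X P Λ L g c A' K Z z G := by
  have hΓ := zero_le_one.trans hX.one_le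
  have hΛ0 : 0 < Λ := one_pos.trans_le hX.one_le_range
  obtain ⟨I, hI, hfix⟩ := hsol
  obtain ⟨F, AF, KF, hAF, hKF, hF, hFA, hFK⟩ := hX.exists_section hg hM0 hM c
  have hZF : ∀ t ∈ Icc 0 T, Z t = F (base c + ∑ i, I i t) := fun t ht => (hF _ _).1 (hfix t ht)
  have hbar : ∀ t ∈ Icc 0 T, ∀ m, P 1 (bar (Z t m)) ≤ AF := fun t ht m => by
    rw [hZF t ht]; exact hFA _ _
  set p := ∑ m, P Λ (Z 0 m) with hp
  have hp0 : 0 ≤ p := Finset.sum_nonneg fun m _ => apply_nonneg _ _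
  have hbase : ∀ t ∈ Icc 0 T, ‖base (Z t)‖ ≤ Γ * (A * Λ ^ N + Γ * p) := by
    intro t ht
    refine (pi_norm_le_iff_of_nonneg (by positivity)).2 fun m => ?_
    have h1 := hZ 0 t le_rfl ht.1 ht.2 m Λ hΛ0 (hX.rpow_lt 0 t le_rfl ht.1 ht.2).le le_rfl
    have h2 := (hX.scaled 0 t Λ le_rfl ht.1 ht.2 (hX.rpow_lt 0 t le_rfl ht.1 ht.2).le hΛ0
      le_rfl).bound (Z 0 m)
    have h3 : P Λ (Z 0 m) ≤ p := Finset.single_le_sum (f := fun m => P Λ (Z 0 m))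
      (fun m _ => apply_nonneg _ _) (Finset.mem_univ m)
    refine (hX.counit Λ (Z t m)).trans (mul_le_mul_of_nonneg_left ?_ hΓ)
    have h4 := map_add_le_add (P Λ) (Z t m - act (X 0 t) (Z 0 m)) (act (X 0 t) (Z 0 m))
    rw [sub_add_cancel] at h4
    have h5 := mul_le_mul_of_nonneg_left h3 hΓ
    linarith
  have hb0 : 0 ≤ Γ * (A * Λ ^ N + Γ * p) := by positivity
  obtain ⟨K₂, hK₂, hev⟩ := hX.exists_ev_order hM0 (add_nonneg hAF hA) e
  have hAFA : AF ≤ AF + A := le_add_of_nonneg_right hA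
  have hY : ∀ i m s u, 0 ≤ s → s ≤ u → u ≤ T → P 1 (ev N (g i m) (Z s)) ≤ K₂ ∧
      HasOrder P N (ω s u ^ γ) Λ K₂ (ev N (g i m) (Z u) - act (X s u) (ev N (g i m) (Z s))) :=
    fun i m s u h1 h2 h3 => hev _ (hg i m) (hM i m) s u h1 h2 h3 _ _
      (fun j => (hbar s ⟨h1, h2.trans h3⟩ j).trans hAFA)
      (fun j => (hbar u ⟨h1.trans h2, h3⟩ j).trans hAFA)
      fun j => (hZ s u h1 h2 h3 j).mono (le_add_of_nonneg_left hAF)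
  obtain ⟨K₃, hK₃, hint⟩ := hX.exists_integral hT e
  have hG := fun i => hint 0 T le_rfl hT le_rfl Λ (hX.rpow_lt 0 T le_rfl hT le_rfl) le_rfl K₂ hK₂
    (fun s m => ev N (g i m) (Z s)) (fun s h1 h2 m => (hY i m s s h1 le_rfl h2).1)
    (fun s u h1 h2 h3 m => (hY i m s u h1 h2 h3).2) i
  choose G hG using hG
  have hGI : ∀ t ∈ Icc 0 T, ∀ i, I i t = G i t - G i 0 := fun t ht i =>
    (hI i t ht).unique (hX.hasRRSLimit le_rfl le_rfl (by positivity) (hG i) le_rfl ht.1 ht.2)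
  refine ⟨AF + Γ * (A * Λ ^ N + Γ * p) + A, K₃ * K₂, fun t => base c + ∑ i, I i t, G,
    by positivity, by positivity, hfix, fun t ht m => (hbar t ht m).trans (by linarith),
    fun t ht => (hbase t ht).trans (by linarith),
    fun s u h1 h2 h3 m => (hZ s u h1 h2 h3 m).mono (by linarith), hG, fun t ht => ?_⟩
  have e1 : ∑ i, I i 0 = 0 := Finset.sum_eq_zero fun i _ => by
    rw [hGI 0 ⟨le_rfl, hT⟩, sub_self]
  simp only [e1, add_zero, hGI t ht]

/-- Two solutions which agree at `a` and are at distance `κ` on a small interval `[a, b]`, in the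
norm of controlled paths, are at distance `κ / 2`. -/
theorem IsDriver.halving [Module.Finite ℝ H] (hX : IsDriver 𝒜 nrm N L γ T ω X P Γ Λ) (hT : 0 ≤ T)
    (hg : ∀ i m, ContDiff ℝ (N + 1 : ℕ) (g i m)) (hM0 : 0 ≤ M)
    (hM : ∀ i m, ∀ n ≤ N, ∀ z, ‖iteratedFDeriv ℝ n (g i m) z‖ ≤ M) {A K K' : ℝ} (hA : 0 ≤ A)
    (hK : 0 ≤ K) (hK' : 0 ≤ K')
    {Z Z' : ℝ → Fin e → H} {z z' : ℝ → Fin e → ℝ} {G G' : Fin d → ℝ → Fin e → ℝ}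
    (hZ : IsSewnSolution N γ T ω X P Λ L g c A K Z z G)
    (hZ' : IsSewnSolution N γ T ω X P Λ L g c A K' Z' z' G') :
    ∃ ρ : ℝ, 0 < ρ ∧ ρ ≤ Λ ∧ ∀ a b, 0 ≤ a → a ≤ b → b ≤ T → ω a b ^ γ < ρ → Z a = Z' a →
      ∀ κ, 0 < κ →
      ((∀ s, a ≤ s → s ≤ b → ∀ m, P 1 (Z s m - Z' s m) ≤ κ) ∧
        ∀ s u, a ≤ s → s ≤ u → u ≤ b → ∀ m, HasOrder P N (ω s u ^ γ) ρ κ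
          ((Z u m - act (X s u) (Z s m)) - (Z' u m - act (X s u) (Z' s m)))) →
      (∀ s, a ≤ s → s ≤ b → ∀ m, P 1 (Z s m - Z' s m) ≤ κ / 2) ∧
        ∀ s u, a ≤ s → s ≤ u → u ≤ b → ∀ m, HasOrder P N (ω s u ^ γ) ρ (κ / 2)
          ((Z u m - act (X s u) (Z s m)) - (Z' u m - act (X s u) (Z' s m))) := by
  have hΓ := zero_le_one.trans hX.one_le
  have hΛ0 := zero_le_one.trans hX.one_le_range
  have hgN : ∀ i m, ContDiff ℝ N (g i m) := fun i m =>
    (hg i m).of_le (by exact_mod_cast Nat.le_succ N)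
  obtain ⟨F, AF, KF, hAF, hKF, hF, hFA, hFK⟩ := hX.exists_section hgN hM0 hM c
  obtain ⟨K₁, hK₁, hdiff⟩ := hX.exists_ev_diff_order hg hA
  obtain ⟨K₃, hK₃, hint⟩ := hX.exists_integral hT e
  set E := d * (K₃ * K₁) with hE
  have hE0 : 0 ≤ E := by positivity
  obtain ⟨ρ, hρ, hρ1, hsmall⟩ := exists_small
    (c := Γ * E + d * Γ * (K₁ + Γ ^ 2 * K₁) + KF * E * Λ ^ N) (by positivity)
  have hρΛ := hρ1.trans hX.one_le_range
  refine ⟨ρ, hρ, hρΛ, fun a b ha hab hb hωρ haZ κ hκ ⟨h1, h2⟩ => ?_⟩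
  let Y : Fin d → ℝ → Fin e → H := fun i s m => ev N (g i m) (Z s) - ev N (g i m) (Z' s)
  have hY : ∀ i m s u, a ≤ s → s ≤ u → u ≤ b → P 1 (Y i s m) ≤ K₁ * κ ∧
      HasOrder P N (ω s u ^ γ) ρ (K₁ * κ) (Y i u m - act (X s u) (Y i s m)) := by
    intro i m s u has hsu hub
    have hs : s ∈ Icc 0 T := ⟨ha.trans has, hsu.trans (hub.trans hb)⟩
    have hu : u ∈ Icc 0 T := ⟨hs.1.trans hsu, hub.trans hb⟩
    exact hdiff i m s u ρ hs.1 hsu hu.2 hρΛ (Z s) (Z u) (Z' s) (Z' u) (hZ.bar_le s hs)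
      (hZ.bar_le u hu) (hZ'.bar_le s hs) (hZ'.bar_le u hu) (hZ.base_le s hs) (hZ.base_le u hu)
      (hZ'.base_le s hs) (hZ'.base_le u hu)
      (fun j r hr h3 h4 => hZ.order s u hs.1 hsu hu.2 j r hr h3 (h4.trans hρΛ))
      (fun j r hr h3 h4 => hZ'.order s u hs.1 hsu hu.2 j r hr h3 (h4.trans hρΛ)) κ hκ.le
      (h1 s has (hsu.trans hub)) (h1 u (has.trans hsu) hub) (h2 s u has hsu hub)
  have hI := fun i => hint a b ha hab hb ρ hωρ hρΛ (K₁ * κ) (by positivity) (Y i)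
    (fun s h3 h4 m => (hY i m s s h3 le_rfl h4).1) (fun s u h3 h4 h5 m => (hY i m s u h3 h4 h5).2) i
  choose I hI using hI
  -- the integrals of the difference are the differences of the integrals
  have hIG : ∀ i s u, a ≤ s → s ≤ u → u ≤ b →
      I i u - I i s = (G i u - G i s) - (G' i u - G' i s) := by
    intro i s u h3 h4 h5
    have l1 := hX.hasRRSLimit ha hb (by positivity) (hI i) h3 h4 h5
    have hsew : SewingBound 0 T ω γ N (K + K') fun s t => (G i t - G' i t) - (G i s - G' i s)
        - fun m => X s t (L i (Y i s m)) := by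
      intro s t ε k1 k2 k3 hε k4
      have e1 : ((G i t - G' i t) - (G i s - G' i s) - fun m => X s t (L i (Y i s m)))
          = (G i t - G i s - fun m => X s t (L i (ev N (g i m) (Z s))))
            - (G' i t - G' i s - fun m => X s t (L i (ev N (g i m) (Z' s)))) := by
        ext m
        simp only [Y, Pi.sub_apply, map_sub]; ring
      simp only [e1]
      refine (norm_sub_le _ _).trans ((add_le_add (hZ.sewing i s t ε k1 k2 k3 hε k4)
        (hZ'.sewing i s t ε k1 k2 k3 hε k4)).trans_eq ?_)
      ring
    have l2 := hX.hasRRSLimit (G := fun t => G i t - G' i t) le_rfl le_rfl (by positivity) hsew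
      (ha.trans h3) h4 (h5.trans hb)
    rw [l1.unique l2]
    abel
  -- the defect of the real parts
  have hδ : ∀ s u, a ≤ s → s ≤ u → u ≤ b → ∀ m,
      |(z u m - z s m - ∑ i, X s u (L i (ev N (g i m) (Z s))))
        - (z' u m - z' s m - ∑ i, X s u (L i (ev N (g i m) (Z' s))))|
      ≤ E * κ * (ω s u ^ γ * (ω s u ^ γ) ^ N) := by
    intro s u has hsu hub m
    have hs : s ∈ Icc 0 T := ⟨ha.trans has, hsu.trans (hub.trans hb)⟩
    have hu : u ∈ Icc 0 T := ⟨hs.1.trans hsu, hub.trans hb⟩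
    have e1 : (z u m - z s m - ∑ i, X s u (L i (ev N (g i m) (Z s))))
        - (z' u m - z' s m - ∑ i, X s u (L i (ev N (g i m) (Z' s))))
        = ∑ i, (I i u - I i s - fun m => X s u (L i (Y i s m))) m := by
      have e2 : ∀ i, (I i u - I i s - fun m => X s u (L i (Y i s m))) m
          = ((G i u m - G i s m) - (G' i u m - G' i s m))
            - (X s u (L i (ev N (g i m) (Z s))) - X s u (L i (ev N (g i m) (Z' s)))) := by
        intro i
        rw [hIG i s u has hsu hub]
        simp only [Y, Pi.sub_apply, map_sub]
      simp only [e2, Finset.sum_sub_distrib]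
      rw [hZ.incr u hu, hZ.incr s hs, hZ'.incr u hu, hZ'.incr s hs]
      simp only [Pi.add_apply, Finset.sum_apply, Pi.sub_apply, Finset.sum_sub_distrib]
      ring
    rw [e1]
    rcases hsu.eq_or_lt with rfl | hlt
    · have hz0 := hX.rpow_nonneg hs.1 le_rfl hs.2
      rw [Finset.sum_eq_zero, abs_zero]
      · positivity
      · intro i _
        simp [hX.pairing_cocycle_self hs.1 hs.2]
    · refine (norm_sum_le _ _).trans ((Finset.sum_le_sum fun i _ => (norm_le_pi_norm _ m).trans
        (hX.norm_le_of_sewingBound ha hb (hI i) has hlt hub)).trans_eq ?_)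
      simp [hE]; ring
  refine ⟨fun s has hsb m => ?_, fun s u has hsu hub m r hr hℓr hrρ => ?_⟩
  · have hs : s ∈ Icc 0 T := ⟨ha.trans has, hsb.trans hb⟩
    have ha' : a ∈ Icc 0 T := ⟨ha, hab.trans hb⟩
    have hza : z a = z' a := by
      rw [← hX.base_eq (hZ.fixed a ha'), ← hX.base_eq (hZ'.fixed a ha'), haZ]
    have hℓ0 := hX.rpow_nonneg ha has hs.2
    have hℓρ : ω a s ^ γ ≤ ρ := (hX.rpow_mono ha le_rfl has hsb hb).trans hωρ.le
    have hzz : ‖z s - z' s‖ ≤ E * κ * (ρ * Λ ^ N) := by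
      refine (pi_norm_le_iff_of_nonneg (by positivity)).2 fun j => ?_
      have e1 : (z s - z' s) j = (z s j - z a j - ∑ i, X a s (L i (ev N (g i j) (Z a))))
          - (z' s j - z' a j - ∑ i, X a s (L i (ev N (g i j) (Z' a)))) := by
        rw [haZ, hza, Pi.sub_apply]; ring
      rw [e1]
      refine (hδ a s le_rfl has hsb j).trans ?_
      have : ω a s ^ γ ≤ Λ := hℓρ.trans hρΛ
      gcongr
    rw [(hF _ _).1 (hZ.fixed s hs), (hF _ _).1 (hZ'.fixed s hs)]
    refine (hFK _ _ _).trans ?_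
    have h3 : KF * (E * κ * (ρ * Λ ^ N)) = KF * E * Λ ^ N * ρ * κ := by ring
    have h4 : 0 ≤ Γ * E * ρ := by positivity
    have h5 : 0 ≤ d * Γ * (K₁ + Γ ^ 2 * K₁) * ρ := by positivity
    have h6 : KF * E * Λ ^ N * ρ ≤ 1 / 2 := by linarith
    have h7 := mul_le_mul_of_nonneg_right h6 hκ.le
    have h8 := mul_le_mul_of_nonneg_left hzz hKF
    linarith
  · have hs : s ∈ Icc 0 T := ⟨ha.trans has, hsu.trans (hub.trans hb)⟩
    have hu : u ∈ Icc 0 T := ⟨hs.1.trans hsu, hub.trans hb⟩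
    have hℓ0 := hX.rpow_nonneg hs.1 hsu hu.2
    have hrΛ := hrρ.trans hρΛ
    have f1 := hX.cocycleMap_sub_act (g := g) (c := c) hs.1 hsu hu.2 (z s) (z u) (Z s) (Z u) m
    have f2 := hX.cocycleMap_sub_act (g := g) (c := c) hs.1 hsu hu.2 (z' s) (z' u) (Z' s) (Z' u) m
    rw [← hZ.fixed s hs, ← hZ.fixed u hu] at f1
    rw [← hZ'.fixed s hs, ← hZ'.fixed u hu] at f2
    have e1 : (Z u m - act (X s u) (Z s m)) - (Z' u m - act (X s u) (Z' s m))
        = ((z u m - z s m - ∑ i, X s u (L i (ev N (g i m) (Z s))))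
          - (z' u m - z' s m - ∑ i, X s u (L i (ev N (g i m) (Z' s))))) • (1 : H)
          + ∑ i, L i (Y i u m - act (X s u) (Y i s m - gproj 𝒜 N (Y i s m))) := by
      rw [f1, f2]
      simp only [Y, map_sub, Finset.sum_sub_distrib, sub_smul]
      abel
    rw [e1]
    have g1 : P r (((z u m - z s m - ∑ i, X s u (L i (ev N (g i m) (Z s))))
          - (z' u m - z' s m - ∑ i, X s u (L i (ev N (g i m) (Z' s))))) • (1 : H))
        ≤ E * κ * (ρ * r ^ N) * Γ := by
      rw [map_smul_eq_mul, Real.norm_eq_abs]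
      refine mul_le_mul ((hδ s u has hsu hub m).trans ?_) (hX.one r) (apply_nonneg _ _)
        (by positivity)
      have := hℓr.trans hrρ
      gcongr
    have g2 := hX.sum_cocycle_le hr
      (y := fun i => Y i u m - act (X s u) (Y i s m - gproj 𝒜 N (Y i s m)))
      (C := K₁ * κ * r ^ N + Γ ^ 2 * r ^ N * (K₁ * κ)) fun i => by
        obtain ⟨k1, k2⟩ := hY i m s u has hsu hub
        refine (hX.sub_act_sub_top_le hs.1 hsu hu.2 hℓr hr hrΛ (k2 r hr hℓr hrρ)).trans ?_
        gcongr
    refine (map_add_le_add _ _ _).trans ((add_le_add g1 g2).trans ?_)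
    have h3 : d * Γ * (K₁ * κ * r ^ N + Γ ^ 2 * r ^ N * (K₁ * κ)) * r
        ≤ d * Γ * (K₁ * κ * r ^ N + Γ ^ 2 * r ^ N * (K₁ * κ)) * ρ := by gcongr
    have h4 : 0 ≤ KF * E * Λ ^ N * ρ := by positivity
    have h5 : Γ * E * ρ + d * Γ * (K₁ + Γ ^ 2 * K₁) * ρ ≤ 1 / 2 := by linarith
    have h6 : 0 ≤ κ * r ^ N := by positivity
    have h7 := mul_le_mul_of_nonneg_right h5 h6
    linarith

end Uniqueness

section Agreement

theorem chainSum_congr {V : Type*} [AddCommMonoid V] {Ξ Ξ' : ℝ → ℝ → V} {s t : ℝ}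
    (h : ∀ u v, s ≤ u → u < t → Ξ u v = Ξ' u v) (l : List ℝ) (hl : l.Pairwise (· < ·))
    (hmem : ∀ u ∈ l, s ≤ u ∧ u ≤ t) : chainSum Ξ l = chainSum Ξ' l := by
  induction l with
  | nil => rfl
  | cons u l ih =>
    cases l with
    | nil => rfl
    | cons v l =>
      rw [List.pairwise_cons] at hl
      have huv : u < v := hl.1 v (by simp)
      rw [chainSum, chainSum, ih hl.2 fun w hw => hmem w (List.mem_cons_of_mem _ hw),
        h u v (hmem u (by simp)).1 (huv.trans_le (hmem v (by simp)).2)]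

/-- The Riemann sums on `[s, t]` only involve germs which start before `t`. -/
theorem HasRRSLimit.congr {V : Type*} [NormedAddCommGroup V] {Ξ Ξ' : ℝ → ℝ → V} {s t : ℝ} {K : V}
    (hK : HasRRSLimit Ξ s t K) (h : ∀ u v, s ≤ u → u < t → Ξ u v = Ξ' u v) :
    HasRRSLimit Ξ' s t K := by
  intro ε hε
  obtain ⟨P₀, hP₀, hlim⟩ := hK ε hε
  refine ⟨P₀, hP₀, fun P hP hPP => ?_⟩
  rw [← chainSum_congr h _ (Finset.sortedLT_sort P |>.pairwise) fun u hu =>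
    hP.2.2 u ((Finset.mem_sort _).1 hu)]
  exact hlim P hP hPP

variable {H : Type*} [CommRing H] [Algebra ℝ H] [Coalgebra ℝ H]
variable {𝒜 : ℕ → Submodule ℝ H} [GradedAlgebra 𝒜] {nrm : Seminorm ℝ H} {N d e : ℕ}
  {L : Fin d → H →ₗ[ℝ] H} {γ T : ℝ} {ω : ℝ → ℝ → ℝ} {X : ℝ → ℝ → Module.Dual ℝ H}
  {P : ℝ → Seminorm ℝ H} {Γ Λ : ℝ} {g : Fin d → Fin e → (Fin e → ℝ) → ℝ} {M : ℝ}
  {c : Fin e → H}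

/-- Agreement propagates to the right of a point: halve the distance infinitely often. -/
theorem IsDriver.exists_eq_right [Module.Finite ℝ H] (hX : IsDriver 𝒜 nrm N L γ T ω X P Γ Λ)
    (hT : 0 ≤ T) (hg : ∀ i m, ContDiff ℝ (N + 1 : ℕ) (g i m)) (hM0 : 0 ≤ M)
    (hM : ∀ i m, ∀ n ≤ N, ∀ z, ‖iteratedFDeriv ℝ n (g i m) z‖ ≤ M) {A K K' : ℝ} (hA : 0 ≤ A)
    (hK : 0 ≤ K) (hK' : 0 ≤ K')
    {Z Z' : ℝ → Fin e → H} {z z' : ℝ → Fin e → ℝ} {G G' : Fin d → ℝ → Fin e → ℝ}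
    (hZ : IsSewnSolution N γ T ω X P Λ L g c A K Z z G)
    (hZ' : IsSewnSolution N γ T ω X P Λ L g c A K' Z' z' G') {a : ℝ} (ha : 0 ≤ a) (haT : a < T)
    (haZ : Z a = Z' a) : ∃ b, a < b ∧ b ≤ T ∧ ∀ s, a ≤ s → s ≤ b → Z s = Z' s := by
  have hΓ := zero_le_one.trans hX.one_le
  obtain ⟨ρ, hρ, hρΛ, hhalf⟩ := hX.halving hT hg hM0 hM hA hK hK' hZ hZ'
  obtain ⟨b, hab, hbT, hωb⟩ : ∃ b, a < b ∧ b ≤ T ∧ ω a b ^ γ < ρ := by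
    have h1 := hX.right a a ha le_rfl haT.le
    rw [hX.control.diag a ha haT.le] at h1
    have h2 : Tendsto (fun b => ω a b ^ γ) (𝓝[Ioc a T] a) (𝓝 (0 ^ γ)) :=
      ((Real.continuousAt_rpow_const 0 γ (Or.inr hX.exponent_pos.le)).tendsto).comp h1
    rw [Real.zero_rpow hX.exponent_pos.ne'] at h2
    have h3 : (𝓝[Ioc a T] a).NeBot := by
      rw [nhdsWithin_Ioc_eq_nhdsGT haT]; infer_instance
    obtain ⟨b, hb1, hb2⟩ := ((h2.eventually (gt_mem_nhds hρ)).and self_mem_nhdsWithin).exists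
    exact ⟨b, hb2.1, hb2.2, hb1⟩
  refine ⟨b, hab, hbT, ?_⟩
  set κ := 2 * A * Γ + 2 * A + 1 with hκ
  have hκ0 : 0 < κ := by positivity
  have hmem : ∀ {s}, a ≤ s → s ≤ b → s ∈ Icc 0 T := fun h1 h2 => ⟨ha.trans h1, h2.trans hbT⟩
  have key : ∀ n : ℕ, (∀ s, a ≤ s → s ≤ b → ∀ m, P 1 (Z s m - Z' s m) ≤ κ / 2 ^ n) ∧
        ∀ s u, a ≤ s → s ≤ u → u ≤ b → ∀ m, HasOrder P N (ω s u ^ γ) ρ (κ / 2 ^ n)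
          ((Z u m - act (X s u) (Z s m)) - (Z' u m - act (X s u) (Z' s m))) := by
    intro n
    induction n with
    | zero =>
      rw [pow_zero, div_one]
      refine ⟨fun s h1 h2 m => ?_, fun s u h1 h2 h3 m r hr hℓr hrρ => ?_⟩
      · have hs := hmem h1 h2
        have e1 : Z s m - Z' s m = (base (Z s) m - base (Z' s) m) • (1 : H)
            + (bar (Z s m) - bar (Z' s m)) := by
          simp only [base, bar_eq, sub_smul]; abel
        have h3 : |base (Z s) m - base (Z' s) m| ≤ 2 * A :=
          (abs_sub _ _).trans (by
            have h4 := (norm_le_pi_norm (base (Z s)) m).trans (hZ.base_le s hs)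
            have h5 := (norm_le_pi_norm (base (Z' s)) m).trans (hZ'.base_le s hs)
            rw [Real.norm_eq_abs] at h4 h5
            linarith)
        have h4 : P 1 ((base (Z s) m - base (Z' s) m) • (1 : H)) ≤ 2 * A * Γ := by
          rw [map_smul_eq_mul, Real.norm_eq_abs]
          exact mul_le_mul h3 (hX.one 1) (apply_nonneg _ _) (by positivity)
        have h5 := (map_sub_le_add (P 1) (bar (Z s m)) (bar (Z' s m))).trans
          (add_le_add (hZ.bar_le s hs m) (hZ'.bar_le s hs m))
        rw [e1]
        refine (map_add_le_add _ _ _).trans ?_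
        linarith
      · have hs := hmem h1 (h2.trans h3)
        have hu := hmem (h1.trans h2) h3
        have h4 := hZ.order s u hs.1 h2 hu.2 m r hr hℓr (hrρ.trans hρΛ)
        have h5 := hZ'.order s u hs.1 h2 hu.2 m r hr hℓr (hrρ.trans hρΛ)
        refine (map_sub_le_add _ _ _).trans ((add_le_add h4 h5).trans ?_)
        rw [← add_mul]
        have h6 : 0 ≤ 2 * A * Γ := by positivity
        exact mul_le_mul_of_nonneg_right (by linarith) (by positivity)
    | succ n ih =>
      have := hhalf a b ha hab.le hbT hωb haZ (κ / 2 ^ n) (by positivity) ih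
      rwa [div_div, ← pow_succ] at this
  intro s h1 h2
  ext m
  have hlim : Tendsto (fun n : ℕ => κ / 2 ^ n) atTop (𝓝 0) :=
    tendsto_const_nhds.div_atTop (tendsto_pow_atTop_atTop_of_one_lt one_lt_two)
  have h3 : P 1 (Z s m - Z' s m) ≤ 0 := ge_of_tendsto' hlim fun n => (key n).1 s h1 h2 m
  exact sub_eq_zero.1 (hX.definite _ (le_antisymm h3 (apply_nonneg _ _)))

/-- The supremum of the times up to which two solutions agree is `T`: they agree at this supremum,
and then a little to the right of it. -/
theorem IsDriver.evSolution_unique [Module.Finite ℝ H] (hX : IsDriver 𝒜 nrm N L γ T ω X P Γ Λ)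
    (hT : 0 ≤ T) (hg : ∀ i m, ContDiff ℝ (N + 1 : ℕ) (g i m)) (hM0 : 0 ≤ M)
    (hM : ∀ i m, ∀ n ≤ N, ∀ z, ‖iteratedFDeriv ℝ n (g i m) z‖ ≤ M) {Z Z' : ℝ → Fin e → H}
    {A A' : ℝ} (hA : 0 ≤ A) (hA' : 0 ≤ A')
    (hZ : ∀ s u, 0 ≤ s → s ≤ u → u ≤ T → ∀ m,
      HasOrder P N (ω s u ^ γ) Λ A (Z u m - act (X s u) (Z s m)))
    (hZ' : ∀ s u, 0 ≤ s → s ≤ u → u ≤ T → ∀ m,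
      HasOrder P N (ω s u ^ γ) Λ A' (Z' u m - act (X s u) (Z' s m)))
    (hsol : IsEvSolution N T X L g c Z) (hsol' : IsEvSolution N T X L g c Z') :
    EqOn Z Z' (Icc 0 T) := by
  have hgN : ∀ i m, ContDiff ℝ N (g i m) := fun i m =>
    (hg i m).of_le (by exact_mod_cast Nat.le_succ N)
  obtain ⟨B, K, z, G, hB, hK, hs⟩ := hX.exists_isSewnSolution hT hgN hM0 hM hA hZ hsol
  obtain ⟨B', K', z', G', hB', hK', hs'⟩ := hX.exists_isSewnSolution hT hgN hM0 hM hA' hZ' hsol'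
  have hr := hs.mono (le_add_of_nonneg_right hB' : B ≤ B + B')
  have hr' := hs'.mono (le_add_of_nonneg_left hB : B' ≤ B + B')
  -- at a given time, the equation only depends on the past
  have hleft : ∀ t ∈ Icc 0 T, (∀ s, 0 ≤ s → s < t → Z s = Z' s) → Z t = Z' t := by
    intro t ht h
    obtain ⟨I, hI, hfix⟩ := hsol
    obtain ⟨I', hI', hfix'⟩ := hsol'
    have hII : ∀ i, I i t = I' i t := fun i =>
      ((hI i t ht).congr fun u v h1 h2 => by simp only [h u h1 h2]).unique (hI' i t ht)
    have h1 := hfix t ht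
    simp only [hII] at h1
    exact hX.eq_of_fixed hgN hM0 hM (hfix' t ht) h1
  let S : Set ℝ := {t | t ∈ Icc 0 T ∧ ∀ s, 0 ≤ s → s < t → Z s = Z' s}
  have h0S : (0 : ℝ) ∈ S := ⟨⟨le_rfl, hT⟩, fun s h1 h2 => absurd h1 h2.not_ge⟩
  have hbdd : BddAbove S := ⟨T, fun t ht => ht.1.2⟩
  set τ := sSup S with hτ
  have hτ0 : 0 ≤ τ := le_csSup hbdd h0S
  have hτT : τ ≤ T := csSup_le ⟨0, h0S⟩ fun t ht => ht.1.2
  have hbefore : ∀ s, 0 ≤ s → s < τ → Z s = Z' s := by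
    intro s h1 h2
    obtain ⟨t, ht, hst⟩ := exists_lt_of_lt_csSup ⟨0, h0S⟩ h2
    exact ht.2 s h1 hst
  have hat := hleft τ ⟨hτ0, hτT⟩ hbefore
  rcases hτT.eq_or_lt with h | h
  · intro t ht
    rcases ht.2.eq_or_lt with h1 | h1
    · rw [h1, ← h]; exact hat
    · exact hbefore t ht.1 (by rw [h]; exact h1)
  · obtain ⟨b, hb, hbT, hext⟩ := hX.exists_eq_right hT hg hM0 hM (by positivity) hK hK' hr hr' hτ0 h
      hat
    have hbS : b ∈ S := ⟨⟨hτ0.trans hb.le, hbT⟩, fun s h1 h2 => by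
      rcases lt_or_ge s τ with h3 | h3
      · exact hbefore s h1 h3
      · exact hext s h3 h2.le⟩
    exact absurd (le_csSup hbdd hbS) hb.not_ge

end Agreement

/-! ### The image of a controlled path under a smooth function -/

section SmoothImage

theorem iteratedFDeriv_pd_apply {ι : Type*} [Fintype ι] [DecidableEq ι] {n : ℕ}
    {g : (ι → ℝ) → ℝ} (hg : ContDiff ℝ (n + 1 : ℕ) g) (x : ι → ℝ) (v : Fin n → ι → ℝ) (j : ι) :
    iteratedFDeriv ℝ n (pd j g) x v
      = iteratedFDeriv ℝ (n + 1) g x (Fin.snoc v (Pi.single j (1 : ℝ)) : Fin (n + 1) → ι → ℝ) := by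
  have hd : ContDiff ℝ n (fderiv ℝ g) := hg.fderiv_right (m := n) (by norm_cast)
  have h := (ContinuousLinearMap.apply ℝ ℝ (Pi.single j (1 : ℝ))).iteratedFDeriv_comp_left
    (f := fderiv ℝ g) (x := x) hd.contDiffAt (le_refl (n : WithTop ℕ∞))
  rw [iteratedFDeriv_succ_apply_right, Fin.init_snoc, Fin.snoc_last]
  exact congrArg (fun D => D v) h

theorem jet_eq_sum {ι A : Type*} [Fintype ι] [DecidableEq ι] [CommRing A] [Algebra ℝ A] (n : ℕ) :
    ∀ {g : (ι → ℝ) → ℝ}, ContDiff ℝ n g → ∀ (x : ι → ℝ) (b : ι → A), jet n g x b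
      = ∑ J : Fin n → ι, iteratedFDeriv ℝ n g x (fun k => Pi.single (J k) (1 : ℝ))
        • ∏ k, b (J k) := by
  induction n with
  | zero =>
    intro g _ x b
    simp [jet]
  | succ n ih =>
    intro g hg x b
    rw [jet, ← (Fin.snocEquiv fun _ : Fin (n + 1) => ι).sum_comp, Fintype.sum_prod_type]
    refine Finset.sum_congr rfl fun j _ => ?_
    rw [ih (ContDiff.pd hg j), Finset.mul_sum]
    refine Finset.sum_congr rfl fun J _ => ?_
    have e : (fun k => Pi.single ((Fin.snocEquiv fun _ : Fin (n + 1) => ι) (j, J) k) (1 : ℝ))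
        = (Fin.snoc (fun k => Pi.single (J k) (1 : ℝ)) (Pi.single j (1 : ℝ)) :
          Fin (n + 1) → ι → ℝ) := by
      ext k : 1
      refine Fin.lastCases ?_ (fun k => ?_) k <;> simp [Fin.snocEquiv]
    rw [iteratedFDeriv_pd_apply hg, e, Fin.prod_univ_castSucc]
    simp [Fin.snocEquiv, mul_comm]

theorem iteratedFDeriv_component {e n : ℕ} {φ : (Fin e → ℝ) → Fin e → ℝ} (hφ : ContDiff ℝ n φ)
    (x : Fin e → ℝ) (v : Fin n → Fin e → ℝ) (m : Fin e) :
    iteratedFDeriv ℝ n (fun x => φ x m) x v = iteratedFDeriv ℝ n φ x v m := by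
  have h := (ContinuousLinearMap.proj (R := ℝ) (φ := fun _ : Fin e => ℝ) m).iteratedFDeriv_comp_left
    (f := φ) (x := x) hφ.contDiffAt (le_refl (n : WithTop ℕ∞))
  exact congrArg (fun D => D v) h

theorem norm_iteratedFDeriv_component_le {e n : ℕ} {φ : (Fin e → ℝ) → Fin e → ℝ}
    (hφ : ContDiff ℝ n φ) (x : Fin e → ℝ) (m : Fin e) :
    ‖iteratedFDeriv ℝ n (fun x => φ x m) x‖ ≤ ‖iteratedFDeriv ℝ n φ x‖ := by
  refine ContinuousMultilinearMap.opNorm_le_bound (norm_nonneg _) fun v => ?_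
  rw [iteratedFDeriv_component hφ]
  exact (norm_le_pi_norm _ m).trans (ContinuousMultilinearMap.le_opNorm _ _)

variable {H : Type*} [CommRing H] [Algebra ℝ H] [Coalgebra ℝ H]

theorem smoothImage_eq_lift {e N : ℕ} {φ : (Fin e → ℝ) → Fin e → ℝ} (hφ : ContDiff ℝ N φ)
    (z : Fin e → H) (m : Fin e) :
    smoothImage N φ z m = lift (N + 1) (fun x => φ x m) (base z) fun j => bar (z j) := by
  rw [smoothImage, lift]
  refine Finset.sum_congr rfl fun n hn => ?_
  have hn' : ContDiff ℝ n φ :=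
    hφ.of_le (by exact_mod_cast Nat.lt_succ_iff.1 (Finset.mem_range.1 hn))
  rw [jet_eq_sum n (contDiff_pi.1 hn' m)]
  refine congrArg _ (Finset.sum_congr rfl fun J _ => ?_)
  rw [iteratedFDeriv_component hn']
  rfl

variable {𝒜 : ℕ → Submodule ℝ H} [GradedAlgebra 𝒜] {nrm : Seminorm ℝ H} {N d e : ℕ}
  {L : Fin d → H →ₗ[ℝ] H} {γ T : ℝ} {ω : ℝ → ℝ → ℝ} {X : ℝ → ℝ → Module.Dual ℝ H}
  {P : ℝ → Seminorm ℝ H} {Γ Λ : ℝ}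

/-- The cocycles do not see the last term of the Taylor series, which has top degree. -/
theorem IsDriver.cocycle_smoothImage (hX : IsDriver 𝒜 nrm N L γ T ω X P Γ Λ)
    {φ : (Fin e → ℝ) → Fin e → ℝ} (hφ : ContDiff ℝ N φ) (i : Fin d) (z : Fin e → H) (m : Fin e) :
    L i (smoothImage N φ z m) = L i (ev N (fun x => φ x m) z) := by
  have hΓ := zero_le_one.trans hX.one_le
  rw [smoothImage_eq_lift hφ, lift_succ, map_add, map_smul, ← ev]
  set h := jet N (fun x => φ x m) (base z) fun j => bar (z j) with hh
  set p := ∑ j, P 1 (bar (z j)) with hp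
  set M := ‖iteratedFDeriv ℝ N (fun x => φ x m) (base z)‖ with hM
  have h1 : ∀ r, 0 < r → r ≤ 1 → P 1 (L i h) ≤ Γ * (Γ * M * (e * (Γ * p)) ^ N) * r := by
    intro r hr hr1
    have hrΛ := hr1.trans hX.one_le_range
    have h2 : P r h ≤ Γ * M * (Fintype.card (Fin e) * (Γ * r * p)) ^ N :=
      jet_le (hX.mul_le r) (hX.one r) N (contDiff_pi.1 hφ m) le_rfl fun j =>
        hX.bar_le hr hrΛ (Finset.single_le_sum (f := fun j => P 1 (bar (z j)))
          (fun _ _ => apply_nonneg _ _) (Finset.mem_univ j))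
    have h3 := (hX.pow_mul_le r hr.le hr1 _).trans ((hX.cocycle_le i r hr h).trans
      (mul_le_mul_of_nonneg_left h2 (by positivity)))
    have h4 : 0 < r ^ N := pow_pos hr N
    refine le_of_mul_le_mul_left (h3.trans_eq ?_) h4
    rw [Fintype.card_fin, show (e : ℝ) * (Γ * r * p) = r * (e * (Γ * p)) by ring, mul_pow]
    ring
  have h2 : L i h = 0 :=
    hX.definite _ (le_antisymm (le_zero_of_forall_le_mul h1) (apply_nonneg _ _))
  rw [h2, smul_zero, add_zero]

/-- Controlled paths in terms of the scale of norms: the estimates on the components of the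
remainder are one estimate on its norms. -/
theorem IsDriver.mem_controlledPaths_iff (hX : IsDriver 𝒜 nrm N L γ T ω X P Γ Λ)
    {Z : ℝ → Fin e → H} : Z ∈ controlledPaths 𝒜 nrm N γ T ω X e ↔ ∃ A : ℝ, 0 ≤ A ∧
      ∀ s u, 0 ≤ s → s ≤ u → u ≤ T → ∀ m,
        HasOrder P N (ω s u ^ γ) Λ A (Z u m - act (X s u) (Z s m)) := by
  have hΓ := zero_le_one.trans hX.one_le
  have hpow : ∀ s u, 0 ≤ s → s ≤ u → u ≤ T → ∀ j ≤ N,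
      ω s u ^ (((N : ℝ) - j) * γ) = (ω s u ^ γ) ^ (N - j) := by
    intro s u h1 h2 h3 j hj
    rw [← Real.rpow_natCast, ← Real.rpow_mul (hX.control.nonneg s u h1 h2 h3), Nat.cast_sub hj,
      mul_comm]
  constructor
  · rintro ⟨C, hC⟩
    refine ⟨Γ * |C|, by positivity, fun s u h1 h2 h3 m r hr hℓr _ => ?_⟩
    rw [mul_assoc]
    refine hX.le_of_comp_le r hr.le |C| (abs_nonneg C) _ fun j hj => ?_
    rw [GradedAlgebra.proj_apply]
    refine (hC s u h1 h2 h3 j hj m).trans ?_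
    rw [hpow s u h1 h2 h3 j hj]
    have h4 := hX.rpow_nonneg h1 h2 h3
    have h5 := le_abs_self C
    gcongr
  · rintro ⟨A, -, hZ⟩
    refine ⟨A, fun s u h1 h2 h3 j hj m => ?_⟩
    rw [hpow s u h1 h2 h3 j hj, ← GradedAlgebra.proj_apply]
    refine le_apply_of_forall_gt (f := fun r => A * r ^ (N - j)) (by fun_prop)
      (hX.rpow_lt s u h1 h2 h3) fun r hr hrΛ => ?_
    have hr0 := (hX.rpow_nonneg h1 h2 h3).trans_lt hr
    have h4 := (hX.comp_le r hr0.le j hj _).trans (hZ s u h1 h2 h3 m r hr0 hr.le hrΛ)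
    have h5 : r ^ N = r ^ j * r ^ (N - j) := by rw [← pow_add, Nat.add_sub_cancel' hj]
    refine le_of_mul_le_mul_left (h4.trans_eq ?_) (pow_pos hr0 j)
    rw [h5]; ring

theorem IsDriver.isSolution_iff (hX : IsDriver 𝒜 nrm N L γ T ω X P Γ Λ)
    {φ : Fin d → (Fin e → ℝ) → Fin e → ℝ} (hφ : ∀ i, ContDiff ℝ N (φ i)) {c : Fin e → H}
    {Z : ℝ → Fin e → H} : IsSolution N T X L φ c Z
      ↔ IsEvSolution N T X L (fun i m x => φ i x m) c Z := by
  have key : ∀ (K : Fin d → ℝ → Fin e → ℝ) t m,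
      c m + ∑ i, (L i (smoothImage N (φ i) (Z t) m) + K i t m • (1 : H))
        = cocycleMap N L (fun i m x => φ i x m) c (base c + ∑ i, K i t) (Z t) m := by
    intro K t m
    simp only [hX.cocycle_smoothImage (hφ _), cocycleMap, Pi.add_apply, Finset.sum_apply,
      add_smul, Finset.sum_smul, Finset.sum_add_distrib, bar_eq, base]
    abel
  unfold IsSolution IsEvSolution HasRoughIntegral
  simp only [key, funext_iff]
  simp only [hX.cocycle_smoothImage (hφ _)]

end SmoothImage

end RoughHopf

open RoughHopf in
theorem theorem6p2 {H : Type*} [CommRing H] [Algebra ℝ H] [Coalgebra ℝ H]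
    (𝒜 : ℕ → Submodule ℝ H) [GradedAlgebra 𝒜] (N d e : ℕ)
    (hH : IsTruncatedHopf 𝒜 N)
    (B : LinearMap.BilinForm ℝ H) (L : Fin d → H →ₗ[ℝ] H) (hL : IsCocycleSystem 𝒜 N B L)
    (nrm : Seminorm ℝ H) (hnrm : ∀ h, nrm h = 0 → h = 0)
    (γ : ℝ) (hγ : 0 < γ) (hγ' : γ ≤ 1) (hN : N = ⌊1 / γ⌋₊)
    (T : ℝ) (hT : 0 < T)
    (ω : ℝ → ℝ → ℝ) (hω : IsControl T ω) (hω' : IsRightContinuous T ω)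
    (x : ℝ → Module.Dual ℝ (𝒜 1)) (X : ℝ → ℝ → Module.Dual ℝ H)
    (hX : IsRoughPath 𝒜 nrm N γ T ω x X)
    (φ : Fin d → (Fin e → ℝ) → (Fin e → ℝ)) (hφ : ∀ i, ContDiff ℝ (N + 1) (φ i))
    (hφ' : ∀ i, ∀ n ≤ N, ∃ M : ℝ, ∀ z, ‖iteratedFDeriv ℝ n (φ i) z‖ ≤ M) :
    (∀ ξ : Fin e → ℝ, (fun _ m => ξ m • (1 : H)) ∈ controlledPaths 𝒜 nrm N γ T ω X e) ∧
    ∀ c : Fin e → H, (fun _ => c) ∈ controlledPaths 𝒜 nrm N γ T ω X e →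
      ∃ Z ∈ controlledPaths 𝒜 nrm N γ T ω X e, IsSolution N T X L φ c Z ∧
        ∀ Z' ∈ controlledPaths 𝒜 nrm N γ T ω X e, IsSolution N T X L φ c Z' →
          Set.EqOn Z' Z (Set.Icc 0 T) := by
  obtain ⟨P, Γ, Λ, hD⟩ := exists_isDriver hH hL hnrm hγ hγ' hN hT hω hω' hX
  have hfin : Module.Finite ℝ H := finite_of_grading hH.truncated hH.finite
  have hφN : ∀ i, ContDiff ℝ N (φ i) := fun i => (hφ i).of_le (by exact_mod_cast Nat.le_succ N)
  let g : Fin d → Fin e → (Fin e → ℝ) → ℝ := fun i m x => φ i x m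
  have hg : ∀ i m, ContDiff ℝ (N + 1 : ℕ) (g i m) := fun i m => contDiff_pi.1 (hφ i) m
  have hgN : ∀ i m, ContDiff ℝ N (g i m) := fun i m => contDiff_pi.1 (hφN i) m
  obtain ⟨M, hM0, hM⟩ : ∃ M : ℝ, 0 ≤ M ∧ ∀ i m, ∀ n ≤ N, ∀ z,
      ‖iteratedFDeriv ℝ n (g i m) z‖ ≤ M := by
    choose! M hM using hφ'
    refine ⟨∑ i, ∑ n ∈ Finset.range (N + 1), |M i n|, by positivity, fun i m n hn z => ?_⟩
    refine (norm_iteratedFDeriv_component_le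
      ((hφN i).of_le (by exact_mod_cast hn)) z m).trans ((hM i n hn z).trans ?_)
    refine (le_abs_self _).trans ((Finset.single_le_sum (f := fun n => |M i n|)
      (fun _ _ => abs_nonneg _) (Finset.mem_range.2 (Nat.lt_succ_of_le hn))).trans ?_)
    exact Finset.single_le_sum (f := fun i => ∑ n ∈ Finset.range (N + 1), |M i n|)
      (fun _ _ => by positivity) (Finset.mem_univ i)
  refine ⟨fun ξ => ⟨0, fun s t h1 h2 h3 j _ m => ?_⟩, fun c hc => ?_⟩
  · rw [remainder, map_smul, hD.act_one s t h1 h2 h3, sub_self]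
    simp
  · obtain ⟨C, hC, hc⟩ := hD.mem_controlledPaths_iff.1 hc
    obtain ⟨Z, hZ, A, hA, hZA⟩ := hD.exists_evSolution hT.le hgN hM0 hM hC hc
    refine ⟨Z, hD.mem_controlledPaths_iff.2 ⟨A, hA, hZA⟩, (hD.isSolution_iff hφN).2 hZ,
      fun Z' hZ' hsol' => ?_⟩
    obtain ⟨A', hA', hZA'⟩ := hD.mem_controlledPaths_iff.1 hZ'
    exact hD.evSolution_unique hT.le hg hM0 hM hA' hA hZA' hZA ((hD.isSolution_iff hφN).1 hsol') hZ
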